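/- Conventions. A simplicial complex is a finite abstract simplicial complex: a finite family $K$ of finite sets (simplexes) such that every subset (face) of a simplex of $K$ is again a simplex of $K$; the empty simplex is a face of every simplex, and $v$ is a vertex of $K$ if $\{v\}\in K$. For complexes $K,L$ without common vertices, the join is $K\star L=\{A\cup B : A\in K,\ B\in L\}$. A simplex $A$ also denotes the complex of all its faces, and $\partial A$ is the complex of its proper faces. For $A\in K$, the link is $\mathrm{lk}(A,K)=\{B\in K : A\cap B=\emptyset,\ A\cup B\in K\}$ and the star is $\mathrm{st}(A,K)=A\star \mathrm{lk}(A,K)$. If $A$ is a non-empty simplex of $K$ and $a$ is not a vertex of $K$, the stellar subdivision $(A,a)K$ is obtained from $K$ by removing $\mathrm{st}(A,K)$ and inserting $a\star\partial A\star \mathrm{lk}(A,K)$; the inverse operation is a stellar weld. A simplicial isomorphism is a bijection between the vertices of two complexes that induces a bijection between their simplexes. Two complexes are stellar equivalent if they are related by a finite sequence of stellar subdivisions, stellar welds and simplicial isomorphisms. For $n\ge 0$, let $\Delta^n$ be the complex of all faces of an $n$-simplex (a set of $n+1$ vertices), and $\partial\Delta^n$ the complex of its proper faces. A stellar $n$-ball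 is a complex stellar equivalent to $\Delta^n$; a stellar $n$-sphere is a complex stellar equivalent to $\partial\Delta^{n+1}$. Theorem 3.8 (Newman). Let $n\ge 0$, let $S$ be a stellar $n$-sphere and let $K\subseteq S$ be a subcomplex that is a stellar $n$-ball. Then the closure of $S-K$, that is, the subcomplex of $S$ consisting of all simplexes of $S$ that are not in $K$ together with all their faces, is a stellar $n$-ball. -/

import Mathlib

/-!
Stellar theory of finite abstract simplicial complexes.  Stellar moves and isomorphisms preserve
finiteness, so every complex stellar equivalent to a finite one is finite.

Complexes are Mathlib's `PreAbstractSimplicialComplex V`: a downward closed family of nonempty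
finite subsets of `V`.  The elements of `V` that are vertices of `K` are those `v` with `{v} ∈ K`;
`V` may have further elements.  The empty simplex, which is a face of every simplex, is not listed
among the faces; it is put back by `IsSimplexOrEmpty` wherever it plays a role.
-/

universe u v

namespace Stellar

/-- `s` is a simplex of `K`, the empty simplex being allowed. -/
def IsSimplexOrEmpty {V : Type u} (K : PreAbstractSimplicialComplex V) (s : Finset V) : Prop :=
  s = ∅ ∨ s ∈ K

/-- The set of vertices of a complex. -/
def vertices {V : Type u} (K : PreAbstractSimplicialComplex V) : Set V :=
  {x | {x} ∈ K}

/-- The complex consisting of the simplex `A` and all its faces. -/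
def simplex {V : Type u} (A : Finset V) : PreAbstractSimplicialComplex V where
  faces := {s | s.Nonempty ∧ s ⊆ A}
  isRelLowerSet_faces := fun _ hs => ⟨hs.1, fun _ ht hne => ⟨hne, ht.trans hs.2⟩⟩

/-- The complex `∂A` of all proper faces of the simplex `A`. -/
def boundary {V : Type u} (A : Finset V) : PreAbstractSimplicialComplex V where
  faces := {s | s.Nonempty ∧ s ⊂ A}
  isRelLowerSet_faces := fun _ hs =>
    ⟨hs.1, fun _ ht hne => ⟨hne, Finset.ssubset_of_subset_of_ssubset ht hs.2⟩⟩

open Classical in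
/-- The join `K ⋆ L = {A ⋆ B : A ∈ K, B ∈ L}`, empty simplexes included.  It is used only for
complexes without common vertices. -/
def join {V : Type u} (K L : PreAbstractSimplicialComplex V) : PreAbstractSimplicialComplex V where
  faces := {s | s.Nonempty ∧ ∃ A B, IsSimplexOrEmpty K A ∧ IsSimplexOrEmpty L B ∧ s = A ∪ B}
  isRelLowerSet_faces := by
    have key : ∀ (M : PreAbstractSimplicialComplex V) (A t : Finset V),
        IsSimplexOrEmpty M A → IsSimplexOrEmpty M (t ∩ A) := by
      intro M A t hA
      rcases (t ∩ A).eq_empty_or_nonempty with h | h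
      · exact Or.inl h
      · rcases hA with rfl | hA
        · exact absurd h (by simp)
        · exact Or.inr ((M.isRelLowerSet_faces hA).2 Finset.inter_subset_right h)
    rintro s ⟨hs, A, B, hA, hB, rfl⟩
    refine ⟨hs, fun t ht hne => ⟨hne, t ∩ A, t ∩ B, key K A t hA, key L B t hB, ?_⟩⟩
    rw [← Finset.inter_union_distrib_left]
    exact (Finset.inter_eq_left.2 ht).symm

open Classical in
/-- The link `lk(A, K)`: the simplexes `B` of `K`, disjoint from `A`, with `A ⋆ B ∈ K`. -/
def link {V : Type u} (A : Finset V) (K : PreAbstractSimplicialComplex V) :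
    PreAbstractSimplicialComplex V where
  faces := {B | B ∈ K ∧ Disjoint A B ∧ A ∪ B ∈ K}
  isRelLowerSet_faces := by
    rintro B ⟨hB, hd, hAB⟩
    refine ⟨(K.isRelLowerSet_faces hB).1, fun t ht hne => ⟨?_, ?_, ?_⟩⟩
    · exact (K.isRelLowerSet_faces hB).2 ht hne
    · exact Finset.disjoint_of_subset_right ht hd
    · exact (K.isRelLowerSet_faces hAB).2 (Finset.union_subset_union_right ht)
        (hne.mono Finset.subset_union_right)

/-- The closed star `st(A, K) = A ⋆ lk(A, K)`. -/
def closedStar {V : Type u} (A : Finset V) (K : PreAbstractSimplicialComplex V) :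
    PreAbstractSimplicialComplex V :=
  join (simplex A) (link A K)

/-- The complex `(A, a)K` obtained by starring `K` at `a`: remove `st(A, K)` and replace it with
`a ⋆ ∂A ⋆ lk(A, K)`.  (The operation is meant for a simplex `A` of `K` and a new vertex `a`.) -/
def starring {V : Type u} (A : Finset V) (a : V) (K : PreAbstractSimplicialComplex V) :
    PreAbstractSimplicialComplex V where
  faces := {s | s ∈ K ∧ s ∉ closedStar A K} ∪
    {s | s ∈ join (simplex {a}) (join (boundary A) (link A K))}
  isRelLowerSet_faces := by
    classical
    rintro s (⟨hs, hst⟩ | hs)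
    · refine ⟨(K.isRelLowerSet_faces hs).1, fun t ht hne => ?_⟩
      have htK : t ∈ K := (K.isRelLowerSet_faces hs).2 ht hne
      by_cases htst : t ∈ closedStar A K
      · right
        obtain ⟨-, P, Q, hP, hQ, rfl⟩ := htst
        refine ⟨hne, ∅, P ∪ Q, Or.inl rfl, Or.inr ⟨hne, P, Q, ?_, hQ, rfl⟩, by simp⟩
        rcases hP with rfl | ⟨hP1, hP2⟩
        · exact Or.inl rfl
        · refine Or.inr ⟨hP1, Finset.ssubset_iff_subset_ne.2 ⟨hP2, ?_⟩⟩
          rintro rfl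
          have hPs : P ⊆ s := Finset.subset_union_left.trans ht
          refine hst ⟨(K.isRelLowerSet_faces hs).1, P, s \ P, Or.inr ⟨hP1, subset_rfl⟩, ?_,
            (Finset.union_sdiff_of_subset hPs).symm⟩
          rcases (s \ P).eq_empty_or_nonempty with h | h
          · exact Or.inl h
          · refine Or.inr ⟨(K.isRelLowerSet_faces hs).2 Finset.sdiff_subset h,
              Finset.disjoint_sdiff, ?_⟩
            rwa [Finset.union_sdiff_of_subset hPs]
      · exact Or.inl ⟨htK, htst⟩
    · have h := (join (simplex {a}) (join (boundary A) (link A K))).isRelLowerSet_faces hs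
      exact ⟨h.1, fun t ht hne => Or.inr (h.2 ht hne)⟩

/-- `K'` is the stellar subdivision `(A, a)K` of `K`, for a simplex `A` of `K` and a new vertex
`a`; equivalently `K` is obtained from `K'` by the stellar weld `(A, a)⁻¹`. -/
def IsStellarSubdivision {V : Type u} (A : Finset V) (a : V)
    (K K' : PreAbstractSimplicialComplex V) : Prop :=
  A ∈ K ∧ a ∉ vertices K ∧ K' = starring A a K

/-- Simplicial isomorphism: a bijection between the vertices that induces a bijection between the
simplexes. -/
def SimplicialIso {V : Type u} {W : Type v} (K : PreAbstractSimplicialComplex V)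
    (L : PreAbstractSimplicialComplex W) : Prop :=
  ∃ e : vertices K ≃ vertices L, ∀ s : Finset (vertices K),
    s.map (Function.Embedding.subtype _) ∈ K ↔
      (s.map e.toEmbedding).map (Function.Embedding.subtype _) ∈ L

/-- Stellar equivalence `K ∼ L`: `L` is obtained from `K` by a finite sequence of stellar
subdivisions, stellar welds and simplicial isomorphisms. -/
inductive StellarEquiv {V : Type u} (K : PreAbstractSimplicialComplex V) :
    ∀ {W : Type u}, PreAbstractSimplicialComplex W → Prop
  | refl : StellarEquiv K K
  | subdivide {W : Type u} {L M : PreAbstractSimplicialComplex W} (A : Finset W) (a : W) :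
      StellarEquiv K L → IsStellarSubdivision A a L M → StellarEquiv K M
  | weld {W : Type u} {L M : PreAbstractSimplicialComplex W} (A : Finset W) (a : W) :
      StellarEquiv K L → IsStellarSubdivision A a M L → StellarEquiv K M
  | iso {W X : Type u} {L : PreAbstractSimplicialComplex W} {M : PreAbstractSimplicialComplex X} :
      StellarEquiv K L → SimplicialIso L M → StellarEquiv K M

/-- The standard complex `Δⁿ`: an `n`-simplex and all its faces. -/
def stdComplex (n : ℕ) : PreAbstractSimplicialComplex (ULift.{u} (Fin (n + 1))) :=
  simplex Finset.univ

/-- The boundary `∂Δⁿ` of the standard complex. -/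
def stdBoundary (n : ℕ) : PreAbstractSimplicialComplex (ULift.{u} (Fin (n + 1))) :=
  boundary Finset.univ

/-- A stellar `n`-ball is a complex stellar equivalent to `Δⁿ`. -/
def IsStellarBall {V : Type u} (n : ℕ) (B : PreAbstractSimplicialComplex V) : Prop :=
  StellarEquiv B (stdComplex.{u} n)

/-- A stellar `n`-sphere is a complex stellar equivalent to `∂Δⁿ⁺¹`. -/
def IsStellarSphere {V : Type u} (n : ℕ) (S : PreAbstractSimplicialComplex V) : Prop :=
  StellarEquiv S (stdBoundary.{u} (n + 1))

/-- The closure of `S - K`: the simplexes of `S` that are not in `K`, together with all their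
faces. -/
def closureDiff {V : Type u} (S K : PreAbstractSimplicialComplex V) :
    PreAbstractSimplicialComplex V where
  faces := {t | t.Nonempty ∧ ∃ s ∈ S, s ∉ K ∧ t ⊆ s}
  isRelLowerSet_faces := by
    rintro t ⟨hne, s, hs, hsK, hts⟩
    exact ⟨hne, fun r hr hrne => ⟨hrne, s, hs, hsK, hr.trans hts⟩⟩

end Stellar

/-! A pure complex is encoded as the mod 2 sum of its facets. Such sums form a commutative ring: the
product of disjoint simplexes is their join, that of meeting simplexes is zero, and the boundary `d`
is a derivation. A stellar subdivision replaces `A * P + Q` by `a * ∂A * P + Q`, where `P` is the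
link of `A`. Geometric constructions thus become ring identities, with side conditions ensuring that
pieces meet only where they should. Since the vertex set `ι` is infinite, isomorphisms need not be
listed among the moves: starring at a vertex renames it.

Newman's theorem is proved by induction on the dimension, as an invariance statement: the property
that the complement of `K` is a ball in every sphere containing `K` (`ComplBall`) does not change
under a stellar move of `K`. So it is enough to treat a single simplex.

The first ingredient is an exchange principle. If `R` is a cycle, then `A * ∂B * R` and `∂A * B * R`
have the common subdivision `z * ∂A * ∂B * R` (`repl_flip`). For a ball or sphere `P` the cone `x *
P` may play the role of `B`: the piece `A * (P + x * ∂P)` may be exchanged for `x * ∂A * P`, also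
after a join with a further cycle (`Phi`). This is transported along the moves that turn `P` into a
standard model, by induction on the dimension (`repl_cone_subdivision`, `repl_cone_weld`,
`BallOrSph.phiJoin`). With `A` a vertex it shows that gluing `u * z * ∂W` to a chain in which the
link of `u` is a ball `W` does not change its type (`eqv_cone_star`).

The second ingredient is that the only mod 2 cycles made of facets of a sphere are zero and the
whole sphere (`Sph.irr`). Hence any two facets are joined by a path through ridges. Deleting either
of two adjacent facets gives equivalent chains, so deleting any facet gives a ball
(`Sph.ball_add_facet`). This is the theorem for a single simplex.

For the invariance let `K = A * P + R` and `K' = x * ∂A * P + R`. The property passes from `K'` to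
`K` by subdividing the whole sphere at `A`. In the other direction, let `X` be the complement of
`K'`; after a subdivision `A` is not in `X`. The exchange turns `K' + X` into `K + (X + A * x *
∂P)`, so `X + A * x * ∂P` is a ball. If `∂P` is not zero, the link of `x` in `X` is complementary to
the ball `∂A * P` in the link of `x` in the sphere, hence a ball by induction, and `eqv_cone_star`
removes the extra piece.

Finally the result is carried from chains to complexes. The move sequence is followed back from the
standard model, and purity of the chain at hand makes every move of complexes a move of chains. -/

set_option linter.unusedSectionVars false

/-! ### The ring of mod 2 chains and the boundary derivation. -/

namespace StellarChain

/-- Mod 2 chains: finite sets of finite sets, added by symmetric difference. -/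
def Chain (ι : Type*) : Type _ := Finset ι →₀ ZMod 2

noncomputable section

variable {ι : Type*}

instance : AddCommGroup (Chain ι) := inferInstanceAs (AddCommGroup (Finset ι →₀ ZMod 2))
instance : Module (ZMod 2) (Chain ι) := inferInstanceAs (Module (ZMod 2) (Finset ι →₀ ZMod 2))

/-- The finite set of simplexes that occur in a chain. -/
def supp (K : Chain ι) : Finset (Finset ι) := Finsupp.support K

/-- The chain with the single simplex `A`. -/
def e (A : Finset ι) : Chain ι := Finsupp.single A 1

theorem finsupp_ext_of_support {α : Type*} {f g : α →₀ ZMod 2} (h : f.support = g.support) :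
    f = g := by
  ext m
  have h2 : ∀ x y : ZMod 2, (x ≠ 0 ↔ y ≠ 0) → x = y := by decide
  exact h2 _ _ (by simpa only [Finsupp.mem_support_iff] using Finset.ext_iff.1 h m)

theorem finsupp_mem_support_add {α : Type*} {f g : α →₀ ZMod 2} {m : α} :
    m ∈ (f + g).support ↔ Xor (m ∈ f.support) (m ∈ g.support) := by
  have h2 : ∀ x y : ZMod 2, x + y ≠ 0 ↔ Xor (x ≠ 0) (y ≠ 0) := by unfold Xor; decide
  simpa only [Finsupp.mem_support_iff, Finsupp.add_apply] using h2 (f m) (g m)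

theorem chain_ext {K L : Chain ι} (h : supp K = supp L) : K = L :=
  finsupp_ext_of_support h

theorem mem_supp_add {K L : Chain ι} {m : Finset ι} :
    m ∈ supp (K + L) ↔ Xor (m ∈ supp K) (m ∈ supp L) :=
  finsupp_mem_support_add

@[simp] theorem supp_zero : supp (0 : Chain ι) = ∅ := Finsupp.support_zero

@[simp] theorem supp_e (A : Finset ι) : supp (e A) = {A} :=
  Finsupp.support_single A one_ne_zero

theorem supp_eq_empty {K : Chain ι} : supp K = ∅ ↔ K = 0 := Finsupp.support_eq_empty

@[elab_as_elim]
theorem chain_induction {p : Chain ι → Prop} (K : Chain ι) (h0 : p 0) (he : ∀ A, p (e A))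
    (ha : ∀ K L, p K → p L → p (K + L)) : p K := by
  refine Finsupp.induction_linear (motive := fun K => p K) K h0 ha ?_
  intro A c
  have : ∀ c : ZMod 2, c = 0 ∨ c = 1 := by decide
  rcases this c with rfl | rfl
  · have : (Finsupp.single A 0 : Finset ι →₀ ZMod 2) = 0 := Finsupp.single_zero A
    rw [this]; exact h0
  · exact he A

theorem add_self (K : Chain ι) : K + K = 0 := by
  have : (2 : ZMod 2) • K = 0 := by
    rw [show (2 : ZMod 2) = 0 from rfl, zero_smul]
  rwa [two_smul] at this

/-- Extend a function on simplexes to a linear map on chains. -/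
def extend {M : Type*} [AddCommGroup M] [Module (ZMod 2) M] (f : Finset ι → M) :
    Chain ι →ₗ[ZMod 2] M := Finsupp.linearCombination (ZMod 2) f

@[simp] theorem extend_e {M : Type*} [AddCommGroup M] [Module (ZMod 2) M] (f : Finset ι → M)
    (A : Finset ι) : extend f (e A) = f A := by
  exact (Finsupp.linearCombination_single (ZMod 2) 1 A).trans (one_smul _ _)

variable [DecidableEq ι]

/-- The product of chains as a bilinear map. -/
def mulL : Chain ι →ₗ[ZMod 2] Chain ι →ₗ[ZMod 2] Chain ι :=
  extend fun A => extend fun B => if Disjoint A B then e (A ∪ B) else 0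

instance : Mul (Chain ι) := ⟨fun K L => mulL K L⟩
instance : One (Chain ι) := ⟨e ∅⟩

theorem mul_def (K L : Chain ι) : K * L = mulL K L := rfl
theorem one_def : (1 : Chain ι) = e ∅ := rfl

theorem e_mul_e_ite (A B : Finset ι) :
    e A * e B = if Disjoint A B then e (A ∪ B) else 0 := by
  rw [mul_def, mulL, extend_e, extend_e]

theorem e_mul_e {A B : Finset ι} (h : Disjoint A B) : e A * e B = e (A ∪ B) := by
  rw [e_mul_e_ite, if_pos h]

theorem add_mul' (K L M : Chain ι) : (K + L) * M = K * M + L * M := by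
  simp [mul_def]
theorem mul_add' (K L M : Chain ι) : K * (L + M) = K * L + K * M := by
  simp [mul_def]
theorem zero_mul' (M : Chain ι) : 0 * M = 0 := by simp [mul_def]
theorem mul_zero' (M : Chain ι) : M * 0 = 0 := by simp [mul_def]

theorem mul_comm' (K L : Chain ι) : K * L = L * K := by
  refine chain_induction K ?_ ?_ ?_
  · rw [zero_mul', mul_zero']
  · intro A
    refine chain_induction L ?_ ?_ ?_
    · rw [zero_mul', mul_zero']
    · intro B
      simp only [e_mul_e_ite, disjoint_comm (a := B), Finset.union_comm B]
    · intro K L h1 h2; rw [add_mul', mul_add', h1, h2]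
  · intro K L h1 h2; rw [add_mul', mul_add', h1, h2]

theorem mul_assoc' (K L M : Chain ι) : K * L * M = K * (L * M) := by
  refine chain_induction K ?_ ?_ ?_
  · simp only [zero_mul']
  · intro A
    refine chain_induction L ?_ ?_ ?_
    · simp only [zero_mul', mul_zero']
    · intro B
      refine chain_induction M ?_ ?_ ?_
      · simp only [mul_zero']
      · intro C
        rw [e_mul_e_ite A B, e_mul_e_ite B C]
        by_cases h1 : Disjoint A B <;> by_cases h2 : Disjoint B C <;> by_cases h3 : Disjoint A C <;>
          simp [h1, h2, h3, e_mul_e_ite, zero_mul', mul_zero', Finset.disjoint_union_left,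
            Finset.disjoint_union_right, Finset.union_assoc]
      · intro K L h1 h2; simp only [mul_add', h1, h2]
    · intro K L h1 h2; simp only [mul_add', add_mul', h1, h2]
  · intro K L h1 h2; simp only [add_mul', h1, h2]

theorem one_mul' (K : Chain ι) : 1 * K = K := by
  refine chain_induction K ?_ ?_ ?_
  · simp only [mul_zero']
  · intro A
    rw [one_def, e_mul_e (Finset.disjoint_empty_left A), Finset.empty_union]
  · intro K L h1 h2; simp only [mul_add', h1, h2]

instance : CommRing (Chain ι) :=
  { (inferInstance : AddCommGroup (Chain ι)) with
    mul := (· * ·)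
    one := 1
    left_distrib := mul_add'
    right_distrib := add_mul'
    zero_mul := zero_mul'
    mul_zero := mul_zero'
    mul_assoc := mul_assoc'
    one_mul := one_mul'
    mul_one := fun K => by rw [mul_comm', one_mul']
    mul_comm := mul_comm' }

/-- Multiples of this identity are fed to `linear_combination` wherever a term occurs twice and
cancels. -/
theorem two_eq_zero : (2 : Chain ι) = 0 := by
  rw [← one_add_one_eq_two, add_self]

theorem e_empty : e (∅ : Finset ι) = 1 := rfl

theorem e_union {A B : Finset ι} (h : Disjoint A B) : e (A ∪ B) = e A * e B := (e_mul_e h).symm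

theorem e_insert {A : Finset ι} {v : ι} (h : v ∉ A) : e (insert v A) = e {v} * e A := by
  rw [Finset.insert_eq, e_union (by simpa using h)]

theorem e_erase {A : Finset ι} {v : ι} (h : v ∈ A) : e A = e {v} * e (A.erase v) := by
  rw [← e_insert (Finset.notMem_erase v A), Finset.insert_erase h]

/-- The boundary of a chain. -/
def d : Chain ι →ₗ[ZMod 2] Chain ι := extend fun A => ∑ v ∈ A, e (A.erase v)

theorem d_e (A : Finset ι) : d (e A) = ∑ v ∈ A, e (A.erase v) := by
  rw [d, extend_e]

@[simp] theorem d_one : d (1 : Chain ι) = 0 := by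
  rw [one_def, d_e, Finset.sum_empty]

@[simp] theorem d_vertex (v : ι) : d (e {v}) = 1 := by
  rw [d_e, Finset.sum_singleton, Finset.erase_singleton, e_empty]

/-- The cone formula. When `v` already lies in the simplex the left side vanishes, and on the right
the only surviving term of `v * ∂A` is `A` itself, which cancels mod 2. -/
theorem d_vertex_mul (v : ι) (K : Chain ι) : d (e {v} * K) = K + e {v} * d K := by
  refine chain_induction K ?_ ?_ ?_
  · simp
  · intro A
    by_cases hv : v ∈ A
    · have h1 : e {v} * e A = 0 := by
        rw [e_mul_e_ite, if_neg (by simpa using hv)]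
      rw [h1, map_zero, d_e, Finset.mul_sum, Finset.sum_eq_single_of_mem v hv, ← e_erase hv,
        add_self]
      intro w _ hwv
      rw [e_mul_e_ite, if_neg]
      simp [hv, Ne.symm hwv]
    · rw [← e_insert hv, d_e, Finset.sum_insert hv, Finset.erase_insert hv, d_e, Finset.mul_sum]
      congr 1
      refine Finset.sum_congr rfl fun w hw => ?_
      have hvw : v ≠ w := fun h => hv (h ▸ hw)
      rw [Finset.erase_insert_of_ne hvw, e_insert]
      exact fun h => hv (Finset.mem_of_mem_erase h)
  · intro K L h1 h2
    rw [mul_add, map_add, h1, h2, map_add]; ring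

/-- Every simplex is a product of vertices, so this follows from the cone formula; signs disappear
mod 2. -/
theorem d_mul (K L : Chain ι) : d (K * L) = d K * L + K * d L := by
  refine chain_induction K ?_ ?_ ?_
  · simp
  · intro A
    induction A using Finset.induction_on with
    | empty => rw [e_empty]; simp
    | insert v A hv ih =>
      rw [e_insert hv, mul_assoc, d_vertex_mul, ih, d_vertex_mul]; ring
  · intro K M h1 h2
    rw [add_mul, map_add, h1, h2, map_add]; ring

@[simp] theorem d_d (K : Chain ι) : d (d K) = 0 := by
  refine chain_induction K ?_ ?_ ?_
  · simp
  · intro A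
    induction A using Finset.induction_on with
    | empty => rw [e_empty]; simp
    | insert v A hv ih =>
      rw [e_insert hv, d_vertex_mul, map_add, d_vertex_mul, ih, mul_zero, add_zero, add_self]
  · intro K L h1 h2
    rw [map_add, map_add, h1, h2, add_zero]

end

end StellarChain

/-! ### Faces and vertices of chains, stellar moves, renaming and links. -/

namespace StellarChain

noncomputable section

variable {ι : Type*} [DecidableEq ι]

/-- `G` is a (possibly empty) face of a simplex of the chain `K`. -/
def Face (K : Chain ι) (G : Finset ι) : Prop := ∃ m ∈ supp K, G ⊆ m

/-- The vertices of a chain. -/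
def vars (K : Chain ι) : Finset ι := (supp K).biUnion id

theorem mem_vars {K : Chain ι} {v : ι} : v ∈ vars K ↔ ∃ m ∈ supp K, v ∈ m := by
  simp [vars]

theorem mem_vars_iff_face {K : Chain ι} {v : ι} : v ∈ vars K ↔ Face K {v} := by
  simp [mem_vars, Face]

theorem Face.mono {K : Chain ι} {G H : Finset ι} (h : Face K G) (hs : H ⊆ G) : Face K H := by
  obtain ⟨m, hm, hG⟩ := h
  exact ⟨m, hm, hs.trans hG⟩

theorem Face.subset_vars {K : Chain ι} {G : Finset ι} (h : Face K G) : G ⊆ vars K := by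
  obtain ⟨m, hm, hG⟩ := h
  exact fun v hv => mem_vars.2 ⟨m, hm, hG hv⟩

theorem face_of_mem_supp {K : Chain ι} {G : Finset ι} (h : G ∈ supp K) : Face K G :=
  ⟨G, h, subset_rfl⟩

theorem face_empty {K : Chain ι} : Face K ∅ ↔ K ≠ 0 := by
  rw [← not_iff_not, not_not, ← supp_eq_empty]
  simp [Face, Finset.eq_empty_iff_forall_notMem]

@[simp] theorem not_face_zero (G : Finset ι) : ¬ Face (0 : Chain ι) G := by
  simp [Face]

@[simp] theorem vars_zero : vars (0 : Chain ι) = ∅ := by simp [vars]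

@[simp] theorem face_e {A G : Finset ι} : Face (e A) G ↔ G ⊆ A := by
  simp [Face]

@[simp] theorem vars_e (A : Finset ι) : vars (e A) = A := by simp [vars]

@[simp] theorem vars_one : vars (1 : Chain ι) = ∅ := by rw [← e_empty, vars_e]

theorem mem_supp_or_of_add {K L : Chain ι} {m : Finset ι} (h : m ∈ supp (K + L)) :
    m ∈ supp K ∨ m ∈ supp L := by
  rcases mem_supp_add.1 h with h | h
  · exact Or.inl h.1
  · exact Or.inr h.1

theorem Face.of_add {K L : Chain ι} {G : Finset ι} (h : Face (K + L) G) :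
    Face K G ∨ Face L G := by
  obtain ⟨m, hm, hG⟩ := h
  exact (mem_supp_or_of_add hm).imp (fun h => ⟨m, h, hG⟩) (fun h => ⟨m, h, hG⟩)

theorem not_face_add {K L : Chain ι} {G : Finset ι} (h1 : ¬ Face K G) (h2 : ¬ Face L G) :
    ¬ Face (K + L) G := fun h => h.of_add.elim h1 h2

theorem vars_add_subset (K L : Chain ι) : vars (K + L) ⊆ vars K ∪ vars L := by
  intro v hv
  rw [mem_vars_iff_face] at hv
  simp only [Finset.mem_union, mem_vars_iff_face]
  exact hv.of_add

theorem notMem_vars_add {K L : Chain ι} {v : ι} (h1 : v ∉ vars K) (h2 : v ∉ vars L) :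
    v ∉ vars (K + L) := fun h => by
  rcases Finset.mem_union.1 (vars_add_subset K L h) with h | h
  · exact h1 h
  · exact h2 h

theorem exists_mem_supp_of_sum {α : Type*} {s : Finset α} {f : α → Chain ι} {m : Finset ι}
    (h : m ∈ supp (∑ i ∈ s, f i)) : ∃ i ∈ s, m ∈ supp (f i) := by
  classical
  induction s using Finset.induction_on with
  | empty => simp at h
  | insert a s ha ih =>
    rw [Finset.sum_insert ha] at h
    rcases mem_supp_or_of_add h with h | h
    · exact ⟨a, Finset.mem_insert_self _ _, h⟩
    · obtain ⟨i, hi, h⟩ := ih h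
      exact ⟨i, Finset.mem_insert_of_mem hi, h⟩

theorem supp_sum_e {α : Type*} {s : Finset α} {f : α → Finset ι} (hf : Set.InjOn f s) :
    supp (∑ i ∈ s, e (f i)) = s.image f := by
  classical
  induction s using Finset.induction_on with
  | empty => simp
  | insert a s ha ih =>
    have ih := ih (hf.mono (by simp))
    ext m
    rw [Finset.sum_insert ha, mem_supp_add, ih, supp_e, Finset.image_insert, Finset.mem_insert,
      Finset.mem_singleton]
    have : f a ∉ s.image f := by
      intro h
      obtain ⟨b, hb, hab⟩ := Finset.mem_image.1 h
      have := hf (by simp [hb]) (by simp) hab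
      exact ha (this ▸ hb)
    constructor
    · rintro (h | h)
      · exact Or.inl h.1
      · exact Or.inr h.1
    · rintro (rfl | h)
      · exact Or.inl ⟨rfl, this⟩
      · exact Or.inr ⟨h, fun h' => this (h' ▸ h)⟩

theorem eq_sum_e (K : Chain ι) : K = ∑ m ∈ supp K, e m := by
  apply chain_ext
  rw [supp_sum_e (f := fun m => m) (Set.injOn_id _), Finset.image_id']

theorem mem_supp_of_mul {K L : Chain ι} {m : Finset ι} (h : m ∈ supp (K * L)) :
    ∃ k ∈ supp K, ∃ l ∈ supp L, Disjoint k l ∧ m = k ∪ l := by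
  rw [eq_sum_e K, eq_sum_e L, Finset.sum_mul_sum] at h
  obtain ⟨k, hk, h⟩ := exists_mem_supp_of_sum h
  obtain ⟨l, hl, h⟩ := exists_mem_supp_of_sum h
  rw [e_mul_e_ite] at h
  split_ifs at h with hd
  · exact ⟨k, hk, l, hl, hd, by simpa using h⟩
  · simp at h

/-- Product of chains without common vertices. -/
theorem mem_supp_mul {K L : Chain ι} (hKL : Disjoint (vars K) (vars L)) {m : Finset ι} :
    m ∈ supp (K * L) ↔ ∃ k ∈ supp K, ∃ l ∈ supp L, m = k ∪ l := by
  have hsub : ∀ {M : Chain ι} {k : Finset ι}, k ∈ supp M → k ⊆ vars M := fun h =>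
    (face_of_mem_supp h).subset_vars
  have h1 : K * L = ∑ p ∈ supp K ×ˢ supp L, e (p.1 ∪ p.2) := by
    conv_lhs => rw [eq_sum_e K, eq_sum_e L, Finset.sum_mul_sum]
    rw [Finset.sum_product]
    refine Finset.sum_congr rfl fun k hk => Finset.sum_congr rfl fun l hl => e_mul_e ?_
    exact Finset.disjoint_of_subset_left (hsub hk) (Finset.disjoint_of_subset_right (hsub hl) hKL)
  rw [h1, supp_sum_e]
  · simp only [Finset.mem_image, Finset.mem_product, Prod.exists]
    constructor
    · rintro ⟨k, l, ⟨hk, hl⟩, rfl⟩; exact ⟨k, hk, l, hl, rfl⟩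
    · rintro ⟨k, hk, l, hl, rfl⟩; exact ⟨k, l, ⟨hk, hl⟩, rfl⟩
  · rintro ⟨k, l⟩ h ⟨k', l'⟩ h' heq
    simp only [Finset.coe_product, Set.mem_prod, Finset.mem_coe] at h h'
    simp only at heq
    rw [Finset.disjoint_left] at hKL
    rw [Finset.ext_iff] at heq
    ext v
    all_goals
      have hv := heq v
      simp only [Finset.mem_union] at hv
      have a1 := @hsub _ _ h.1 v
      have a2 := @hsub _ _ h.2 v
      have a3 := @hsub _ _ h'.1 v
      have a4 := @hsub _ _ h'.2 v
      have a5 := @hKL v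
      tauto

/-- This half needs no disjointness: cancellation in a product can only remove facets. -/
theorem Face.of_mul {K L : Chain ι} {G : Finset ι} (h : Face (K * L) G) :
    ∃ A B, Face K A ∧ Face L B ∧ G = A ∪ B := by
  obtain ⟨m, hm, hG⟩ := h
  obtain ⟨k, hk, l, hl, -, rfl⟩ := mem_supp_of_mul hm
  refine ⟨G ∩ k, G ∩ l, ⟨k, hk, Finset.inter_subset_right⟩, ⟨l, hl, Finset.inter_subset_right⟩, ?_⟩
  rw [← Finset.inter_union_distrib_left, Finset.inter_eq_left.2 hG]

theorem face_mul {K L : Chain ι} (hKL : Disjoint (vars K) (vars L)) {A B : Finset ι}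
    (hA : Face K A) (hB : Face L B) : Face (K * L) (A ∪ B) := by
  obtain ⟨k, hk, hA⟩ := hA
  obtain ⟨l, hl, hB⟩ := hB
  exact ⟨k ∪ l, (mem_supp_mul hKL).2 ⟨k, hk, l, hl, rfl⟩, Finset.union_subset_union hA hB⟩

theorem vars_mul_subset (K L : Chain ι) : vars (K * L) ⊆ vars K ∪ vars L := by
  intro v hv
  rw [mem_vars] at hv
  obtain ⟨m, hm, hv⟩ := hv
  obtain ⟨k, hk, l, hl, -, rfl⟩ := mem_supp_of_mul hm
  simp only [Finset.mem_union, mem_vars] at hv ⊢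
  exact hv.imp (fun h => ⟨k, hk, h⟩) (fun h => ⟨l, hl, h⟩)

theorem mem_supp_d_e {A m : Finset ι} : m ∈ supp (d (e A)) ↔ ∃ v ∈ A, m = A.erase v := by
  rw [d_e, supp_sum_e]
  · simp only [Finset.mem_image, eq_comm]
  · intro v hv w hw h
    by_contra hne
    have : v ∈ A.erase w := Finset.mem_erase.2 ⟨hne, hv⟩
    rw [← show A.erase v = A.erase w from h] at this
    simp at this

theorem mem_supp_d {K : Chain ι} {m : Finset ι} (h : m ∈ supp (d K)) :
    ∃ v ∉ m, insert v m ∈ supp K := by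
  rw [eq_sum_e K, map_sum] at h
  obtain ⟨A, hA, h⟩ := exists_mem_supp_of_sum h
  obtain ⟨v, hv, rfl⟩ := mem_supp_d_e.1 h
  exact ⟨v, Finset.notMem_erase v A, by rwa [Finset.insert_erase hv]⟩

theorem Face.of_d {K : Chain ι} {G : Finset ι} (h : Face (d K) G) : Face K G := by
  obtain ⟨m, hm, hG⟩ := h
  obtain ⟨v, -, h⟩ := mem_supp_d hm
  exact ⟨_, h, hG.trans (Finset.subset_insert _ _)⟩

theorem vars_d_subset (K : Chain ι) : vars (d K) ⊆ vars K := fun v hv => by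
  rw [mem_vars_iff_face] at hv ⊢
  exact hv.of_d

theorem face_d_e {A G : Finset ι} : Face (d (e A)) G ↔ G ⊂ A := by
  constructor
  · rintro ⟨m, hm, hG⟩
    obtain ⟨v, hv, rfl⟩ := mem_supp_d_e.1 hm
    exact Finset.ssubset_of_subset_of_ssubset hG (Finset.erase_ssubset hv)
  · intro h
    obtain ⟨v, hv, hvG⟩ := Finset.exists_of_ssubset h
    exact ⟨A.erase v, mem_supp_d_e.2 ⟨v, hv, rfl⟩, Finset.subset_erase.2 ⟨h.1, hvG⟩⟩

theorem vars_d_e_subset (A : Finset ι) : vars (d (e A)) ⊆ A := by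
  simpa using vars_d_subset (e A)

/-- The chain `K'` is the stellar subdivision of `K` at the simplex `A` with new vertex `a`. If `A`
is not a simplex of `K`, then `K' = K`. -/
def StarAt (A : Finset ι) (a : ι) (P Q K K' : Chain ι) : Prop :=
  A.Nonempty ∧ a ∉ A ∧ Disjoint A (vars P) ∧ a ∉ vars P ∧ a ∉ vars Q ∧ ¬ Face Q A ∧
    K = e A * P + Q ∧ K' = e {a} * d (e A) * P + Q

def Star (K K' : Chain ι) : Prop := ∃ A a P Q, StarAt A a P Q K K'

/-- Stellar equivalence of chains. -/
def Eqv (K L : Chain ι) : Prop := Relation.EqvGen Star K L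

theorem Star.eqv {K K' : Chain ι} (h : Star K K') : Eqv K K' := .rel _ _ h
theorem Eqv.refl (K : Chain ι) : Eqv K K := Relation.EqvGen.refl _
theorem Eqv.symm {K L : Chain ι} (h : Eqv K L) : Eqv L K := Relation.EqvGen.symm _ _ h
theorem Eqv.trans {K L M : Chain ι} (h : Eqv K L) (h' : Eqv L M) : Eqv K M :=
  Relation.EqvGen.trans _ _ _ h h'

/-- Renaming of the vertices. -/
def rn (σ : Equiv.Perm ι) : Chain ι →ₗ[ZMod 2] Chain ι := extend fun A => e (A.map σ.toEmbedding)

@[simp] theorem rn_e (σ : Equiv.Perm ι) (A : Finset ι) : rn σ (e A) = e (A.map σ.toEmbedding) := by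
  rw [rn, extend_e]

theorem rn_mul (σ : Equiv.Perm ι) (K L : Chain ι) : rn σ (K * L) = rn σ K * rn σ L := by
  refine chain_induction K ?_ ?_ ?_
  · simp
  · intro A
    refine chain_induction L ?_ ?_ ?_
    · simp
    · intro B
      rw [rn_e, rn_e, e_mul_e_ite, e_mul_e_ite]
      by_cases h : Disjoint A B
      · rw [if_pos h, if_pos (by simpa using h), rn_e, Finset.map_union]
      · rw [if_neg h, if_neg (by simpa using h), map_zero]
    · intro K L h1 h2; rw [mul_add, map_add, h1, h2, map_add, mul_add]
  · intro K L h1 h2; rw [add_mul, map_add, h1, h2, map_add, add_mul]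

theorem rn_d (σ : Equiv.Perm ι) (K : Chain ι) : rn σ (d K) = d (rn σ K) := by
  refine chain_induction K ?_ ?_ ?_
  · simp
  · intro A
    rw [rn_e, d_e, d_e, map_sum, Finset.sum_map]
    refine Finset.sum_congr rfl fun v _ => ?_
    rw [rn_e, Finset.map_erase]
  · intro K L h1 h2; simp only [map_add, h1, h2]

theorem rn_rn (σ τ : Equiv.Perm ι) (K : Chain ι) : rn σ (rn τ K) = rn (σ * τ) K := by
  refine chain_induction K ?_ ?_ ?_
  · simp
  · intro A; simp only [rn_e, Finset.map_map]; rfl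
  · intro K L h1 h2; simp only [map_add, h1, h2]

theorem rn_id (K : Chain ι) : rn 1 K = K := by
  refine chain_induction K ?_ ?_ ?_
  · simp
  · intro A; rw [rn_e]; congr 1; exact Finset.map_refl
  · intro K L h1 h2; simp only [map_add, h1, h2]

@[simp] theorem rn_symm_rn (σ : Equiv.Perm ι) (K : Chain ι) : rn σ⁻¹ (rn σ K) = K := by
  rw [rn_rn, inv_mul_cancel, rn_id]

@[simp] theorem rn_rn_symm (σ : Equiv.Perm ι) (K : Chain ι) : rn σ (rn σ⁻¹ K) = K := by
  rw [rn_rn, mul_inv_cancel, rn_id]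

theorem map_inv_map (σ : Equiv.Perm ι) (A : Finset ι) :
    (A.map σ.toEmbedding).map (σ⁻¹ : Equiv.Perm ι).toEmbedding = A := by
  rw [Finset.map_map]
  have : σ.toEmbedding.trans (σ⁻¹ : Equiv.Perm ι).toEmbedding = Function.Embedding.refl ι := by
    ext v; simp
  rw [this, Finset.map_refl]

theorem map_map_inv (σ : Equiv.Perm ι) (A : Finset ι) :
    (A.map (σ⁻¹ : Equiv.Perm ι).toEmbedding).map σ.toEmbedding = A := by
  simpa using map_inv_map σ⁻¹ A

theorem supp_rn (σ : Equiv.Perm ι) (K : Chain ι) :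
    supp (rn σ K) = (supp K).image (Finset.map σ.toEmbedding) := by
  conv_lhs => rw [eq_sum_e K, map_sum]
  simp only [rn_e]
  rw [supp_sum_e]
  exact fun A _ B _ h => Finset.map_injective _ h

theorem face_rn {σ : Equiv.Perm ι} {K : Chain ι} {G : Finset ι} :
    Face (rn σ K) (G.map σ.toEmbedding) ↔ Face K G := by
  simp [Face, supp_rn]

theorem face_rn' {σ : Equiv.Perm ι} {K : Chain ι} {G : Finset ι} :
    Face (rn σ K) G ↔ Face K (G.map (σ⁻¹ : Equiv.Perm ι).toEmbedding) := by
  conv_rhs => rw [← face_rn (σ := σ), map_map_inv]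

theorem vars_rn (σ : Equiv.Perm ι) (K : Chain ι) : vars (rn σ K) = (vars K).map σ.toEmbedding := by
  ext v
  rw [mem_vars_iff_face, face_rn', Finset.map_singleton, ← mem_vars_iff_face]
  simp

theorem map_eq_self {σ : Equiv.Perm ι} {A : Finset ι} (h : ∀ v ∈ A, σ v = v) :
    A.map σ.toEmbedding = A := by
  rw [Finset.map_eq_image]
  conv_rhs => rw [← Finset.image_id (s := A)]
  exact Finset.image_congr fun v hv => h v hv

theorem rn_congr {σ τ : Equiv.Perm ι} {K : Chain ι} (h : ∀ v ∈ vars K, σ v = τ v) :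
    rn σ K = rn τ K := by
  conv_lhs => rw [eq_sum_e K, map_sum]
  conv_rhs => rw [eq_sum_e K, map_sum]
  refine Finset.sum_congr rfl fun m hm => ?_
  rw [rn_e, rn_e, Finset.map_eq_image, Finset.map_eq_image]
  congr 1
  exact Finset.image_congr fun v hv => h v ((face_of_mem_supp hm).subset_vars hv)

theorem rn_eq_self {σ : Equiv.Perm ι} {K : Chain ι} (h : ∀ v ∈ vars K, σ v = v) : rn σ K = K := by
  rw [rn_congr (τ := 1) h, rn_id]

theorem Star.rn {K K' : Chain ι} (h : Star K K') (σ : Equiv.Perm ι) : Star (rn σ K) (rn σ K') := by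
  obtain ⟨A, a, P, Q, h1, h2, h3, h4, h5, h6, rfl, rfl⟩ := h
  refine ⟨A.map σ.toEmbedding, σ a, StellarChain.rn σ P, StellarChain.rn σ Q, ?_, ?_, ?_, ?_, ?_,
    ?_, ?_, ?_⟩
  · simpa using h1
  · simpa using h2
  · rw [vars_rn]; simpa using h3
  · rw [vars_rn]; simpa using h4
  · rw [vars_rn]; simpa using h5
  · rwa [face_rn]
  · rw [map_add, rn_mul, rn_e]
  · rw [map_add, rn_mul, rn_mul, rn_d, rn_e, rn_e, Finset.map_singleton]; rfl

theorem Eqv.rn {K L : Chain ι} (h : Eqv K L) (σ : Equiv.Perm ι) : Eqv (rn σ K) (rn σ L) := by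
  induction h with
  | rel K L h => exact (h.rn σ).eqv
  | refl K => exact .refl _
  | symm K L _ ih => exact ih.symm
  | trans K L M _ _ ih1 ih2 => exact ih1.trans ih2

/-- The link of `A` in `K`. -/
def lk (A : Finset ι) : Chain ι →ₗ[ZMod 2] Chain ι :=
  extend fun B => if A ⊆ B then e (B \ A) else 0

/-- The part of `K` that does not contain `A`. -/
def dl (A : Finset ι) : Chain ι →ₗ[ZMod 2] Chain ι :=
  extend fun B => if A ⊆ B then 0 else e B

theorem lk_e {A B : Finset ι} : lk A (e B) = if A ⊆ B then e (B \ A) else 0 := by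
  rw [lk, extend_e]

theorem dl_e {A B : Finset ι} : dl A (e B) = if A ⊆ B then 0 else e B := by
  rw [dl, extend_e]

theorem eq_lk_add_dl (A : Finset ι) (K : Chain ι) : K = e A * lk A K + dl A K := by
  refine chain_induction K ?_ ?_ ?_
  · simp
  · intro B
    rw [lk_e, dl_e]
    split_ifs with h
    · rw [e_mul_e Finset.disjoint_sdiff, Finset.union_sdiff_of_subset h, add_zero]
    · rw [mul_zero, zero_add]
  · intro K L h1 h2
    rw [map_add, map_add]
    conv_lhs => rw [h1, h2]
    ring

theorem mem_supp_lk {A m : Finset ι} {K : Chain ι} :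
    m ∈ supp (lk A K) ↔ Disjoint A m ∧ A ∪ m ∈ supp K := by
  have h1 : lk A K = ∑ B ∈ supp K with A ⊆ B, e (B \ A) := by
    conv_lhs => rw [eq_sum_e K, map_sum]
    simp only [lk_e, Finset.sum_filter]
  rw [h1, supp_sum_e]
  · simp only [Finset.mem_image, Finset.mem_filter]
    constructor
    · rintro ⟨B, ⟨hB, hA⟩, rfl⟩
      exact ⟨Finset.disjoint_sdiff, by rwa [Finset.union_sdiff_of_subset hA]⟩
    · rintro ⟨hd, h⟩
      exact ⟨A ∪ m, ⟨h, Finset.subset_union_left⟩, Finset.union_sdiff_cancel_left hd⟩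
  · intro B hB C hC h
    simp only [Finset.coe_filter, Set.mem_ofPred_eq] at hB hC h
    rw [← Finset.union_sdiff_of_subset hB.2, h, Finset.union_sdiff_of_subset hC.2]

theorem mem_supp_dl {A m : Finset ι} {K : Chain ι} :
    m ∈ supp (dl A K) ↔ m ∈ supp K ∧ ¬ A ⊆ m := by
  have h1 : dl A K = ∑ B ∈ supp K with ¬ A ⊆ B, e B := by
    conv_lhs => rw [eq_sum_e K, map_sum]
    simp only [dl_e, Finset.sum_filter, ite_not]
  rw [h1, supp_sum_e (f := fun m => m) (Set.injOn_id _), Finset.image_id', Finset.mem_filter]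

theorem face_lk {A G : Finset ι} {K : Chain ι} :
    Face (lk A K) G ↔ Disjoint A G ∧ Face K (A ∪ G) := by
  constructor
  · rintro ⟨m, hm, hG⟩
    obtain ⟨h1, h2⟩ := mem_supp_lk.1 hm
    exact ⟨Finset.disjoint_of_subset_right hG h1, _, h2, Finset.union_subset_union_right hG⟩
  · rintro ⟨hd, m, hm, hG⟩
    refine ⟨m \ A, mem_supp_lk.2 ⟨Finset.disjoint_sdiff, ?_⟩, ?_⟩
    · rwa [Finset.union_sdiff_of_subset (Finset.subset_union_left.trans hG)]
    · exact Finset.subset_sdiff.2 ⟨Finset.subset_union_right.trans hG, hd.symm⟩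

theorem Face.of_dl {A G : Finset ι} {K : Chain ι} (h : Face (dl A K) G) : Face K G := by
  obtain ⟨m, hm, hG⟩ := h
  exact ⟨m, (mem_supp_dl.1 hm).1, hG⟩

theorem disjoint_vars_lk (A : Finset ι) (K : Chain ι) : Disjoint A (vars (lk A K)) := by
  rw [Finset.disjoint_left]
  intro v hv h
  obtain ⟨h1, -⟩ := face_lk.1 (mem_vars_iff_face.1 h)
  simp [hv] at h1

theorem not_face_dl (A : Finset ι) (K : Chain ι) : ¬ Face (dl A K) A := by
  rintro ⟨m, hm, hA⟩
  exact (mem_supp_dl.1 hm).2 hA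

theorem vars_lk_subset (A : Finset ι) (K : Chain ι) : vars (lk A K) ⊆ vars K := fun v hv => by
  rw [mem_vars_iff_face] at hv ⊢
  exact (face_lk.1 hv).2.mono Finset.subset_union_right

theorem vars_dl_subset (A : Finset ι) (K : Chain ι) : vars (dl A K) ⊆ vars K := fun v hv => by
  rw [mem_vars_iff_face] at hv ⊢
  exact hv.of_dl

theorem lk_eq_zero {A : Finset ι} {K : Chain ι} (h : ¬ Face K A) : lk A K = 0 := by
  rw [← supp_eq_empty, Finset.eq_empty_iff_forall_notMem]
  intro m hm
  exact h ⟨_, (mem_supp_lk.1 hm).2, Finset.subset_union_left⟩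

theorem lk_ne_zero {A : Finset ι} {K : Chain ι} : lk A K ≠ 0 ↔ Face K A := by
  rw [← face_empty, face_lk]; simp

theorem lk_e_mul {A : Finset ι} {P : Chain ι} (h : Disjoint A (vars P)) : lk A (e A * P) = P := by
  apply chain_ext
  ext m
  rw [mem_supp_lk, mem_supp_mul (by simpa using h)]
  simp only [supp_e, Finset.mem_singleton, exists_eq_left]
  constructor
  · rintro ⟨hd, l, hl, h2⟩
    have h3 : Disjoint A l :=
      Finset.disjoint_of_subset_right (face_of_mem_supp hl).subset_vars h
    have : m = l := by
      rw [← Finset.union_sdiff_cancel_left hd, h2, Finset.union_sdiff_cancel_left h3]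
    rwa [this]
  · intro hm
    exact ⟨Finset.disjoint_of_subset_right (face_of_mem_supp hm).subset_vars h, m, hm, rfl⟩

/-- The decomposition of a chain at `A` is unique. -/
theorem lk_eq {A : Finset ι} {P Q : Chain ι} (h : Disjoint A (vars P)) (hQ : ¬ Face Q A) :
    lk A (e A * P + Q) = P := by
  rw [map_add, lk_e_mul h, lk_eq_zero hQ, add_zero]

theorem dl_eq {A : Finset ι} {P Q : Chain ι} (h : Disjoint A (vars P)) (hQ : ¬ Face Q A) :
    dl A (e A * P + Q) = Q := by
  have h1 := eq_lk_add_dl A (e A * P + Q)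
  rw [lk_eq h hQ] at h1
  exact (add_left_cancel h1).symm

theorem StarAt.mk_lk {A : Finset ι} {a : ι} {K : Chain ι} (hA : A.Nonempty) (ha : a ∉ A)
    (haK : a ∉ vars K) :
    StarAt A a (lk A K) (dl A K) K (e {a} * d (e A) * lk A K + dl A K) :=
  ⟨hA, ha, disjoint_vars_lk A K, fun h => haK (vars_lk_subset A K h),
    fun h => haK (vars_dl_subset A K h), not_face_dl A K, eq_lk_add_dl A K, rfl⟩

theorem StarAt.eqv {A : Finset ι} {a : ι} {P Q K K' : Chain ι} (h : StarAt A a P Q K K') :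
    Eqv K K' := Star.eqv ⟨A, a, P, Q, h⟩

/-- Since `∂{v} = 1`, starring at the vertex `v` with new vertex `a` merely renames `v` to `a`. -/
theorem eqv_swap_fresh {K : Chain ι} {v a : ι} (ha : a ∉ vars K) :
    Eqv K (rn (Equiv.swap v a) K) := by
  by_cases hva : v = a
  · subst hva
    rw [rn_eq_self]
    · exact .refl _
    · intro w _; simp
  have h := StarAt.mk_lk (A := {v}) (a := a) (K := K) (by simp) (by simpa using Ne.symm hva) ha
  have h1 : rn (Equiv.swap v a) (lk {v} K) = lk {v} K := by
    refine rn_eq_self fun w hw => Equiv.swap_apply_of_ne_of_ne ?_ ?_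
    · rintro rfl; simpa [hw] using disjoint_vars_lk {w} K
    · rintro rfl; exact ha (vars_lk_subset _ _ hw)
  have h2 : rn (Equiv.swap v a) (dl {v} K) = dl {v} K := by
    refine rn_eq_self fun w hw => Equiv.swap_apply_of_ne_of_ne ?_ ?_
    · rintro rfl; exact not_face_dl {w} K (mem_vars_iff_face.1 hw)
    · rintro rfl; exact ha (vars_dl_subset _ _ hw)
  have h3 : rn (Equiv.swap v a) K = e {a} * d (e {v}) * lk {v} K + dl {v} K := by
    conv_lhs => rw [eq_lk_add_dl {v} K, map_add, rn_mul, h1, h2, rn_e, Finset.map_singleton]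
    simp
  rw [h3]
  exact h.eqv

variable [Infinite ι]

theorem exists_fresh (s : Finset ι) : ∃ a, a ∉ s := Infinite.exists_notMem_finset s

theorem eqv_swap (K : Chain ι) (v w : ι) : Eqv K (rn (Equiv.swap v w) K) := by
  by_cases hvw : v = w
  · subst hvw
    rw [rn_eq_self]
    · exact .refl _
    · intro w _; simp
  obtain ⟨a, ha⟩ := exists_fresh (vars K ∪ {v, w})
  simp only [Finset.mem_union, Finset.mem_insert, Finset.mem_singleton, not_or] at ha
  obtain ⟨ha, hav, haw⟩ := ha
  have h1 := eqv_swap_fresh (v := v) ha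
  have hv1 : v ∉ vars (rn (Equiv.swap v a) K) := by
    rw [vars_rn]
    simp only [Finset.mem_map_equiv, Equiv.symm_swap, Equiv.swap_apply_left]
    exact ha
  have h2 := eqv_swap_fresh (v := w) hv1
  have hw1 : w ∉ vars (rn (Equiv.swap w v) (rn (Equiv.swap v a) K)) := by
    rw [vars_rn]
    simp only [Finset.mem_map_equiv, Equiv.symm_swap, Equiv.swap_apply_left]
    exact hv1
  have h3 := eqv_swap_fresh (v := a) hw1
  have : rn (Equiv.swap a w) (rn (Equiv.swap w v) (rn (Equiv.swap v a) K)) =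
      rn (Equiv.swap v w) K := by
    rw [rn_rn, rn_rn]
    refine rn_congr fun x _ => ?_
    rw [Equiv.Perm.mul_apply, Equiv.Perm.mul_apply]
    simp only [Equiv.swap_apply_def]
    split_ifs <;> simp_all
  rw [this] at h3
  exact (h1.trans h2).trans h3

theorem exists_perm_of_injOn (S : Finset ι) (f : ι → ι) (hf : Set.InjOn f S) :
    ∃ σ : Equiv.Perm ι, (∀ K : Chain ι, Eqv K (rn σ K)) ∧ ∀ v ∈ S, σ v = f v := by
  induction S using Finset.induction_on with
  | empty => exact ⟨1, fun K => by rw [rn_id]; exact .refl _, by simp⟩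
  | insert v S hv ih =>
    obtain ⟨σ, h1, h2⟩ := ih (hf.mono (by simp))
    refine ⟨Equiv.swap (σ v) (f v) * σ, fun K => ?_, fun w hw => ?_⟩
    · rw [← rn_rn]
      exact (h1 K).trans (eqv_swap _ _ _)
    · rw [Equiv.Perm.mul_apply]
      rcases Finset.mem_insert.1 hw with rfl | hw'
      · rw [Equiv.swap_apply_left]
      · have hne : w ≠ v := fun h => hv (h ▸ hw')
        rw [Equiv.swap_apply_of_ne_of_ne (fun h => hne (σ.injective h)), h2 w hw']
        rw [h2 w hw']
        exact fun h => hne (hf (by simp [hw']) (by simp) h)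

/-- On the finitely many vertices of `K` any permutation agrees with a product of transpositions. So
stellar moves alone already contain the simplicial isomorphisms. -/
theorem eqv_rn (σ : Equiv.Perm ι) (K : Chain ι) : Eqv K (rn σ K) := by
  obtain ⟨τ, h1, h2⟩ := exists_perm_of_injOn (vars K) σ σ.injective.injOn
  rw [rn_congr (τ := τ) fun v hv => (h2 v hv).symm]
  exact h1 K

/-- The vertices outside `F` can be moved away from a given finite set. -/
theorem exists_perm_avoid (F S N : Finset ι) :
    ∃ σ : Equiv.Perm ι, (∀ v ∈ F, σ v = v) ∧ ∀ v ∈ S, v ∉ F → σ v ∉ N := by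
  induction S using Finset.induction_on with
  | empty => exact ⟨1, by simp, by simp⟩
  | insert v S hv ih =>
    obtain ⟨σ, h1, h2⟩ := ih
    by_cases hvF : v ∈ F
    · refine ⟨σ, h1, fun w hw hwF => ?_⟩
      rcases Finset.mem_insert.1 hw with rfl | hw
      · exact absurd hvF hwF
      · exact h2 w hw hwF
    · obtain ⟨u, hu⟩ := exists_fresh (N ∪ F ∪ S.image σ)
      simp only [Finset.mem_union, Finset.mem_image, not_or, not_exists, not_and] at hu
      refine ⟨Equiv.swap (σ v) u * σ, fun w hw => ?_, fun w hw hwF => ?_⟩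
      · rw [Equiv.Perm.mul_apply, Equiv.swap_apply_of_ne_of_ne, h1 w hw]
        · exact fun h => hvF (σ.injective h ▸ hw)
        · rw [h1 w hw]; rintro rfl; exact hu.1.2 hw
      · rw [Equiv.Perm.mul_apply]
        rcases Finset.mem_insert.1 hw with rfl | hw'
        · rw [Equiv.swap_apply_left]; exact hu.1.1
        · rw [Equiv.swap_apply_of_ne_of_ne]
          · exact h2 w hw' hwF
          · exact fun h => hv (σ.injective h ▸ hw')
          · exact hu.2 w hw'

end

end StellarChain

/-! ### Local exchange of chains with the same boundary. -/

namespace StellarChain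

noncomputable section

variable {ι : Type*} [DecidableEq ι]

theorem notMem_vars_mul {K L : Chain ι} {v : ι} (h1 : v ∉ vars K) (h2 : v ∉ vars L) :
    v ∉ vars (K * L) := fun h => by
  rcases Finset.mem_union.1 (vars_mul_subset K L h) with h | h
  · exact h1 h
  · exact h2 h

theorem notMem_vars_d {K : Chain ι} {v : ι} (h1 : v ∉ vars K) : v ∉ vars (d K) :=
  fun h => h1 (vars_d_subset K h)

theorem disjoint_vars_add {K L : Chain ι} {A : Finset ι} (h1 : Disjoint A (vars K))
    (h2 : Disjoint A (vars L)) : Disjoint A (vars (K + L)) :=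
  Finset.disjoint_of_subset_right (vars_add_subset K L) (Finset.disjoint_union_right.2 ⟨h1, h2⟩)

theorem disjoint_vars_mul {K L : Chain ι} {A : Finset ι} (h1 : Disjoint A (vars K))
    (h2 : Disjoint A (vars L)) : Disjoint A (vars (K * L)) :=
  Finset.disjoint_of_subset_right (vars_mul_subset K L) (Finset.disjoint_union_right.2 ⟨h1, h2⟩)

theorem disjoint_vars_d {K : Chain ι} {A : Finset ι} (h1 : Disjoint A (vars K)) :
    Disjoint A (vars (d K)) :=
  Finset.disjoint_of_subset_right (vars_d_subset K) h1

theorem Face.of_mul_left {K L : Chain ι} {G : Finset ι} (h : Face (K * L) G)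
    (hG : Disjoint G (vars L)) : Face K G := by
  obtain ⟨A, B, hA, hB, rfl⟩ := h.of_mul
  have hB' : B = ∅ := by
    rw [Finset.disjoint_union_left] at hG
    exact Finset.disjoint_self_iff_empty B |>.1
      (Finset.disjoint_of_subset_right hB.subset_vars hG.2)
  rwa [hB', Finset.union_empty]

theorem Face.of_mul_right {K L : Chain ι} {G : Finset ι} (h : Face (K * L) G)
    (hG : Disjoint G (vars K)) : Face L G := by
  rw [mul_comm] at h; exact h.of_mul_left hG

theorem not_face_d_mul {A : Finset ι} {R : Chain ι} (h : Disjoint A (vars R)) :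
    ¬ Face (d (e A) * R) A := fun hf =>
  (face_d_e.1 (hf.of_mul_left h)).ne rfl

/-- A face of `A * P` that does not contain `A` is a face of `∂A * P`. -/
theorem Face.of_e_mul {A G : Finset ι} {P : Chain ι} (h : Disjoint A (vars P))
    (hf : Face (e A * P) G) (hG : ¬ A ⊆ G) : Face (d (e A) * P) G := by
  obtain ⟨B, C, hB, hC, rfl⟩ := hf.of_mul
  rw [face_e] at hB
  refine face_mul (Finset.disjoint_of_subset_left (vars_d_e_subset A) h) ?_ hC
  rw [face_d_e]
  exact Finset.ssubset_iff_subset_ne.2 ⟨hB, fun h => hG (h ▸ Finset.subset_union_left)⟩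

/-- A face of `∂A * P` is a face of `A * P`. -/
theorem Face.of_d_e_mul {A G : Finset ι} {P : Chain ι} (h : Disjoint A (vars P))
    (hf : Face (d (e A) * P) G) : Face (e A * P) G := by
  obtain ⟨B, C, hB, hC, rfl⟩ := hf.of_mul
  exact face_mul (by simpa using h) hB.of_d hC

theorem not_subset_of_face_d_mul {A G : Finset ι} {P : Chain ι} (h : Disjoint A (vars P))
    (hf : Face (d (e A) * P) G) : ¬ A ⊆ G :=
  fun hAG => not_face_d_mul h (hf.mono hAG)

theorem Eqv.of_eq {K L : Chain ι} (h : K = L) : Eqv K L := h ▸ Eqv.refl K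

theorem rn_add_of_fixed {σ : Equiv.Perm ι} {C Q : Chain ι} (h : ∀ v ∈ vars C, σ v = v) :
    rn σ (C + Q) = C + rn σ Q := by
  rw [map_add, rn_eq_self h]

/-- `C` and `C'` have the same boundary and may be exchanged for each other inside a
larger chain which meets them only in their boundary. -/
def Repl (C C' : Chain ι) : Prop :=
  d C = d C' ∧ ∃ N : Finset ι, ∀ Q : Chain ι, (∀ v ∈ vars Q, v ∈ N → v ∈ vars (d C)) →
    (∀ G : Finset ι, G.Nonempty → Face Q G → G ⊆ vars (d C) → Face (d C) G) → Eqv (C + Q) (C' + Q)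

theorem Repl.refl (C : Chain ι) : Repl C C := ⟨rfl, ∅, fun _ _ _ => .refl _⟩

theorem Repl.of_eq {C C' : Chain ι} (h : C = C') : Repl C C' := h ▸ Repl.refl C

theorem Repl.trans {C C' C'' : Chain ι} (h : Repl C C') (h' : Repl C' C'') : Repl C C'' := by
  obtain ⟨h1, N, h2⟩ := h
  obtain ⟨h1', N', h2'⟩ := h'
  refine ⟨h1.trans h1', N ∪ N', fun Q hQ hQ' => (h2 Q ?_ hQ').trans (h2' Q ?_ ?_)⟩
  · exact fun v hv hvN => hQ v hv (Finset.mem_union_left _ hvN)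
  · rw [← h1]; exact fun v hv hvN => hQ v hv (Finset.mem_union_right _ hvN)
  · rwa [← h1]

theorem Repl.rn {C C' : Chain ι} (h : Repl C C') (σ : Equiv.Perm ι) :
    Repl (rn σ C) (rn σ C') := by
  obtain ⟨h1, N, h2⟩ := h
  refine ⟨by rw [← rn_d, ← rn_d, h1], N.map σ.toEmbedding, fun Q hQ hQ' => ?_⟩
  have h3 := h2 (StellarChain.rn σ⁻¹ Q) ?_ ?_
  · simpa using h3.rn σ
  · intro v hv hvN
    rw [vars_rn, Finset.mem_map] at hv
    obtain ⟨w, hw, rfl⟩ := hv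
    have hw' : σ (σ⁻¹ w) = w := σ.apply_symm_apply w
    have := hQ (σ (σ⁻¹ w)) (hw'.symm ▸ hw) (Finset.mem_map_of_mem _ hvN)
    rw [← rn_d, vars_rn] at this
    simpa using this
  · intro G hG hf hGE
    have := hQ' (G.map σ.toEmbedding) (by simpa using hG) (by simpa [face_rn'] using hf) ?_
    · rwa [← rn_d, face_rn] at this
    · rw [← rn_d, vars_rn]; simpa using hGE

theorem repl_rn_iff {C C' : Chain ι} (σ : Equiv.Perm ι) :
    Repl (rn σ C) (rn σ C') ↔ Repl C C' :=
  ⟨fun h => by simpa using h.rn σ⁻¹, fun h => h.rn σ⟩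

/-- The nonempty simplexes common to `C` and `Q` lie in `E`. -/
def MeetIn (C Q E : Chain ι) : Prop := ∀ G : Finset ι, G.Nonempty → Face Q G → Face C G → Face E G

variable [Infinite ι]

/-- The set `N` in `Repl` collects vertices used by auxiliary moves. Renaming the vertices of `Q`
outside `C` and `C'` away from `N` removes the condition on `N`; the boundary stays fixed, and there
`Q` is glued. -/
theorem Repl.eqv_add_of_full {C C' Q : Chain ι} (h : Repl C C') (h1 : MeetIn C Q (d C))
    (h2 : MeetIn C' Q (d C))
    (hfull : ∀ G : Finset ι, G.Nonempty → Face Q G → G ⊆ vars (d C) → Face (d C) G) :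
    Eqv (C + Q) (C' + Q) := by
  obtain ⟨hd, N, hN⟩ := h
  obtain ⟨σ, hσ, hσN⟩ := exists_perm_avoid (vars C ∪ vars C') (vars Q) N
  have hC : ∀ v ∈ vars C, σ v = v := fun v hv => hσ v (Finset.mem_union_left _ hv)
  have hC' : ∀ v ∈ vars C', σ v = v := fun v hv => hσ v (Finset.mem_union_right _ hv)
  have hE : ∀ v ∈ vars (d C), σ v = v := fun v hv => hC v (vars_d_subset C hv)
  have key := hN (StellarChain.rn σ Q) ?_ ?_
  · refine (Eqv.trans ?_ key).trans (Eqv.symm ?_)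
    · rw [← rn_add_of_fixed hC]; exact eqv_rn σ _
    · rw [← rn_add_of_fixed hC']; exact eqv_rn σ _
  · intro w hw hwN
    rw [vars_rn, Finset.mem_map] at hw
    obtain ⟨v, hv, rfl⟩ := hw
    by_cases hvF : v ∈ vars C ∪ vars C'
    · have : v ∈ vars (d C) := by
        rw [mem_vars_iff_face] at hv ⊢
        rcases Finset.mem_union.1 hvF with hF | hF
        · exact h1 {v} (by simp) hv (mem_vars_iff_face.1 hF)
        · exact h2 {v} (by simp) hv (mem_vars_iff_face.1 hF)
      exact (hE v this).symm ▸ this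
    · exact absurd hwN (hσN v hv hvF)
  · intro G hG hf hGE
    rw [face_rn'] at hf
    have : G.map (σ⁻¹ : Equiv.Perm ι).toEmbedding = G := by
      refine map_eq_self fun v hv => ?_
      rw [Equiv.Perm.inv_eq_iff_eq, hE v (hGE hv)]
    rw [this] at hf
    exact hfull G hG hf hGE

/-- Exchange inside a chain that meets `C` and `C'` only in the boundary. -/
theorem Repl.eqv_add {C C' : Chain ι} (h : Repl C C') : ∀ {Q : Chain ι}, MeetIn C Q (d C) →
    MeetIn C' Q (d C) → Eqv (C + Q) (C' + Q) := by
  classical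
  -- Induction on the number of simplexes of `Q` that are spanned by boundary vertices without lying
  -- in the boundary, the obstruction to fullness.
  suffices H : ∀ (n : ℕ) (Q : Chain ι), MeetIn C Q (d C) → MeetIn C' Q (d C) →
      ((vars (d C)).powerset.filter fun G => G.Nonempty ∧ Face Q G ∧ ¬ Face (d C) G).card = n →
      Eqv (C + Q) (C' + Q) from fun {Q} h1 h2 => H _ Q h1 h2 rfl
  intro n
  induction n using Nat.strong_induction_on with
  | _ n ih =>
  intro Q h1 h2 hn
  by_cases hfull : ∀ G : Finset ι, G.Nonempty → Face Q G → G ⊆ vars (d C) → Face (d C) G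
  · exact h.eqv_add_of_full h1 h2 hfull
  push Not at hfull
  obtain ⟨B, hB, hBQ, hBE, hBn⟩ := hfull
  -- Starring an obstructing simplex `B` at a fresh vertex destroys it. Every new simplex contains
  -- `a`, so no other obstruction arises, and `C`, `C'` are untouched because `B` lies in neither.
  obtain ⟨a, ha⟩ := exists_fresh (vars Q ∪ vars C ∪ vars C')
  simp only [Finset.mem_union, not_or] at ha
  have haB : a ∉ B := fun h => ha.1.1 (hBQ.subset_vars h)
  have hstar := fun (D : Chain ι) (hD : a ∉ vars D) (hDB : ¬ Face D B) =>
    (show StarAt B a (lk B Q) (D + dl B Q) (D + Q)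
      (D + (e {a} * d (e B) * lk B Q + dl B Q)) from
      ⟨hB, haB, disjoint_vars_lk B Q, fun h => ha.1.1 (vars_lk_subset _ _ h),
        notMem_vars_add hD fun h => ha.1.1 (vars_dl_subset _ _ h),
        not_face_add hDB (not_face_dl B Q), by
          conv_lhs => rw [eq_lk_add_dl B Q]
          ring, by ring⟩).eqv
  have hold : ∀ G : Finset ι, a ∉ G → Face (e {a} * d (e B) * lk B Q + dl B Q) G →
      Face Q G ∧ ¬ B ⊆ G := by
    intro G haG hf
    rcases hf.of_add with hf | hf
    · rw [mul_assoc] at hf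
      have hf := hf.of_mul_right (by simpa using haG)
      refine ⟨?_, not_subset_of_face_d_mul (disjoint_vars_lk B Q) hf⟩
      obtain ⟨m, hm, hG⟩ := hf.of_d_e_mul (disjoint_vars_lk B Q)
      refine ⟨m, ?_, hG⟩
      rw [mem_supp_mul (by simpa using disjoint_vars_lk B Q)] at hm
      obtain ⟨k, hk, l, hl, rfl⟩ := hm
      rw [supp_e, Finset.mem_singleton] at hk
      subst hk
      exact (mem_supp_lk.1 hl).2
    · exact ⟨hf.of_dl, fun hBG => not_face_dl B Q (hf.mono hBG)⟩
  have hmeet : ∀ D : Chain ι, a ∉ vars D → MeetIn D Q (d C) →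
      MeetIn D (e {a} * d (e B) * lk B Q + dl B Q) (d C) := by
    intro D haD hD G hG hGQ hGD
    exact hD G hG (hold G (fun h => haD (hGD.subset_vars h)) hGQ).1 hGD
  refine ((hstar C ha.1.2 fun h => hBn (h1 B hB hBQ h)).trans (ih _ ?_ _ (hmeet C ha.1.2 h1)
    (hmeet C' ha.2 h2) rfl)).trans (hstar C' ha.2 fun h => hBn (h2 B hB hBQ h)).symm
  rw [← hn]
  apply Finset.card_lt_card
  refine Finset.ssubset_iff_of_subset ?_ |>.2 ⟨B, ?_, ?_⟩
  · intro G hG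
    simp only [Finset.mem_filter, Finset.mem_powerset] at hG ⊢
    exact ⟨hG.1, hG.2.1, (hold G (fun h => ha.1.2 (vars_d_subset C (hG.1 h))) hG.2.2.1).1, hG.2.2.2⟩
  · simp only [Finset.mem_filter, Finset.mem_powerset]
    exact ⟨hBE, hB, hBQ, hBn⟩
  · simp only [Finset.mem_filter, Finset.mem_powerset, not_and]
    exact fun _ _ hf => absurd subset_rfl (hold B haB hf).2

/-- Exchanges are local. -/
theorem Repl.add {C C' D : Chain ι} (h : Repl C C') (h1 : MeetIn C D (d C))
    (h2 : MeetIn C' D (d C)) : Repl (C + D) (C' + D) := by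
  refine ⟨by rw [map_add, map_add, h.1], vars C ∪ vars C', fun Q hQ hfull => ?_⟩
  -- A simplex common to `C` (or `C'`) and `Q` lies in the boundary of the enlarged chain by
  -- fullness; that boundary is `d C + d D`, and the part in `d D` is controlled by the meeting
  -- condition with `D`.
  have key : ∀ B : Chain ι, d B = d C → (∀ v ∈ vars B, v ∈ vars C ∪ vars C') →
      MeetIn B D (d C) → MeetIn B (D + Q) (d C) := by
    intro B hBC hBv hB G hG hGQ hGB
    rcases hGQ.of_add with hf | hf
    · exact hB G hG hf hGB
    · have h3 := hfull G hG hf fun v hv => hQ v (hf.subset_vars hv) (hBv v (hGB.subset_vars hv))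
      rw [map_add] at h3
      rcases h3.of_add with h3 | h3
      · exact h3
      · exact hB G hG h3.of_d hGB
  rw [add_assoc, add_assoc]
  exact h.eqv_add (key C rfl (fun v hv => Finset.mem_union_left _ hv) h1)
    (key C' h.1.symm (fun v hv => Finset.mem_union_right _ hv) h2)

/-- The stellar exchange of `A * ∂B` and `∂A * B`, joined to a cycle. -/
theorem repl_flip {A B : Finset ι} {R : Chain ι} (hA : A.Nonempty) (hB : B.Nonempty)
    (hAB : Disjoint A B) (hAR : Disjoint A (vars R)) (hBR : Disjoint B (vars R)) (hR : d R = 0) :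
    Repl (e A * d (e B) * R) (d (e A) * e B * R) := by
  have hE1 : d (e A * d (e B) * R) = d (e A) * (d (e B) * R) := by
    rw [d_mul, d_mul, d_d, hR]; ring
  have hE2 : d (d (e A) * e B * R) = d (e A) * (d (e B) * R) := by
    rw [d_mul, d_mul, d_d, hR]; ring
  have hAB' : Disjoint A (vars (d (e B) * R)) :=
    disjoint_vars_mul (disjoint_vars_d (by simpa using hAB)) hAR
  have hBA' : Disjoint B (vars (d (e A) * R)) :=
    disjoint_vars_mul (disjoint_vars_d (by simpa using hAB.symm)) hBR
  refine ⟨hE1.trans hE2.symm, A ∪ B, fun Q hQ hfull => ?_⟩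
  rw [hE1] at hQ hfull
  -- Starring the one side at `A` and the other at `B`, both with vertex `z`, gives `z * ∂A * ∂B *
  -- R`. Neither simplex is a face of `Q`: fullness would put it into `∂A * ∂B * R`, which contains
  -- neither `A` nor `B`.
  obtain ⟨z, hz⟩ := exists_fresh (A ∪ B ∪ vars R ∪ vars Q)
  simp only [Finset.mem_union, not_or] at hz
  obtain ⟨⟨⟨hzA, hzB⟩, hzR⟩, hzQ⟩ := hz
  have hnA : ¬ Face Q A := fun hf => not_face_d_mul hAB' (hfull A hA hf fun v hv =>
    hQ v (hf.subset_vars hv) (Finset.mem_union_left _ hv))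
  have hnB : ¬ Face Q B := fun hf => not_face_d_mul hBA' (by
    have := hfull B hB hf fun v hv => hQ v (hf.subset_vars hv) (Finset.mem_union_right _ hv)
    rwa [show d (e A) * (d (e B) * R) = d (e B) * (d (e A) * R) by ring] at this)
  have s1 : StarAt A z (d (e B) * R) Q (e A * d (e B) * R + Q)
      (e {z} * d (e A) * (d (e B) * R) + Q) :=
    ⟨hA, hzA, hAB', notMem_vars_mul (notMem_vars_d (by simpa using hzB)) hzR, hzQ, hnA,
      by ring, rfl⟩
  have s2 : StarAt B z (d (e A) * R) Q (d (e A) * e B * R + Q)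
      (e {z} * d (e A) * (d (e B) * R) + Q) :=
    ⟨hB, hzB, hBA', notMem_vars_mul (notMem_vars_d (by simpa using hzA)) hzR, hzQ, hnB,
      by ring, by ring⟩
  exact s1.eqv.trans s2.eqv.symm

end

end StellarChain

/-! ### The exchange property `Phi` under a stellar move. -/

namespace StellarChain

noncomputable section

variable {ι : Type*} [DecidableEq ι]

/-- The usual way to check that an exchange is local: when `A` does not occur in `D`, the chains `A
* P` and `D` can meet only in `∂A * P`. -/
theorem meetIn_e_mul {A : Finset ι} {P D E : Chain ι} (h : Disjoint A (vars P))
    (hD : ¬ Face D A) (hE : d (e A) * P = E) : MeetIn (e A * P) D E := fun _ _ hGD hG =>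
  hE ▸ hG.of_e_mul h fun hAG => hD (hGD.mono hAG)

theorem subset_of_mem_supp_e_mul {B m : Finset ι} {X : Chain ι} (h : m ∈ supp (e B * X)) :
    B ⊆ m := by
  obtain ⟨k, hk, l, -, -, rfl⟩ := mem_supp_of_mul h
  rw [supp_e, Finset.mem_singleton] at hk
  exact hk ▸ Finset.subset_union_left

/-- All facets of `B * X` contain `B` and none of `Y` does, so the sum has no cancellation. -/
theorem Face.e_mul_add {B G : Finset ι} {X Y : Chain ι} (h : Face (e B * X) G)
    (hY : ¬ Face Y B) : Face (e B * X + Y) G := by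
  obtain ⟨m, hm, hG⟩ := h
  exact ⟨m, mem_supp_add.2 (Or.inl ⟨hm, fun h => hY ⟨m, h, subset_of_mem_supp_e_mul hm⟩⟩), hG⟩

theorem Face.add_e_mul {B G : Finset ι} {X Y : Chain ι} (h : Face Y G)
    (hY : ¬ Face Y B) : Face (e B * X + Y) G := by
  obtain ⟨m, hm, hG⟩ := h
  exact ⟨m, mem_supp_add.2 (Or.inr ⟨hm, fun h => hY ⟨m, hm, subset_of_mem_supp_e_mul h⟩⟩), hG⟩

theorem not_face_of_notMem_vars {K : Chain ι} {v : ι} (h : v ∉ vars K) : ¬ Face K {v} :=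
  fun hf => h (mem_vars_iff_face.2 hf)

theorem not_face_mul_right {K L : Chain ι} {G : Finset ι} (h : ¬ Face L G)
    (hG : Disjoint G (vars K)) : ¬ Face (K * L) G := fun hf => h (hf.of_mul_right hG)

theorem not_face_d {K : Chain ι} {G : Finset ι} (h : ¬ Face K G) : ¬ Face (d K) G :=
  fun hf => h hf.of_d

/-- For a ball `P`, a suspension-like sphere around `A` may be exchanged for a cone on `∂A * P`. -/
def Phi (P : Chain ι) : Prop :=
  ∀ (A : Finset ι) (Z : Chain ι) (x : ι), A.Nonempty → d Z = 0 → Disjoint A (vars Z) →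
    Disjoint A (vars P) → Disjoint (vars Z) (vars P) → x ∉ A → x ∉ vars Z → x ∉ vars P →
    Repl (e A * (Z * (P + e {x} * d P))) (e {x} * (d (e A) * (Z * P)))

variable [Infinite ι]

/-- Three exchanges. The flip of `b * A` against `B` turns the left side for the subdivided chain
into the left side for `B * R + T` plus `b * B * ∂A * Z * (R + x * ∂R)`. Then `Phi (B * R + T)`
applies, and the result regroups as an instance of `Phi (b * R)` with simplex `B` and cycle `∂A *
Z`, plus `x * ∂A * Z * T`. -/
theorem repl_cone_subdivision {A B : Finset ι} {x b : ι} {Z R T : Chain ι}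
    (hA : A.Nonempty) (hB : B.Nonempty) (hZ : d Z = 0) (hAZ : Disjoint A (vars Z))
    (hxA : x ∉ A) (hxZ : x ∉ vars Z) (hAB : Disjoint A B) (hbA : b ∉ A)
    (hAR : Disjoint A (vars R)) (hAT : Disjoint A (vars T))
    (hZB : Disjoint B (vars Z)) (hbZ : b ∉ vars Z)
    (hZR : Disjoint (vars Z) (vars R)) (hZT : Disjoint (vars Z) (vars T))
    (hxB : x ∉ B) (hxb : x ≠ b) (hxR : x ∉ vars R) (hxT : x ∉ vars T)
    (hbB : b ∉ B) (hBR : Disjoint B (vars R)) (hbR : b ∉ vars R) (hbT : b ∉ vars T)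
    (hBT : ¬ Face T B)
    (h1 : Phi (e B * R + T)) (h2 : Phi (e {b} * R)) :
    Repl (e A * (Z * ((e {b} * d (e B) * R + T) + e {x} * d (e {b} * d (e B) * R + T))))
      (e {x} * (d (e A) * (Z * (e {b} * d (e B) * R + T)))) := by
  have hBx : Disjoint B (vars (e {x})) := by simpa using hxB
  have hBb : Disjoint B (vars (e {b})) := by simpa using hbB
  have hBA : Disjoint B (vars (e A)) := by simpa using hAB.symm
  have hAx : Disjoint A (vars (e {x})) := by simpa using hxA
  have hAb : Disjoint A (vars (e {b})) := by simpa using hbA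
  have hAB' : Disjoint A (vars (e B)) := by simpa using hAB
  have hbx : b ∉ vars (e {x}) := by simpa using hxb.symm
  have hbA' : b ∉ vars (e A) := by simpa using hbA
  have hbB' : b ∉ vars (e B) := by simpa using hbB
  have hxb' : x ∉ vars (e {b}) := by simpa using hxb
  have hxA' : x ∉ vars (e A) := by simpa using hxA
  have hxB' : x ∉ vars (e B) := by simpa using hxB
  set U : Chain ι := d (e B) * R + d T with hU
  set Rh : Chain ι := Z * (R + e {x} * d R) with hRh
  have hdRh : d Rh = 0 := by
    rw [hRh, d_mul, hZ, map_add, d_vertex_mul, d_d]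
    linear_combination (Z * d R) * two_eq_zero (ι := ι)
  have hBRh : Disjoint B (vars Rh) := disjoint_vars_mul hZB
    (disjoint_vars_add hBR (disjoint_vars_mul hBx (disjoint_vars_d hBR)))
  have hARh : Disjoint A (vars Rh) := disjoint_vars_mul hAZ
    (disjoint_vars_add hAR (disjoint_vars_mul hAx (disjoint_vars_d hAR)))
  have hbRh : b ∉ vars Rh := notMem_vars_mul hbZ
    (notMem_vars_add hbR (notMem_vars_mul hbx (notMem_vars_d hbR)))
  have hUB : ¬ Face (T + e {x} * U) B := not_face_add hBT (not_face_mul_right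
    (not_face_add (not_face_d_mul hBR) (not_face_d hBT)) hBx)
  have hUb : b ∉ vars (T + e {x} * U) := notMem_vars_add hbT (notMem_vars_mul hbx
    (notMem_vars_add (notMem_vars_mul (notMem_vars_d hbB') hbR) (notMem_vars_d hbT)))
  have hD1B : ¬ Face (e A * (Z * (T + e {x} * U))) B :=
    not_face_mul_right (not_face_mul_right hUB hZB) hBA
  have hD1b : b ∉ vars (e A * (Z * (T + e {x} * U))) :=
    notMem_vars_mul hbA' (notMem_vars_mul hbZ hUb)
  have hdA : d (e (insert b A)) = e A + e {b} * d (e A) := by rw [e_insert hbA, d_vertex_mul]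
  have hibA : Disjoint (insert b A) B := by
    rw [Finset.disjoint_insert_left]; exact ⟨hbB, hAB⟩
  have hibRh : Disjoint (insert b A) (vars Rh) := by
    rw [Finset.disjoint_insert_left]; exact ⟨hbRh, hARh⟩
  -- replace the star of `b` by the star of `B`
  have s1 : Repl (e (insert b A) * (d (e B) * Rh) + e A * (Z * (T + e {x} * U)))
      (e B * (d (e (insert b A)) * Rh) + e A * (Z * (T + e {x} * U))) := by
    have hf := repl_flip (Finset.insert_nonempty b A) hB hibA hibRh hBRh hdRh
    have h3 : e (insert b A) * (d (e B) * Rh) = e (insert b A) * d (e B) * Rh := by ring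
    have h4 : e B * (d (e (insert b A)) * Rh) = d (e (insert b A)) * e B * Rh := by ring
    have h5 : d (e (insert b A) * d (e B) * Rh) = d (e (insert b A)) * (d (e B) * Rh) := by
      rw [d_mul, d_mul, d_d, hdRh]; ring
    rw [← h3, ← h4] at hf
    rw [← h3] at h5
    refine hf.add ?_ ?_
    · refine meetIn_e_mul (disjoint_vars_mul (disjoint_vars_d (by simpa using hibA)) hibRh) ?_
        h5.symm
      exact fun h => hD1b (h.subset_vars (Finset.mem_insert_self _ _))
    · refine meetIn_e_mul (disjoint_vars_mul (disjoint_vars_d (by simpa using hibA.symm)) hBRh)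
        hD1B ?_
      rw [h5]; ring
  have e1 : e A * (Z * ((e {b} * d (e B) * R + T) + e {x} * d (e {b} * d (e B) * R + T))) =
      e (insert b A) * (d (e B) * Rh) + e A * (Z * (T + e {x} * U)) := by
    rw [e_insert hbA, hRh, hU, map_add, mul_assoc, d_vertex_mul, d_mul, d_d]; ring
  have e2 : e B * (d (e (insert b A)) * Rh) + e A * (Z * (T + e {x} * U)) =
      e A * (Z * ((e B * R + T) + e {x} * d (e B * R + T))) + e {b} * (e B * (d (e A) * Rh)) := by
    rw [hdA, hRh, hU, map_add, d_mul]; ring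
  have hPhi := h1 A Z x hA hZ hAZ
    (disjoint_vars_add (disjoint_vars_mul hAB' hAR) hAT)
    (disjoint_vars_add (disjoint_vars_mul (by simpa using hZB.symm) hZR) hZT) hxA hxZ
    (notMem_vars_add (notMem_vars_mul hxB' hxR) hxT)
  have s2 : Repl (e A * (Z * ((e B * R + T) + e {x} * d (e B * R + T))) +
        e {b} * (e B * (d (e A) * Rh)))
      (e {x} * (d (e A) * (Z * (e B * R + T))) + e {b} * (e B * (d (e A) * Rh))) := by
    have hE : d (e A * (Z * ((e B * R + T) + e {x} * d (e B * R + T)))) =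
        d (e A) * (Z * ((e B * R + T) + e {x} * d (e B * R + T))) := by
      rw [d_mul (e A), d_mul Z, hZ, map_add d (e B * R + T), d_vertex_mul, d_d]
      linear_combination (e A * (Z * d (e B * R + T))) * two_eq_zero (ι := ι)
    have hE2 : d (e A) * (Z * ((e B * R + T) + e {x} * d (e B * R + T))) =
        e B * (d (e A) * Rh) + d (e A) * (Z * (T + e {x} * U)) := by
      rw [hRh, hU, map_add, d_mul]; ring
    have hAP : Disjoint A (vars (e B * R + T)) :=
      disjoint_vars_add (disjoint_vars_mul hAB' hAR) hAT
    refine hPhi.add ?_ ?_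
    · refine meetIn_e_mul (disjoint_vars_mul hAZ (disjoint_vars_add hAP
        (disjoint_vars_mul hAx (disjoint_vars_d hAP)))) ?_ hE.symm
      exact not_face_mul_right (not_face_mul_right (not_face_d_mul hARh) hAB') hAb
    · intro G _ hG hGC
      rw [hE, hE2]
      have hbG : ¬ {b} ⊆ G := by
        rw [Finset.singleton_subset_iff]
        intro h
        exact notMem_vars_mul hbx (notMem_vars_mul (notMem_vars_d hbA') (notMem_vars_mul hbZ
          (notMem_vars_add (notMem_vars_mul hbB' hbR) hbT))) (hGC.subset_vars h)
      have hG2 := hG.of_e_mul (by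
        simpa using notMem_vars_mul hbB' (notMem_vars_mul (notMem_vars_d hbA') hbRh)) hbG
      rw [d_vertex, one_mul] at hG2
      exact hG2.e_mul_add (not_face_mul_right (not_face_mul_right hUB hZB) (disjoint_vars_d hBA))
  have e3 : e {x} * (d (e A) * (Z * (e B * R + T))) + e {b} * (e B * (d (e A) * Rh)) =
      e B * ((d (e A) * Z) * (e {b} * R + e {x} * d (e {b} * R))) +
        e {x} * (d (e A) * (Z * T)) := by
    rw [hRh, d_vertex_mul]; ring
  have hdAZ : d (d (e A) * Z) = 0 := by rw [d_mul, d_d, hZ]; ring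
  have hBAZ : Disjoint B (vars (d (e A) * Z)) := disjoint_vars_mul (disjoint_vars_d hBA) hZB
  have hBbR : Disjoint B (vars (e {b} * R)) := disjoint_vars_mul hBb hBR
  have hAZR : Disjoint (vars (d (e A) * Z)) (vars (e {b} * R)) :=
    disjoint_vars_mul
      (disjoint_comm.1 (disjoint_vars_mul (disjoint_vars_d (by simpa using hbA))
        (by simpa using hbZ)))
      (disjoint_comm.1 (disjoint_vars_mul (disjoint_vars_d (by simpa using hAR.symm)) hZR.symm))
  have hPhi2 := h2 B (d (e A) * Z) x hB hdAZ hBAZ hBbR hAZR hxB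
    (notMem_vars_mul (notMem_vars_d hxA') hxZ) (notMem_vars_mul hxb' hxR)
  have s3 : Repl (e B * ((d (e A) * Z) * (e {b} * R + e {x} * d (e {b} * R))) +
        e {x} * (d (e A) * (Z * T)))
      (e {x} * (d (e B) * (d (e A) * Z * (e {b} * R))) + e {x} * (d (e A) * (Z * T))) := by
    have hE : d (e B * ((d (e A) * Z) * (e {b} * R + e {x} * d (e {b} * R)))) =
        d (e B) * ((d (e A) * Z) * (e {b} * R + e {x} * d (e {b} * R))) := by
      rw [d_mul (e B), d_mul (d (e A) * Z), hdAZ, map_add d (e {b} * R), d_vertex_mul x, d_d]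
      linear_combination (e B * (d (e A) * Z * d (e {b} * R))) * two_eq_zero (ι := ι)
    refine hPhi2.add ?_ ?_
    · refine meetIn_e_mul (disjoint_vars_mul hBAZ (disjoint_vars_add hBbR
        (disjoint_vars_mul hBx (disjoint_vars_d hBbR)))) ?_ hE.symm
      exact not_face_mul_right (not_face_mul_right (not_face_mul_right hBT hZB)
        (disjoint_vars_d hBA)) hBx
    · intro G _ hG hGC
      rw [hE]
      have hbG : ¬ {b} ⊆ G := by
        rw [Finset.singleton_subset_iff]
        intro h
        exact notMem_vars_mul hbx (notMem_vars_mul (notMem_vars_d hbA') (notMem_vars_mul hbZ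
          hbT)) (hG.subset_vars h)
      have hbY : b ∉ vars (e {x} * (d (e B) * (d (e A) * Z * R))) :=
        notMem_vars_mul hbx (notMem_vars_mul (notMem_vars_d hbB') (notMem_vars_mul
          (notMem_vars_mul (notMem_vars_d hbA') hbZ) hbR))
      rw [show e {x} * (d (e B) * (d (e A) * Z * (e {b} * R))) =
        e {b} * (e {x} * (d (e B) * (d (e A) * Z * R))) by ring] at hGC
      have hG2 := hGC.of_e_mul (by simpa using hbY) hbG
      rw [d_vertex, one_mul] at hG2
      have := hG2.add_e_mul (B := {b}) (X := d (e B) * ((d (e A) * Z) * (R + e {x} * d R)))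
        (not_face_of_notMem_vars hbY)
      convert this using 1
      rw [d_vertex_mul]; ring
  rw [e1]
  refine s1.trans ?_
  rw [e2]
  refine s2.trans ?_
  rw [e3]
  refine s3.trans (Repl.of_eq ?_)
  ring

/-- The inverse of the preceding argument: starring at `A ∪ B` with vertex `b` produces the left
side for the subdivided chain plus the same correction term. After its `Phi`, the rest regroups as
an instance of `Phi (B * R)` with the simplex `{b}` and the cycle `∂A * Z`. -/
theorem repl_cone_weld {A B : Finset ι} {x b : ι} {Z R T : Chain ι}
    (hA : A.Nonempty) (hZ : d Z = 0) (hAZ : Disjoint A (vars Z))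
    (hxA : x ∉ A) (hxZ : x ∉ vars Z) (hAB : Disjoint A B) (hbA : b ∉ A)
    (hAR : Disjoint A (vars R)) (hAT : Disjoint A (vars T))
    (hZB : Disjoint B (vars Z)) (hbZ : b ∉ vars Z)
    (hZR : Disjoint (vars Z) (vars R)) (hZT : Disjoint (vars Z) (vars T))
    (hxB : x ∉ B) (hxb : x ≠ b) (hxR : x ∉ vars R) (hxT : x ∉ vars T)
    (hbB : b ∉ B) (hBR : Disjoint B (vars R)) (hbR : b ∉ vars R) (hbT : b ∉ vars T)
    (hBT : ¬ Face T B)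
    (h1 : Phi (e {b} * d (e B) * R + T)) (h2 : Phi (e B * R)) :
    Repl (e A * (Z * ((e B * R + T) + e {x} * d (e B * R + T))))
      (e {x} * (d (e A) * (Z * (e B * R + T)))) := by
  have hBx : Disjoint B (vars (e {x})) := by simpa using hxB
  have hBb : Disjoint B (vars (e {b})) := by simpa using hbB
  have hBA : Disjoint B (vars (e A)) := by simpa using hAB.symm
  have hAx : Disjoint A (vars (e {x})) := by simpa using hxA
  have hAb : Disjoint A (vars (e {b})) := by simpa using hbA
  have hAB' : Disjoint A (vars (e B)) := by simpa using hAB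
  have hbx : b ∉ vars (e {x}) := by simpa using hxb.symm
  have hbA' : b ∉ vars (e A) := by simpa using hbA
  have hbB' : b ∉ vars (e B) := by simpa using hbB
  have hxb' : x ∉ vars (e {b}) := by simpa using hxb
  have hxA' : x ∉ vars (e A) := by simpa using hxA
  have hxB' : x ∉ vars (e B) := by simpa using hxB
  set U : Chain ι := d (e B) * R + d T with hU
  set Rh : Chain ι := Z * (R + e {x} * d R) with hRh
  have hdRh : d Rh = 0 := by
    rw [hRh, d_mul, hZ, map_add, d_vertex_mul, d_d]
    linear_combination (Z * d R) * two_eq_zero (ι := ι)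
  have hBRh : Disjoint B (vars Rh) := disjoint_vars_mul hZB
    (disjoint_vars_add hBR (disjoint_vars_mul hBx (disjoint_vars_d hBR)))
  have hARh : Disjoint A (vars Rh) := disjoint_vars_mul hAZ
    (disjoint_vars_add hAR (disjoint_vars_mul hAx (disjoint_vars_d hAR)))
  have hbRh : b ∉ vars Rh := notMem_vars_mul hbZ
    (notMem_vars_add hbR (notMem_vars_mul hbx (notMem_vars_d hbR)))
  have hUB : ¬ Face (T + e {x} * U) B := not_face_add hBT (not_face_mul_right
    (not_face_add (not_face_d_mul hBR) (not_face_d hBT)) hBx)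
  have hUb : b ∉ vars (T + e {x} * U) := notMem_vars_add hbT (notMem_vars_mul hbx
    (notMem_vars_add (notMem_vars_mul (notMem_vars_d hbB') hbR) (notMem_vars_d hbT)))
  have hD1B : ¬ Face (e A * (Z * (T + e {x} * U))) B :=
    not_face_mul_right (not_face_mul_right hUB hZB) hBA
  have hD1b : b ∉ vars (e A * (Z * (T + e {x} * U))) :=
    notMem_vars_mul hbA' (notMem_vars_mul hbZ hUb)
  have hABb : Disjoint (A ∪ B) {b} := by simp [hbA, hbB]
  have hABRh : Disjoint (A ∪ B) (vars Rh) := Finset.disjoint_union_left.2 ⟨hARh, hBRh⟩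
  have hbdAB : b ∉ vars (d (e (A ∪ B)) * Rh) :=
    notMem_vars_mul (notMem_vars_d (by simp [hbA, hbB])) hbRh
  -- subdivide at `A ∪ B`
  have s1 : Repl (e (A ∪ B) * Rh + e A * (Z * (T + e {x} * U)))
      (e {b} * (d (e (A ∪ B)) * Rh) + e A * (Z * (T + e {x} * U))) := by
    have hf := repl_flip (hA.mono Finset.subset_union_left) (Finset.singleton_nonempty b) hABb
      hABRh (by simpa using hbRh) hdRh
    have h3 : e (A ∪ B) * Rh = e (A ∪ B) * d (e {b}) * Rh := by rw [d_vertex, mul_one]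
    have h4 : e {b} * (d (e (A ∪ B)) * Rh) = d (e (A ∪ B)) * e {b} * Rh := by ring
    have h5 : d (e (A ∪ B) * Rh) = d (e (A ∪ B)) * Rh := by
      rw [d_mul, hdRh]; ring
    rw [← h3, ← h4] at hf
    refine hf.add ?_ ?_
    · exact meetIn_e_mul hABRh (fun h => hD1B (h.mono Finset.subset_union_right)) h5.symm
    · refine meetIn_e_mul (by simpa using hbdAB) (not_face_of_notMem_vars hD1b) ?_
      rw [h5, d_vertex, one_mul]
  have e1 : e A * (Z * ((e B * R + T) + e {x} * d (e B * R + T))) =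
      e (A ∪ B) * Rh + e A * (Z * (T + e {x} * U)) := by
    rw [e_union hAB, hRh, hU, map_add, d_mul]; ring
  have e2 : e {b} * (d (e (A ∪ B)) * Rh) + e A * (Z * (T + e {x} * U)) =
      e A * (Z * ((e {b} * d (e B) * R + T) + e {x} * d (e {b} * d (e B) * R + T))) +
        e {b} * (e B * (d (e A) * Rh)) := by
    rw [e_union hAB, hRh, hU, map_add, d_mul (e A), mul_assoc (e {b}) _ R, d_vertex_mul b,
      d_mul _ R, d_d]; ring
  have hbdBR : Disjoint A (vars (e {b} * d (e B) * R)) :=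
    disjoint_vars_mul (disjoint_vars_mul hAb (disjoint_vars_d hAB')) hAR
  have hPhi := h1 A Z x hA hZ hAZ (disjoint_vars_add hbdBR hAT)
    (disjoint_vars_add (disjoint_vars_mul (disjoint_vars_mul (by simpa using hbZ)
      (disjoint_vars_d (by simpa using hZB.symm))) hZR) hZT) hxA hxZ
    (notMem_vars_add (notMem_vars_mul (notMem_vars_mul hxb' (notMem_vars_d hxB')) hxR) hxT)
  have s2 : Repl (e A * (Z * ((e {b} * d (e B) * R + T) +
        e {x} * d (e {b} * d (e B) * R + T))) + e {b} * (e B * (d (e A) * Rh)))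
      (e {x} * (d (e A) * (Z * (e {b} * d (e B) * R + T))) + e {b} * (e B * (d (e A) * Rh))) := by
    have hE : d (e A * (Z * ((e {b} * d (e B) * R + T) +
          e {x} * d (e {b} * d (e B) * R + T)))) =
        d (e A) * (Z * ((e {b} * d (e B) * R + T) + e {x} * d (e {b} * d (e B) * R + T))) := by
      rw [d_mul (e A), d_mul Z, hZ, map_add d (e {b} * d (e B) * R + T), d_vertex_mul x, d_d]
      linear_combination (e A * (Z * d (e {b} * d (e B) * R + T))) * two_eq_zero (ι := ι)
    have hE2 : d (e A) * (Z * ((e {b} * d (e B) * R + T) +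
          e {x} * d (e {b} * d (e B) * R + T))) =
        e {b} * (d (e B) * (d (e A) * Rh)) + d (e A) * (Z * (T + e {x} * U)) := by
      rw [hRh, hU, map_add, mul_assoc (e {b}) _ R, d_vertex_mul b, d_mul _ R, d_d]; ring
    have hAP : Disjoint A (vars (e {b} * d (e B) * R + T)) := disjoint_vars_add hbdBR hAT
    refine hPhi.add ?_ ?_
    · refine meetIn_e_mul (disjoint_vars_mul hAZ (disjoint_vars_add hAP
        (disjoint_vars_mul hAx (disjoint_vars_d hAP)))) ?_ hE.symm
      exact not_face_mul_right (not_face_mul_right (not_face_d_mul hARh) hAB') hAb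
    · intro G _ hG hGC
      rw [hE, hE2]
      have hBG : ¬ B ⊆ G := by
        intro h
        refine not_face_mul_right (not_face_mul_right (not_face_mul_right (not_face_add ?_ hBT)
          hZB) (disjoint_vars_d hBA)) hBx (hGC.mono h)
        rw [show e {b} * d (e B) * R = e {b} * (d (e B) * R) by ring]
        exact not_face_mul_right (not_face_d_mul hBR) hBb
      rw [show e {b} * (e B * (d (e A) * Rh)) = e B * (e {b} * (d (e A) * Rh)) by ring] at hG
      have hG2 := hG.of_e_mul (disjoint_vars_mul hBb (disjoint_vars_mul (disjoint_vars_d hBA)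
        hBRh)) hBG
      rw [show d (e B) * (e {b} * (d (e A) * Rh)) = e {b} * (d (e B) * (d (e A) * Rh)) by ring]
        at hG2
      exact hG2.e_mul_add (not_face_of_notMem_vars (notMem_vars_mul (notMem_vars_d hbA')
        (notMem_vars_mul hbZ hUb)))
  have e3 : e {x} * (d (e A) * (Z * (e {b} * d (e B) * R + T))) +
        e {b} * (e B * (d (e A) * Rh)) =
      e {b} * ((d (e A) * Z) * (e B * R + e {x} * d (e B * R))) +
        e {x} * (d (e A) * (Z * T)) := by
    rw [hRh, d_mul (e B)]; ring
  have hdAZ : d (d (e A) * Z) = 0 := by rw [d_mul, d_d, hZ]; ring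
  have hBAZ : Disjoint B (vars (d (e A) * Z)) := disjoint_vars_mul (disjoint_vars_d hBA) hZB
  have hbAZ : b ∉ vars (d (e A) * Z) := notMem_vars_mul (notMem_vars_d hbA') hbZ
  have hbBR : b ∉ vars (e B * R) := notMem_vars_mul hbB' hbR
  have hAZR : Disjoint (vars (d (e A) * Z)) (vars (e B * R)) :=
    disjoint_vars_mul (by simpa using hBAZ.symm)
      (disjoint_comm.1 (disjoint_vars_mul (disjoint_vars_d (by simpa using hAR.symm)) hZR.symm))
  have hPhi2 := h2 {b} (d (e A) * Z) x (Finset.singleton_nonempty b) hdAZ (by simpa using hbAZ)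
    (by simpa using hbBR) hAZR (by simpa using hxb)
    (notMem_vars_mul (notMem_vars_d hxA') hxZ) (notMem_vars_mul hxB' hxR)
  rw [d_vertex, one_mul] at hPhi2
  have s3 : Repl (e {b} * ((d (e A) * Z) * (e B * R + e {x} * d (e B * R))) +
        e {x} * (d (e A) * (Z * T)))
      (e {x} * (d (e A) * Z * (e B * R)) + e {x} * (d (e A) * (Z * T))) := by
    have hE : d (e {b} * ((d (e A) * Z) * (e B * R + e {x} * d (e B * R)))) =
        (d (e A) * Z) * (e B * R + e {x} * d (e B * R)) := by
      rw [d_vertex_mul b, d_mul (d (e A) * Z), hdAZ, map_add d (e B * R), d_vertex_mul x, d_d]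
      linear_combination (e {b} * (d (e A) * Z * d (e B * R))) * two_eq_zero (ι := ι)
    refine hPhi2.add ?_ ?_
    · refine meetIn_e_mul ?_ (not_face_of_notMem_vars (notMem_vars_mul hbx (notMem_vars_mul
        (notMem_vars_d hbA') (notMem_vars_mul hbZ hbT)))) (by rw [hE, d_vertex, one_mul])
      rw [Finset.disjoint_singleton_left]
      exact notMem_vars_mul hbAZ (notMem_vars_add hbBR (notMem_vars_mul hbx (notMem_vars_d hbBR)))
    · intro G _ hG hGC
      rw [hE]
      have hBG : ¬ B ⊆ G := fun h => not_face_mul_right (not_face_mul_right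
        (not_face_mul_right hBT hZB) (disjoint_vars_d hBA)) hBx (hG.mono h)
      have hBY : Disjoint B (vars (e {x} * (d (e A) * Z * R))) :=
        disjoint_vars_mul hBx (disjoint_vars_mul hBAZ hBR)
      rw [show e {x} * (d (e A) * Z * (e B * R)) = e B * (e {x} * (d (e A) * Z * R)) by ring]
        at hGC
      have hG2 := hGC.of_e_mul hBY hBG
      have := hG2.add_e_mul (B := B) (X := (d (e A) * Z) * (R + e {x} * d R))
        (not_face_d_mul hBY)
      convert this using 1
      rw [d_mul (e B)]; ring
  rw [e1]
  refine s1.trans ?_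
  rw [e2]
  refine s2.trans ?_
  rw [e3]
  refine s3.trans (Repl.of_eq ?_)
  ring

end

end StellarChain

/-! ### Balls and spheres: boundaries, joins and links. -/

namespace StellarChain

noncomputable section

variable {ι : Type*} [DecidableEq ι]

/-- Balls of dimension `k - 1`. -/
def Ball (k : ℕ) (K : Chain ι) : Prop := 1 ≤ k ∧ ∃ D : Finset ι, D.card = k ∧ Eqv K (e D)

/-- Spheres of dimension `k - 1`. -/
def Sph (k : ℕ) (K : Chain ι) : Prop := ∃ D : Finset ι, D.card = k + 1 ∧ Eqv K (d (e D))

def BallOrSph (k : ℕ) (K : Chain ι) : Prop := Ball k K ∨ Sph k K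

theorem Ball.of_eqv {k : ℕ} {K L : Chain ι} (h : Ball k L) (hK : Eqv K L) : Ball k K := by
  obtain ⟨hk, D, hD, h⟩ := h
  exact ⟨hk, D, hD, hK.trans h⟩

theorem Sph.of_eqv {k : ℕ} {K L : Chain ι} (h : Sph k L) (hK : Eqv K L) : Sph k K := by
  obtain ⟨D, hD, h⟩ := h
  exact ⟨D, hD, hK.trans h⟩

theorem BallOrSph.of_eqv {k : ℕ} {K L : Chain ι} (h : BallOrSph k L) (hK : Eqv K L) :
    BallOrSph k K := h.imp (fun h => h.of_eqv hK) (fun h => h.of_eqv hK)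

theorem e_ne_zero (A : Finset ι) : e A ≠ 0 := by
  rw [Ne, ← supp_eq_empty, supp_e]; simp

theorem d_e_ne_zero {A : Finset ι} (hA : A.Nonempty) : d (e A) ≠ 0 := by
  obtain ⟨v, hv⟩ := hA
  rw [Ne, ← supp_eq_empty]
  exact Finset.ne_empty_of_mem (mem_supp_d_e.2 ⟨v, hv, rfl⟩)

theorem mul_ne_zero' {K L : Chain ι} (h : Disjoint (vars K) (vars L)) (hK : K ≠ 0) (hL : L ≠ 0) :
    K * L ≠ 0 := by
  rw [← face_empty] at hK hL ⊢
  simpa using face_mul h hK hL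

/-- The product rule displays the move on the boundary: same simplex and vertex, link `d P`, and
remainder `∂A * P + d Q` in both chains. -/
theorem StarAt.boundary {A : Finset ι} {a : ι} {P Q K K' : Chain ι} (h : StarAt A a P Q K K') :
    StarAt A a (d P) (d (e A) * P + d Q) (d K) (d K') := by
  obtain ⟨h1, h2, h3, h4, h5, h6, rfl, rfl⟩ := h
  refine ⟨h1, h2, disjoint_vars_d h3, notMem_vars_d h4, notMem_vars_add (notMem_vars_mul
    (notMem_vars_d (by simpa using h2)) h4) (notMem_vars_d h5), not_face_add (not_face_d_mul h3)
    (not_face_d h6), ?_, ?_⟩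
  · rw [map_add, d_mul]; ring
  · rw [map_add, mul_assoc, d_vertex_mul, d_mul, d_d]; ring

theorem Eqv.boundary {K L : Chain ι} (h : Eqv K L) : Eqv (d K) (d L) := by
  induction h with
  | rel K L h =>
    obtain ⟨A, a, P, Q, h⟩ := h
    exact h.boundary.eqv
  | refl K => exact .refl _
  | symm K L _ ih => exact ih.symm
  | trans K L M _ _ ih1 ih2 => exact ih1.trans ih2

theorem vars_d_e_disjoint {A : Finset ι} {P : Chain ι} (h : Disjoint A (vars P)) :
    Disjoint (vars (d (e A))) (vars P) := Finset.disjoint_of_subset_left (vars_d_e_subset A) h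

theorem StarAt.lk_vertex {A : Finset ι} {a : ι} {P Q K K' : Chain ι} (h : StarAt A a P Q K K') :
    lk {a} K' = d (e A) * P := by
  obtain ⟨h1, h2, h3, h4, h5, h6, rfl, rfl⟩ := h
  rw [mul_assoc]
  refine lk_eq ?_ (not_face_of_notMem_vars h5)
  rw [Finset.disjoint_singleton_left]
  exact notMem_vars_mul (notMem_vars_d (by simpa using h2)) h4

theorem StarAt.lk_simplex {A : Finset ι} {a : ι} {P Q K K' : Chain ι} (h : StarAt A a P Q K K') :
    lk A K = P := by
  obtain ⟨h1, h2, h3, h4, h5, h6, rfl, rfl⟩ := h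
  exact lk_eq h3 h6

theorem StarAt.eq_of_zero {A : Finset ι} {a : ι} {Q K K' : Chain ι} (h : StarAt A a 0 Q K K') :
    K = K' := by
  obtain ⟨h1, h2, h3, h4, h5, h6, rfl, rfl⟩ := h
  rw [mul_zero, mul_zero]

/-- Applied to boundaries, this makes being a cycle a stellar invariant, and so the vanishing of the
boundary tells spheres from balls. -/
theorem eqv_zero_iff {K L : Chain ι} (h : Eqv K L) : K = 0 ↔ L = 0 := by
  induction h with
  | rel K L h =>
    obtain ⟨A, a, P, Q, h⟩ := h
    by_cases hP : P = 0
    · subst hP; rw [h.eq_of_zero]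
    · have h1 : K ≠ 0 := fun hK => hP (by rw [← h.lk_simplex, hK, map_zero])
      have h2 : L ≠ 0 := fun hL => mul_ne_zero' (vars_d_e_disjoint h.2.2.1) (d_e_ne_zero h.1) hP
        (by rw [← h.lk_vertex, hL, map_zero])
      simp [h1, h2]
  | refl K => rfl
  | symm K L _ ih => exact ih.symm
  | trans K L M _ _ ih1 ih2 => exact ih1.trans ih2

theorem Sph.d_eq_zero {k : ℕ} {K : Chain ι} (h : Sph k K) : d K = 0 := by
  obtain ⟨D, _, h⟩ := h
  rw [eqv_zero_iff h.boundary, d_d]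

theorem Ball.d_ne_zero {k : ℕ} {K : Chain ι} (h : Ball k K) : d K ≠ 0 := by
  obtain ⟨hk, D, hD, h⟩ := h
  rw [Ne, eqv_zero_iff h.boundary]
  exact d_e_ne_zero (Finset.card_pos.1 (by omega))

theorem Sph.ne_zero {k : ℕ} {K : Chain ι} (h : Sph k K) : K ≠ 0 := by
  obtain ⟨D, hD, h⟩ := h
  rw [Ne, eqv_zero_iff h]
  exact d_e_ne_zero (Finset.card_pos.1 (by omega))

theorem BallOrSph.sph {k : ℕ} {K : Chain ι} (h : BallOrSph k K) (hd : d K = 0) : Sph k K :=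
  h.resolve_left fun hb => hb.d_ne_zero hd

theorem BallOrSph.ball {k : ℕ} {K : Chain ι} (h : BallOrSph k K) (hd : d K ≠ 0) : Ball k K :=
  h.resolve_right fun hb => hd hb.d_eq_zero

/-! ### Joins -/

/-- A sequence of moves uses finitely many vertices; a factor `W` avoiding them goes along with
every move. -/
theorem exists_eqv_mul {K L : Chain ι} (h : Eqv K L) :
    ∃ N : Finset ι, ∀ W : Chain ι, Disjoint (vars W) N → Eqv (W * K) (W * L) := by
  induction h with
  | rel K L h =>
    obtain ⟨A, a, P, Q, h1, h2, h3, h4, h5, h6, rfl, rfl⟩ := h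
    refine ⟨insert a A, fun W hW => ?_⟩
    rw [Finset.disjoint_insert_right] at hW
    exact StarAt.eqv (A := A) (a := a) (P := W * P) (Q := W * Q)
      ⟨h1, h2, disjoint_vars_mul hW.2.symm h3, notMem_vars_mul hW.1 h4, notMem_vars_mul hW.1 h5,
        not_face_mul_right h6 hW.2.symm, by ring, by ring⟩
  | refl K => exact ⟨∅, fun _ _ => .refl _⟩
  | symm K L _ ih =>
    obtain ⟨N, hN⟩ := ih
    exact ⟨N, fun W hW => (hN W hW).symm⟩
  | trans K L M _ _ ih1 ih2 =>
    obtain ⟨N1, hN1⟩ := ih1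
    obtain ⟨N2, hN2⟩ := ih2
    refine ⟨N1 ∪ N2, fun W hW => ?_⟩
    rw [Finset.disjoint_union_right] at hW
    exact (hN1 W hW.1).trans (hN2 W hW.2)

theorem disjoint_map_of_avoid {σ : Equiv.Perm ι} {F S N A : Finset ι}
    (h : ∀ v ∈ S, v ∉ F → σ v ∉ N) (hA : A ⊆ S) (hAF : Disjoint A F) :
    Disjoint (A.map σ.toEmbedding) N := by
  rw [Finset.disjoint_left]
  intro w hw
  obtain ⟨v, hv, rfl⟩ := Finset.mem_map.1 hw
  exact h v (hA hv) (Finset.disjoint_left.1 hAF hv)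

variable [Infinite ι]

theorem Eqv.mul {K L W : Chain ι} (h : Eqv K L) (hK : Disjoint (vars W) (vars K))
    (hL : Disjoint (vars W) (vars L)) : Eqv (W * K) (W * L) := by
  obtain ⟨N, hN⟩ := exists_eqv_mul h
  obtain ⟨σ, h1, h2⟩ := exists_perm_avoid (vars K ∪ vars L) (vars W) N
  have h3 := hN (StellarChain.rn σ W) (by
    rw [vars_rn]
    exact disjoint_map_of_avoid h2 subset_rfl (Finset.disjoint_union_right.2 ⟨hK, hL⟩))
  have h4 : ∀ M : Chain ι, vars M ⊆ vars K ∪ vars L → Eqv (W * M) (StellarChain.rn σ W * M) := by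
    intro M hM
    have : StellarChain.rn σ M = M := rn_eq_self fun v hv => h1 v (hM hv)
    conv_rhs => rw [← this, ← rn_mul]
    exact eqv_rn _ _
  exact ((h4 K Finset.subset_union_left).trans h3).trans (h4 L Finset.subset_union_right).symm

theorem exists_disjoint_map (D A : Finset ι) :
    ∃ σ : Equiv.Perm ι, Disjoint (D.map σ.toEmbedding) A := by
  obtain ⟨σ, -, h⟩ := exists_perm_avoid ∅ D A
  exact ⟨σ, disjoint_map_of_avoid h subset_rfl (by simp)⟩

/-- The left side is the starring of the simplex `A ∪ D` at its face `A`, with new vertex `c`. -/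
theorem eqv_d_e_mul_e {A D : Finset ι} {c : ι} (hA : A.Nonempty) (hc : c ∉ D) (hcA : c ∉ A)
    (hAD : Disjoint A D) : Eqv (d (e A) * e (insert c D)) (e (A ∪ D)) := by
  refine Eqv.symm (StarAt.eqv (A := A) (a := c) (P := e D) (Q := 0)
    ⟨hA, hcA, by simpa using hAD, by simpa using hc, by simp, by simp, ?_, ?_⟩)
  · rw [e_union hAD, add_zero]
  · rw [e_insert hc]; ring

/-- Star `∂(A ∪ D) = A * ∂D + ∂A * D` at `A`: the result is `∂A * (c * ∂D + D) = ∂A * ∂(c * D)`. -/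
theorem eqv_d_e_mul_d_e {A D : Finset ι} {c : ι} (hA : A.Nonempty) (hc : c ∉ D) (hcA : c ∉ A)
    (hAD : Disjoint A D) : Eqv (d (e A) * d (e (insert c D))) (d (e (A ∪ D))) := by
  refine Eqv.symm (StarAt.eqv (A := A) (a := c) (P := d (e D)) (Q := d (e A) * e D)
    ⟨hA, hcA, disjoint_vars_d (by simpa using hAD), notMem_vars_d (by simpa using hc),
      notMem_vars_mul (notMem_vars_d (by simpa using hcA)) (by simpa using hc),
      not_face_d_mul (by simpa using hAD), ?_, ?_⟩)
  · rw [e_union hAD, d_mul]; ring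
  · rw [e_insert hc, d_vertex_mul]; ring

theorem Ball.d_e_mul {k j : ℕ} {X : Chain ι} {A : Finset ι} (h : Ball k X)
    (hA : A.card = j + 1) (hAX : Disjoint A (vars X)) : Ball (k + j) (d (e A) * X) := by
  obtain ⟨hk, D, hD, h⟩ := h
  obtain ⟨σ, hσ⟩ := exists_disjoint_map D A
  have hcard : (D.map σ.toEmbedding).card = k := by rw [Finset.card_map, hD]
  have h' : Eqv X (e (D.map σ.toEmbedding)) := by
    rw [← rn_e]; exact h.trans (eqv_rn _ _)
  obtain ⟨c, hc⟩ : (D.map σ.toEmbedding).Nonempty := Finset.card_pos.1 (by omega)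
  set D' := D.map σ.toEmbedding
  have hE : insert c (D'.erase c) = D' := Finset.insert_erase hc
  have hAD : Disjoint A (D'.erase c) :=
    Finset.disjoint_of_subset_right (Finset.erase_subset _ _) hσ.symm
  have h2 := eqv_d_e_mul_e (A := A) (Finset.card_pos.1 (by omega)) (Finset.notMem_erase c D')
    (Finset.disjoint_left.1 hσ hc) hAD
  rw [hE] at h2
  refine ⟨by omega, A ∪ D'.erase c, ?_, (Eqv.mul h' (vars_d_e_disjoint hAX) ?_).trans h2⟩
  · rw [Finset.card_union_of_disjoint hAD, Finset.card_erase_of_mem hc]; omega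
  · exact vars_d_e_disjoint (by simpa using hσ.symm)

theorem Sph.d_e_mul {k j : ℕ} {X : Chain ι} {A : Finset ι} (h : Sph k X)
    (hA : A.card = j + 1) (hAX : Disjoint A (vars X)) : Sph (k + j) (d (e A) * X) := by
  obtain ⟨D, hD, h⟩ := h
  obtain ⟨σ, hσ⟩ := exists_disjoint_map D A
  have hcard : (D.map σ.toEmbedding).card = k + 1 := by rw [Finset.card_map, hD]
  have h' : Eqv X (d (e (D.map σ.toEmbedding))) := by
    rw [← rn_e, ← rn_d]; exact h.trans (eqv_rn _ _)
  obtain ⟨c, hc⟩ : (D.map σ.toEmbedding).Nonempty := Finset.card_pos.1 (by omega)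
  set D' := D.map σ.toEmbedding
  have hE : insert c (D'.erase c) = D' := Finset.insert_erase hc
  have hAD : Disjoint A (D'.erase c) :=
    Finset.disjoint_of_subset_right (Finset.erase_subset _ _) hσ.symm
  have h2 := eqv_d_e_mul_d_e (A := A) (Finset.card_pos.1 (by omega)) (Finset.notMem_erase c D')
    (Finset.disjoint_left.1 hσ hc) hAD
  rw [hE] at h2
  refine ⟨A ∪ D'.erase c, ?_, (Eqv.mul h' (vars_d_e_disjoint hAX) ?_).trans h2⟩
  · rw [Finset.card_union_of_disjoint hAD, Finset.card_erase_of_mem hc]; omega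
  · exact vars_d_e_disjoint (disjoint_vars_d (by simpa using hσ.symm))

theorem BallOrSph.d_e_mul {k j : ℕ} {X : Chain ι} {A : Finset ι} (h : BallOrSph k X)
    (hA : A.card = j + 1) (hAX : Disjoint A (vars X)) : BallOrSph (k + j) (d (e A) * X) :=
  h.imp (fun h => h.d_e_mul hA hAX) (fun h => h.d_e_mul hA hAX)

/-! ### Links -/

/-- Differentiate the decomposition of `K` at `A`; the terms besides `A * d (lk A K)` do not contain
`A`, and the decomposition is unique. -/
theorem lk_d (A : Finset ι) (K : Chain ι) : lk A (d K) = d (lk A K) := by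
  have h : d K = e A * d (lk A K) + (d (e A) * lk A K + d (dl A K)) := by
    conv_lhs => rw [eq_lk_add_dl A K, map_add, d_mul]
    ring
  rw [h]
  exact lk_eq (disjoint_vars_d (disjoint_vars_lk A K)) (not_face_add
    (not_face_d_mul (disjoint_vars_lk A K)) (not_face_d (not_face_dl A K)))

theorem lk_union {A B : Finset ι} (h : Disjoint A B) (K : Chain ι) :
    lk (A ∪ B) K = lk B (lk A K) := by
  apply chain_ext
  ext m
  simp only [mem_supp_lk, Finset.disjoint_union_left, Finset.disjoint_union_right,
    Finset.union_assoc]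
  tauto

theorem lk_mul_of_disjoint {A : Finset ι} {K : Chain ι} (h : Disjoint A (vars K)) (L : Chain ι) :
    lk A (K * L) = K * lk A L := by
  have h1 : K * L = e A * (K * lk A L) + K * dl A L := by
    conv_lhs => rw [eq_lk_add_dl A L]
    ring
  rw [h1]
  exact lk_eq (disjoint_vars_mul h (disjoint_vars_lk A L)) (not_face_mul_right (not_face_dl A L) h)

theorem lk_inter_e (A G : Finset ι) : lk (G ∩ A) (e A) = e (A \ G) := by
  rw [lk_e, if_pos Finset.inter_subset_right]
  congr 1
  ext v
  simp only [Finset.mem_sdiff, Finset.mem_inter]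
  tauto

theorem lk_inter_sdiff (A G : Finset ι) (K : Chain ι) : lk G K = lk (G \ A) (lk (G ∩ A) K) := by
  rw [← lk_union (Finset.disjoint_of_subset_left Finset.inter_subset_right
    Finset.disjoint_sdiff), Finset.union_comm, Finset.sdiff_union_inter]

theorem lk_e_mul_of_disjoint {A G : Finset ι} {P : Chain ι} (h : Disjoint A (vars P)) :
    lk G (e A * P) = e (A \ G) * lk (G \ A) P := by
  rw [lk_inter_sdiff A, mul_comm, lk_mul_of_disjoint
    (Finset.disjoint_of_subset_left Finset.inter_subset_right h), lk_inter_e, mul_comm,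
    lk_mul_of_disjoint]
  rw [vars_e]; exact disjoint_sdiff_sdiff

theorem lk_d_e_mul_of_disjoint {A G : Finset ι} {P : Chain ι} (h : Disjoint A (vars P)) :
    lk G (d (e A) * P) = d (e (A \ G)) * lk (G \ A) P := by
  rw [lk_inter_sdiff A, mul_comm, lk_mul_of_disjoint
    (Finset.disjoint_of_subset_left Finset.inter_subset_right h), lk_d, lk_inter_e, mul_comm,
    lk_mul_of_disjoint]
  apply disjoint_vars_d
  rw [vars_e]; exact disjoint_sdiff_sdiff

/-- All links of simplexes are balls or spheres. -/
def Man (k : ℕ) (K : Chain ι) : Prop :=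
  ∀ G : Finset ι, G.Nonempty → Face K G → ∃ j, G.card + j = k ∧ BallOrSph j (lk G K)

/-- Links of simplexes that survive the move are themselves subdivided, at the part of `A` outside
`G`; if that part does not occur, the new link chain is zero and the move is trivial. -/
theorem StarAt.link {A G : Finset ι} {a : ι} {P Q K K' : Chain ι} (h : StarAt A a P Q K K')
    (ha : a ∉ G) (hG : ¬ A ⊆ G) :
    StarAt (A \ G) a (lk (G \ A) P) (lk G Q) (lk G K) (lk G K') := by
  obtain ⟨h1, h2, h3, h4, h5, h6, rfl, rfl⟩ := h
  refine ⟨Finset.sdiff_nonempty.2 hG, fun h => h2 (Finset.sdiff_subset h), ?_,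
    fun h => h4 (vars_lk_subset _ _ h), fun h => h5 (vars_lk_subset _ _ h), ?_, ?_, ?_⟩
  · exact Finset.disjoint_of_subset_left Finset.sdiff_subset
      (Finset.disjoint_of_subset_right (vars_lk_subset _ _) h3)
  · intro hf
    refine h6 ((face_lk.1 hf).2.mono ?_)
    rw [Finset.union_sdiff_self_eq_union]
    exact Finset.subset_union_right
  · rw [map_add, lk_e_mul_of_disjoint h3]
  · rw [map_add, mul_assoc, lk_mul_of_disjoint (by simpa using ha), lk_d_e_mul_of_disjoint h3]
    ring

theorem StarAt.face_iff {A G : Finset ι} {a : ι} {P Q K K' : Chain ι} (h : StarAt A a P Q K K')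
    (ha : a ∉ G) (hG : ¬ A ⊆ G) : Face K G ↔ Face K' G := by
  rw [← lk_ne_zero, ← lk_ne_zero, not_iff_not]
  exact eqv_zero_iff (h.link ha hG).eqv

theorem StarAt.not_face {A : Finset ι} {a : ι} {P Q K K' : Chain ι} (h : StarAt A a P Q K K') :
    ¬ Face K' A := by
  obtain ⟨h1, h2, h3, h4, h5, h6, rfl, rfl⟩ := h
  rw [mul_assoc]
  exact not_face_add (not_face_mul_right (not_face_d_mul h3) (by simpa using h2)) h6

theorem StarAt.notMem_vars {A : Finset ι} {a : ι} {P Q K K' : Chain ι}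
    (h : StarAt A a P Q K K') : a ∉ vars K := by
  obtain ⟨h1, h2, h3, h4, h5, h6, rfl, rfl⟩ := h
  exact notMem_vars_add (notMem_vars_mul (by simpa using h2) h4) h5

theorem StarAt.man {A : Finset ι} {a : ι} {P Q K K' : Chain ι} (h : StarAt A a P Q K K') {k : ℕ} :
    Man k K ↔ Man k K' := by
  have hA := h.1
  have hAP := h.2.2.1
  have haA := h.2.1
  constructor
  · intro hK G hG hf
    by_cases ha : a ∈ G
    -- A simplex through the new vertex has as its link the join of `∂(A \ G)` with the link of `A ∪
    -- C` in `K`, where `C` is the rest of `G`. Joining with a boundary of a simplex keeps balls and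
    -- spheres.
    · have hl : lk G K' =
          d (e (A \ G)) * lk ((G.erase a) \ A) P := by
        have hGa : G = {a} ∪ G.erase a := by
          rw [← Finset.insert_eq, Finset.insert_erase ha]
        conv_lhs => rw [hGa, lk_union (by simp), h.lk_vertex, lk_d_e_mul_of_disjoint hAP]
        congr 3
        ext v
        simp only [Finset.mem_sdiff, Finset.mem_erase]
        constructor
        · rintro ⟨hv, hv'⟩
          exact ⟨hv, fun hG => hv' ⟨fun hva => haA (hva ▸ hv), hG⟩⟩
        · rintro ⟨hv, hv'⟩
          exact ⟨hv, fun hG => hv' hG.2⟩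
      have hne := lk_ne_zero.2 hf
      rw [hl] at hne ⊢
      have hAG : (A \ G).Nonempty := by
        by_contra hempty
        rw [Finset.not_nonempty_iff_eq_empty] at hempty
        rw [hempty, e_empty, d_one, zero_mul] at hne
        exact hne rfl
      set C := (G.erase a) \ A with hC
      have hAC : Disjoint A C := Finset.disjoint_sdiff
      have hlC : lk (A ∪ C) K = lk C P := by
        rw [lk_union hAC, h.lk_simplex]
      have hne2 : lk C P ≠ 0 := fun h0 => hne (by rw [h0, mul_zero])
      obtain ⟨j, hj, hB⟩ := hK (A ∪ C) (hA.mono Finset.subset_union_left)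
        (lk_ne_zero.1 (by rwa [hlC]))
      rw [hlC] at hB
      obtain ⟨i, hi⟩ : ∃ i, (A \ G).card = i + 1 :=
        ⟨(A \ G).card - 1, by have := Finset.card_pos.2 hAG; omega⟩
      refine ⟨j + i, ?_, hB.d_e_mul hi (Finset.disjoint_of_subset_left Finset.sdiff_subset
        (Finset.disjoint_of_subset_right (vars_lk_subset _ _) hAP))⟩
      rw [Finset.card_union_of_disjoint hAC] at hj
      have c1 : (G.erase a).card + 1 = G.card := Finset.card_erase_add_one ha
      have c2 : ((G.erase a) \ A).card + ((G.erase a) ∩ A).card = (G.erase a).card :=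
        Finset.card_sdiff_add_card_inter _ _
      have c3 : (A \ G).card + (A ∩ G).card = A.card := Finset.card_sdiff_add_card_inter _ _
      have c4 : (G.erase a) ∩ A = A ∩ G := by
        ext v
        simp only [Finset.mem_inter, Finset.mem_erase]
        constructor
        · rintro ⟨⟨_, h1⟩, h2⟩; exact ⟨h2, h1⟩
        · rintro ⟨h1, h2⟩; exact ⟨⟨fun hva => haA (hva ▸ h1), h2⟩, h1⟩
      rw [c4, ← hC] at c2
      omega
    · have hAG : ¬ A ⊆ G := fun hAG => h.not_face (hf.mono hAG)
      obtain ⟨j, hj, hB⟩ := hK G hG ((h.face_iff ha hAG).2 hf)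
      exact ⟨j, hj, hB.of_eqv (h.link ha hAG).eqv.symm⟩
  · intro hK' G hG hf
    have ha : a ∉ G := fun ha => h.notMem_vars (hf.subset_vars ha)
    by_cases hAG : A ⊆ G
    -- A simplex containing `A` is lost in `K'`. Trading one vertex `v` of `A` for `a` gives a
    -- simplex of `K'` of the same size with the same link.
    · obtain ⟨v, hv⟩ := hA
      have hGA : G = A ∪ (G \ A) := (Finset.union_sdiff_of_subset hAG).symm
      have hl : lk G K = lk (G \ A) P := by
        conv_lhs => rw [hGA, lk_union Finset.disjoint_sdiff, h.lk_simplex]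
      have hl' : lk (insert a (G.erase v)) K' = lk (G \ A) P := by
        rw [Finset.insert_eq, lk_union (by
          rw [Finset.disjoint_singleton_left]; exact fun h => ha (Finset.mem_of_mem_erase h)),
          h.lk_vertex, lk_d_e_mul_of_disjoint hAP]
        have e1 : A \ (G.erase v) = {v} := by
          ext w
          simp only [Finset.mem_sdiff, Finset.mem_erase, Finset.mem_singleton]
          constructor
          · rintro ⟨h1, h2⟩
            by_contra hw
            exact h2 ⟨hw, hAG h1⟩
          · rintro rfl
            exact ⟨hv, fun h => h.1 rfl⟩
        have e2 : (G.erase v) \ A = G \ A := by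
          ext w
          simp only [Finset.mem_sdiff, Finset.mem_erase]
          constructor
          · rintro ⟨⟨_, h1⟩, h2⟩; exact ⟨h1, h2⟩
          · rintro ⟨h1, h2⟩; exact ⟨⟨fun hw => h2 (hw ▸ hv), h1⟩, h2⟩
        rw [e1, e2, d_vertex, one_mul]
      obtain ⟨j, hj, hB⟩ := hK' (insert a (G.erase v)) (Finset.insert_nonempty _ _)
        (lk_ne_zero.1 (by rw [hl', ← hl]; exact lk_ne_zero.2 hf))
      rw [hl', ← hl] at hB
      refine ⟨j, ?_, hB⟩
      rw [Finset.card_insert_of_notMem (fun h => ha (Finset.mem_of_mem_erase h)),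
        Finset.card_erase_add_one (hAG hv)] at hj
      exact hj
    · obtain ⟨j, hj, hB⟩ := hK' G hG ((h.face_iff ha hAG).1 hf)
      exact ⟨j, hj, hB.of_eqv (h.link ha hAG).eqv⟩

theorem Eqv.man {K L : Chain ι} (h : Eqv K L) {k : ℕ} : Man k K ↔ Man k L := by
  induction h with
  | rel K L h =>
    obtain ⟨A, a, P, Q, h⟩ := h
    exact h.man
  | refl K => rfl
  | symm K L _ ih => exact ih.symm
  | trans K L M _ _ ih1 ih2 => exact ih1.trans ih2

theorem ball_e {D : Finset ι} (h : D.Nonempty) : Ball D.card (e D) :=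
  ⟨Finset.card_pos.2 h, D, rfl, .refl _⟩

theorem sph_d_e {D : Finset ι} {k : ℕ} (h : D.card = k + 1) : Sph k (d (e D)) :=
  ⟨D, h, .refl _⟩

theorem BallOrSph.man {k : ℕ} {K : Chain ι} (h : BallOrSph k K) : Man k K := by
  rcases h with ⟨-, D, hD, h⟩ | ⟨D, hD, h⟩
  · rw [h.man]
    intro G _ hf
    rw [face_e] at hf
    refine ⟨(D \ G).card, by rw [add_comm, Finset.card_sdiff_add_card_eq_card hf, hD], ?_⟩
    rw [lk_e, if_pos hf]
    rcases (D \ G).eq_empty_or_nonempty with h0 | h0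
    -- The link of the top simplex is `1`, the sphere of dimension `-1`, which is the boundary of a
    -- point.
    · right
      obtain ⟨c, -⟩ := exists_fresh (∅ : Finset ι)
      refine ⟨{c}, by simp [h0], ?_⟩
      rw [h0, d_vertex, e_empty]
      exact .refl _
    · exact Or.inl (ball_e h0)
  · rw [h.man]
    intro G _ hf
    rw [face_d_e] at hf
    have h1 := Finset.card_sdiff_add_card_eq_card hf.1
    have h2 := Finset.card_lt_card hf
    refine ⟨k - G.card, by omega, Or.inr ?_⟩
    rw [lk_d, lk_e, if_pos hf.1]
    exact sph_d_e (by omega)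

end

end StellarChain

/-! ### The exchange property for all balls and spheres. -/

namespace StellarChain

noncomputable section

variable {ι : Type*} [DecidableEq ι]

theorem Phi.rn {P : Chain ι} (h : Phi P) (σ : Equiv.Perm ι) : Phi (rn σ P) := by
  intro A Z x hA hZ hAZ hAP hZP hxA hxZ hxP
  rw [← repl_rn_iff σ⁻¹]
  have key := h (A.map (σ⁻¹ : Equiv.Perm ι).toEmbedding) (StellarChain.rn σ⁻¹ Z) (σ⁻¹ x)
    (by simpa using hA) (by rw [← rn_d, hZ, map_zero])
    (by rw [vars_rn]; simpa using hAZ) ?_ ?_ (fun h => hxA ((Finset.mem_map' _).1 h))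
    (fun h => hxZ (by rw [vars_rn] at h; exact (Finset.mem_map' _).1 h)) ?_
  · convert key using 1
    · simp only [rn_mul, rn_d, map_add, rn_e, Finset.map_singleton, rn_symm_rn]; rfl
    · simp only [rn_mul, rn_d, rn_e, Finset.map_singleton, rn_symm_rn]; rfl
  all_goals
    have h2 : vars P = (vars (StellarChain.rn σ P)).map (σ⁻¹ : Equiv.Perm ι).toEmbedding := by
      rw [← vars_rn, rn_symm_rn]
    rw [h2]
  · simpa using hAP
  · rw [vars_rn]; simpa using hZP
  · exact fun h => hxP ((Finset.mem_map' _).1 h)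

variable [Infinite ι]

/-- In the definition of `Phi` one may assume that `A`, `Z`, `x` avoid a given finite set. -/
theorem phi_of_avoid {P : Chain ι} (N : Finset ι)
    (h : ∀ (A : Finset ι) (Z : Chain ι) (x : ι), A.Nonempty → d Z = 0 → Disjoint A (vars Z) →
      Disjoint A (vars P) → Disjoint (vars Z) (vars P) → x ∉ A → x ∉ vars Z → x ∉ vars P →
      Disjoint A N → Disjoint (vars Z) N → x ∉ N →
      Repl (e A * (Z * (P + e {x} * d P))) (e {x} * (d (e A) * (Z * P)))) : Phi P := by
  intro A Z x hA hZ hAZ hAP hZP hxA hxZ hxP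
  obtain ⟨σ, h1, h2⟩ := exists_perm_avoid (vars P) (A ∪ vars Z ∪ {x}) (N ∪ vars P)
  have hσP : rn σ P = P := rn_eq_self h1
  have hA' := disjoint_map_of_avoid h2 (A := A)
    (Finset.subset_union_left.trans Finset.subset_union_left) hAP
  have hZ' := disjoint_map_of_avoid h2 (A := vars Z)
    (Finset.subset_union_right.trans Finset.subset_union_left) hZP
  have hx' := h2 x (by simp) hxP
  rw [Finset.disjoint_union_right] at hA' hZ'
  rw [Finset.mem_union, not_or] at hx'
  rw [← repl_rn_iff σ]
  have key := h (A.map σ.toEmbedding) (rn σ Z) (σ x) (by simpa using hA)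
    (by rw [← rn_d, hZ, map_zero]) (by rw [vars_rn]; simpa using hAZ) hA'.2
    (by rw [vars_rn]; exact hZ'.2) (by simpa using hxA) (by rw [vars_rn]; simpa using hxZ)
    hx'.2 hA'.1 (by rw [vars_rn]; exact hZ'.1) hx'.1
  convert key using 1
  · simp only [rn_mul, rn_d, map_add, rn_e, Finset.map_singleton, hσP]; rfl
  · simp only [rn_mul, rn_d, rn_e, Finset.map_singleton, hσP]; rfl

/-- For a simplex `F` this is the flip of `A` against `x * F`, because `∂(x * F) = F + x * ∂F`. -/
theorem phi_e (F : Finset ι) : Phi (e F) := by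
  intro A Z x hA hZ hAZ hAP hZP hxA hxZ hxP
  rw [vars_e] at hAP hZP hxP
  have := repl_flip (A := A) (B := insert x F) (R := Z) hA (Finset.insert_nonempty _ _)
    (by rw [Finset.disjoint_insert_right]; exact ⟨hxA, hAP⟩) hAZ
    (by rw [Finset.disjoint_insert_left]; exact ⟨hxZ, hZP.symm⟩) hZ
  rw [e_insert hxP, d_vertex_mul] at this
  convert this using 1 <;> ring

/-- The flip of `A` against `x * B`, with the factor `∂D` absorbed into the cycle. -/
theorem phi_e_mul_d_e {B D : Finset ι} (hBD : Disjoint B D) : Phi (e B * d (e D)) := by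
  rcases D.eq_empty_or_nonempty with rfl | hD
  · rw [e_empty, d_one, mul_zero]
    intro A Z x _ _ _ _ _ _ _ _
    simp only [map_zero, mul_zero, add_zero]
    exact Repl.refl 0
  refine phi_of_avoid (B ∪ D) ?_
  intro A Z x hA hZ hAZ hAP hZP hxA hxZ hxP hAN hZN hxN
  rw [Finset.disjoint_union_right] at hAN hZN
  rw [Finset.mem_union, not_or] at hxN
  have hxB : x ∉ B := hxN.1
  have hDd : ∀ A : Finset ι, Disjoint A D → Disjoint A (vars (d (e D))) := fun A hA =>
    disjoint_vars_d (by simpa using hA)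
  have := repl_flip (A := A) (B := insert x B) (R := Z * d (e D)) hA (Finset.insert_nonempty _ _)
    (by rw [Finset.disjoint_insert_right]; exact ⟨hxA, hAN.1⟩)
    (disjoint_vars_mul hAZ (hDd A hAN.2))
    (by rw [Finset.disjoint_insert_left]
        exact ⟨notMem_vars_mul hxZ (notMem_vars_d (by simpa using hxN.2)),
          disjoint_vars_mul hZN.1.symm (hDd B hBD)⟩)
    (by rw [d_mul, hZ, d_d]; ring)
  rw [e_insert hxB, d_vertex_mul] at this
  rw [d_mul (e B), d_d]
  convert this using 1 <;> ring

/-- The statement proved by induction: `Phi` for all joins of `R` with a simplex. -/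
def PhiJoin (R : Chain ι) : Prop := ∀ B : Finset ι, Disjoint B (vars R) → Phi (e B * R)

theorem phiJoin_of_avoid {R : Chain ι} (N : Finset ι)
    (h : ∀ B : Finset ι, Disjoint B (vars R) → Disjoint B N → Phi (e B * R)) : PhiJoin R := by
  intro B hB
  obtain ⟨σ, h1, h2⟩ := exists_perm_avoid (vars R) B (N ∪ vars R)
  have hB' := disjoint_map_of_avoid h2 subset_rfl hB
  rw [Finset.disjoint_union_right] at hB'
  have h3 := (h _ hB'.2 hB'.1).rn σ⁻¹
  rw [rn_mul, rn_e, map_inv_map, rn_eq_self (K := R)] at h3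
  · exact h3
  · intro v hv
    rw [Equiv.Perm.inv_eq_iff_eq, h1 v hv]

/-- A join of the move with a simplex `B` is again such a move. The two preceding exchange theorems
then ask for `Phi` of `c * B * P` and of `C * B * P`, which are again joins of a simplex with `P`.
This is why the induction statement includes joins. -/
theorem StarAt.phiJoin {C : Finset ι} {c : ι} {P T R R' : Chain ι} (h : StarAt C c P T R R')
    (hP : P = 0 ∨ PhiJoin P) : PhiJoin R ↔ PhiJoin R' := by
  rcases hP with rfl | hP
  · rw [h.eq_of_zero]
  obtain ⟨hC, hcC, hCP, hcP, hcT, hCT, rfl, rfl⟩ := h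
  have geom : ∀ B : Finset ι, Disjoint B (C ∪ {c} ∪ vars P ∪ vars T) →
      Disjoint C (vars (e B * P)) ∧ c ∉ vars (e B * P) ∧ c ∉ vars (e B * T) ∧
        ¬ Face (e B * T) C ∧ Disjoint B C ∧ c ∉ B ∧ Disjoint B (vars P) ∧ Disjoint B (vars T) := by
    intro B hB
    simp only [Finset.disjoint_union_right, Finset.disjoint_singleton_right] at hB
    obtain ⟨⟨⟨hBC, hcB⟩, hBP⟩, hBT⟩ := hB
    have hCB : Disjoint C (vars (e B)) := by simpa using hBC.symm
    have hcB' : c ∉ vars (e B) := by simpa using hcB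
    exact ⟨disjoint_vars_mul hCB hCP, notMem_vars_mul hcB' hcP, notMem_vars_mul hcB' hcT,
      not_face_mul_right hCT hCB, hBC, hcB, hBP, hBT⟩
  have sep : ∀ A B : Finset ι, Disjoint A (B ∪ (C ∪ {c} ∪ vars P ∪ vars T)) →
      Disjoint A C ∧ c ∉ A ∧ Disjoint A (vars (e B * P)) ∧ Disjoint A (vars (e B * T)) := by
    intro A B hA
    simp only [Finset.disjoint_union_right, Finset.disjoint_singleton_right] at hA
    obtain ⟨hAB, ⟨⟨hAC, hcA⟩, hAP⟩, hAT⟩ := hA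
    exact ⟨hAC, hcA, disjoint_vars_mul (by simpa using hAB) hAP,
      disjoint_vars_mul (by simpa using hAB) hAT⟩
  constructor
  · intro hR
    refine phiJoin_of_avoid (C ∪ {c} ∪ vars P ∪ vars T) fun B _ hBN => ?_
    obtain ⟨g1, g2, g3, g4, g5, g6, g7, g8⟩ := geom B hBN
    have eR : e B * (e {c} * d (e C) * P + T) = e {c} * d (e C) * (e B * P) + e B * T := by ring
    rw [eR]
    refine phi_of_avoid (B ∪ (C ∪ {c} ∪ vars P ∪ vars T)) ?_
    intro A Z x hA hZ hAZ _ _ hxA hxZ _ hAN hZN hxN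
    obtain ⟨a1, a2, a3, a4⟩ := sep A B hAN
    obtain ⟨z1, z2, z3, z4⟩ := sep _ B hZN
    obtain ⟨x1, x2, x3, x4⟩ := sep {x} B (by simpa using hxN)
    simp only [Finset.disjoint_singleton_left, Finset.mem_singleton] at x1 x2 x3 x4
    refine repl_cone_subdivision hA hC hZ hAZ hxA hxZ a1 a2 a3 a4 z1.symm z2 z3 z4 x1
      (Ne.symm x2) x3 x4 hcC g1 g2 g3 g4 ?_ ?_
    · have := hR B (disjoint_vars_add (disjoint_vars_mul (by simpa using g5) g7) g8)
      rwa [show e B * (e C * P + T) = e C * (e B * P) + e B * T by ring] at this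
    · have := hP (insert c B) (by rw [Finset.disjoint_insert_left]; exact ⟨hcP, g7⟩)
      rwa [e_insert g6, mul_assoc] at this
  · intro hR'
    refine phiJoin_of_avoid (C ∪ {c} ∪ vars P ∪ vars T) fun B _ hBN => ?_
    obtain ⟨g1, g2, g3, g4, g5, g6, g7, g8⟩ := geom B hBN
    have eR : e B * (e C * P + T) = e C * (e B * P) + e B * T := by ring
    rw [eR]
    refine phi_of_avoid (B ∪ (C ∪ {c} ∪ vars P ∪ vars T)) ?_
    intro A Z x hA hZ hAZ _ _ hxA hxZ _ hAN hZN hxN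
    obtain ⟨a1, a2, a3, a4⟩ := sep A B hAN
    obtain ⟨z1, z2, z3, z4⟩ := sep _ B hZN
    obtain ⟨x1, x2, x3, x4⟩ := sep {x} B (by simpa using hxN)
    simp only [Finset.disjoint_singleton_left, Finset.mem_singleton] at x1 x2 x3 x4
    refine repl_cone_weld hA hZ hAZ hxA hxZ a1 a2 a3 a4 z1.symm z2 z3 z4 x1
      (Ne.symm x2) x3 x4 hcC g1 g2 g3 g4 ?_ ?_
    · have := hR' B (disjoint_vars_add (disjoint_vars_mul (disjoint_vars_mul (by simpa using g6)
        (disjoint_vars_d (by simpa using g5))) g7) g8)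
      rwa [show e B * (e {c} * d (e C) * P + T) =
        e {c} * d (e C) * (e B * P) + e B * T by ring] at this
    · have := hP (C ∪ B) (Finset.disjoint_union_left.2 ⟨hCP, g7⟩)
      rwa [e_union g5.symm, mul_assoc] at this

/-- Strong induction on the dimension: in each move the link `P` of the subdivided simplex is a ball
or sphere of smaller dimension, or zero. The standard models are handled by the flip. -/
theorem BallOrSph.phiJoin {k : ℕ} {K : Chain ι} (h : BallOrSph k K) : PhiJoin K := by
  induction k using Nat.strong_induction_on generalizing K with
  | _ k ih =>
  have key : ∀ {R L : Chain ι}, Eqv R L → BallOrSph k L → (PhiJoin R ↔ PhiJoin L) := by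
    intro R L hRL
    induction hRL with
    | rel R L hs =>
      intro hL
      obtain ⟨C, c, P, T, hs⟩ := hs
      refine hs.phiJoin ?_
      by_cases hP : P = 0
      · exact Or.inl hP
      · right
        rw [← hs.lk_simplex] at hP ⊢
        obtain ⟨j, hj, hB⟩ := (hL.of_eqv hs.eqv).man C hs.1 (lk_ne_zero.1 hP)
        have := Finset.card_pos.2 hs.1
        exact ih j (by omega) hB
    | refl K => exact fun _ => Iff.rfl
    | symm R L hRL ih' => exact fun hR => (ih' (hR.of_eqv hRL.symm)).symm
    | trans K L M hKL hLM ih1 ih2 => exact fun hM => (ih1 (hM.of_eqv hLM)).trans (ih2 hM)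
  rcases h with ⟨hk, D, hD, h⟩ | ⟨D, hD, h⟩
  · rw [key h (Or.inl ⟨hk, D, hD, .refl _⟩)]
    intro B hB
    rw [vars_e] at hB
    rw [e_mul_e hB]
    exact phi_e _
  · rw [key h (Or.inr ⟨D, hD, .refl _⟩)]
    refine phiJoin_of_avoid D fun B _ hB => phi_e_mul_d_e hB

theorem BallOrSph.phi {k : ℕ} {K : Chain ι} (h : BallOrSph k K) : Phi K := by
  simpa [e_empty] using h.phiJoin ∅ (by simp)

end

end StellarChain

/-! ### Cycles in a sphere and the removal of one facet. -/

namespace StellarChain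

noncomputable section

variable {ι : Type*} [DecidableEq ι] [Infinite ι]

theorem mem_supp_e_mul_add {B m : Finset ι} {X Y : Chain ι} (hY : ¬ Face Y B) :
    m ∈ supp (e B * X + Y) ↔ m ∈ supp (e B * X) ∨ m ∈ supp Y := by
  refine ⟨mem_supp_or_of_add, ?_⟩
  have := fun (h : m ∈ supp (e B * X)) (h' : m ∈ supp Y) =>
    hY ⟨m, h', subset_of_mem_supp_e_mul h⟩
  rw [mem_supp_add]
  unfold Xor
  tauto

/-- All simplexes of the chain have `k` vertices. -/
def Hom (k : ℕ) (K : Chain ι) : Prop := ∀ m ∈ supp K, m.card = k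

theorem mem_supp_e_mul {A m : Finset ι} {P : Chain ι} (h : Disjoint A (vars P)) :
    m ∈ supp (e A * P) ↔ ∃ p ∈ supp P, m = A ∪ p := by
  rw [mem_supp_mul (by simpa using h)]
  simp

theorem mem_supp_d_e_mul {A m : Finset ι} {P : Chain ι} (h : Disjoint A (vars P)) :
    m ∈ supp (d (e A) * P) ↔ ∃ v ∈ A, ∃ p ∈ supp P, m = A.erase v ∪ p := by
  rw [mem_supp_mul (vars_d_e_disjoint h)]
  simp only [mem_supp_d_e]
  constructor
  · rintro ⟨_, ⟨v, hv, rfl⟩, p, hp, rfl⟩; exact ⟨v, hv, p, hp, rfl⟩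
  · rintro ⟨v, hv, p, hp, rfl⟩; exact ⟨_, ⟨v, hv, rfl⟩, p, hp, rfl⟩

theorem StarAt.mem_supp_left {A : Finset ι} {a : ι} {P Q K K' : Chain ι}
    (h : StarAt A a P Q K K') {m : Finset ι} :
    m ∈ supp K ↔ (∃ p ∈ supp P, m = A ∪ p) ∨ m ∈ supp Q := by
  obtain ⟨h1, h2, h3, h4, h5, h6, rfl, rfl⟩ := h
  rw [mem_supp_e_mul_add h6, mem_supp_e_mul h3]

theorem StarAt.mem_supp_right {A : Finset ι} {a : ι} {P Q K K' : Chain ι}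
    (h : StarAt A a P Q K K') {m : Finset ι} :
    m ∈ supp K' ↔ (∃ v ∈ A, ∃ p ∈ supp P, m = insert a (A.erase v ∪ p)) ∨ m ∈ supp Q := by
  obtain ⟨h1, h2, h3, h4, h5, h6, rfl, rfl⟩ := h
  rw [mul_assoc, mem_supp_e_mul_add (not_face_of_notMem_vars h5), mem_supp_e_mul]
  · simp only [mem_supp_d_e_mul h3, Finset.insert_eq]
    refine or_congr_left ⟨?_, ?_⟩
    · rintro ⟨_, ⟨v, hv, p, hp, rfl⟩, rfl⟩; exact ⟨v, hv, p, hp, rfl⟩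
    · rintro ⟨v, hv, p, hp, rfl⟩; exact ⟨_, ⟨v, hv, p, hp, rfl⟩, rfl⟩
  · rw [Finset.disjoint_singleton_left]
    exact notMem_vars_mul (notMem_vars_d (by simpa using h2)) h4

theorem StarAt.hom {A : Finset ι} {a : ι} {P Q K K' : Chain ι} (h : StarAt A a P Q K K') {k : ℕ} :
    Hom k K ↔ Hom k K' := by
  have hc : ∀ v ∈ A, ∀ p ∈ supp P, (insert a (A.erase v ∪ p)).card = (A ∪ p).card := by
    intro v hv p hp
    have hpP := (face_of_mem_supp hp).subset_vars
    have hd : Disjoint A p := Finset.disjoint_of_subset_right hpP h.2.2.1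
    have hd' : Disjoint (A.erase v) p := Finset.disjoint_of_subset_left (Finset.erase_subset _ _) hd
    rw [Finset.card_insert_of_notMem, Finset.card_union_of_disjoint hd,
      Finset.card_union_of_disjoint hd', ← Finset.card_erase_add_one hv]
    · ring
    · rw [Finset.mem_union, not_or]
      exact ⟨fun h' => h.2.1 (Finset.mem_of_mem_erase h'), fun h' => h.2.2.2.1 (hpP h')⟩
  obtain ⟨w, hw⟩ := h.1
  constructor
  · intro hK m hm
    rcases h.mem_supp_right.1 hm with ⟨v, hv, p, hp, rfl⟩ | hm
    · rw [hc v hv p hp]; exact hK _ (h.mem_supp_left.2 (Or.inl ⟨p, hp, rfl⟩))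
    · exact hK m (h.mem_supp_left.2 (Or.inr hm))
  · intro hK m hm
    rcases h.mem_supp_left.1 hm with ⟨p, hp, rfl⟩ | hm
    · rw [← hc w hw p hp]; exact hK _ (h.mem_supp_right.2 (Or.inl ⟨w, hw, p, hp, rfl⟩))
    · exact hK m (h.mem_supp_right.2 (Or.inr hm))

theorem Eqv.hom {K L : Chain ι} (h : Eqv K L) {k : ℕ} : Hom k K ↔ Hom k L := by
  induction h with
  | rel K L h =>
    obtain ⟨A, a, P, Q, h⟩ := h
    exact h.hom
  | refl K => rfl
  | symm K L _ ih => exact ih.symm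
  | trans K L M _ _ ih1 ih2 => exact ih1.trans ih2

theorem BallOrSph.hom {k : ℕ} {K : Chain ι} (h : BallOrSph k K) : Hom k K := by
  rcases h with ⟨-, D, hD, h⟩ | ⟨D, hD, h⟩
  · rw [h.hom]
    intro m hm
    rw [supp_e, Finset.mem_singleton] at hm
    rw [hm, hD]
  · rw [h.hom]
    intro m hm
    obtain ⟨v, hv, rfl⟩ := mem_supp_d_e.1 hm
    rw [Finset.card_erase_of_mem hv, hD]; omega

theorem supp_lk_mono {K L : Chain ι} (h : supp K ⊆ supp L) (A : Finset ι) :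
    supp (lk A K) ⊆ supp (lk A L) := fun m hm => by
  rw [mem_supp_lk] at hm ⊢
  exact ⟨hm.1, h hm.2⟩

theorem supp_dl_mono {K L : Chain ι} (h : supp K ⊆ supp L) (A : Finset ι) :
    supp (dl A K) ⊆ supp (dl A L) := fun m hm => by
  rw [mem_supp_dl] at hm ⊢
  exact ⟨h hm.1, hm.2⟩

theorem Face.of_supp_subset {K L : Chain ι} {G : Finset ι} (hf : Face K G)
    (h : supp K ⊆ supp L) : Face L G := by
  obtain ⟨m, hm, hG⟩ := hf
  exact ⟨m, h hm, hG⟩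

theorem eq_of_add_eq_zero {K L : Chain ι} (h : K + L = 0) : K = L := by
  linear_combination h - L * two_eq_zero (ι := ι)

/-- The only cycles inside `S` are `0` and `S`. -/
def Irr (S : Chain ι) : Prop := ∀ Z : Chain ι, supp Z ⊆ supp S → d Z = 0 → Z = 0 ∨ Z = S

/-- The link part of a cycle is a cycle in the link, hence zero or the whole link. If zero, the
cycle lies in `Q` and is a cycle of the other sphere, not all of it. If whole, exchanging `a * ∂A *
P` and `A * P` turns the cycle into a nonzero one of the other sphere. -/
theorem StarAt.irr {A : Finset ι} {a : ι} {P Q S S' : Chain ι} (h : StarAt A a P Q S S')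
    (hP0 : P ≠ 0) (hdP : d P = 0) (hP : Irr P) (hAP : Irr (d (e A) * P)) : Irr S ↔ Irr S' := by
  have hsub1 : supp Q ⊆ supp S := fun m hm => h.mem_supp_left.2 (Or.inr hm)
  have hsub2 : supp Q ⊆ supp S' := fun m hm => h.mem_supp_right.2 (Or.inr hm)
  have hlk' := h.lk_vertex
  have hlk := h.lk_simplex
  have hne : d (e A) * P ≠ 0 := mul_ne_zero' (vars_d_e_disjoint h.2.2.1) (d_e_ne_zero h.1) hP0
  have hdl' : dl {a} S' = Q := by
    obtain ⟨h1, h2, h3, h4, h5, h6, rfl, rfl⟩ := h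
    rw [mul_assoc]
    refine dl_eq ?_ (not_face_of_notMem_vars h5)
    rw [Finset.disjoint_singleton_left]
    exact notMem_vars_mul (notMem_vars_d (by simpa using h2)) h4
  have hdl : dl A S = Q := by
    obtain ⟨h1, h2, h3, h4, h5, h6, rfl, rfl⟩ := h
    exact dl_eq h3 h6
  obtain ⟨h1, h2, h3, h4, h5, h6, rfl, rfl⟩ := h
  constructor
  · intro hS Z hZ hdZ
    have hY : supp (lk {a} Z) ⊆ supp (d (e A) * P) := hlk' ▸ supp_lk_mono hZ {a}
    have hZ2 : supp (dl {a} Z) ⊆ supp Q := by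
      have := supp_dl_mono hZ {a}
      rwa [hdl'] at this
    have hZ2A : ¬ Face (dl {a} Z) A := fun hf => h6 (hf.of_supp_subset hZ2)
    have hdY : d (lk {a} Z) = 0 := by rw [← lk_d, hdZ, map_zero]
    have hZeq := eq_lk_add_dl {a} Z
    have hdZeq : lk {a} Z + d (dl {a} Z) = 0 := by
      rw [← hdZ]
      conv_rhs => rw [hZeq, map_add, d_vertex_mul, hdY, mul_zero, add_zero]
    rcases hAP _ hY hdY with h0 | h0
    · rw [h0, mul_zero, zero_add] at hZeq
      rw [← hZeq] at hZ2 hZ2A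
      rcases hS Z (hZ2.trans hsub1) hdZ with h7 | h7
      · exact Or.inl h7
      · rw [h7] at hZ2A
        exact absurd (hlk.symm.trans (lk_eq_zero hZ2A)) hP0
    · have hsub : supp (e A * P + dl {a} Z) ⊆ supp (e A * P + Q) := by
        intro m hm
        rw [mem_supp_e_mul_add hZ2A] at hm
        rw [mem_supp_e_mul_add h6]
        exact hm.imp_right fun h => hZ2 h
      have hd0 : d (e A * P + dl {a} Z) = 0 := by
        rw [map_add, d_mul, hdP, mul_zero, add_zero, ← h0, hdZeq]
      rcases hS _ hsub hd0 with h7 | h7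
      · have := lk_eq h3 hZ2A
        rw [h7, map_zero] at this
        exact absurd this.symm hP0
      · right
        rw [hZeq, h0, add_left_cancel h7]; ring
  · intro hS Z hZ hdZ
    have hY : supp (lk A Z) ⊆ supp P := by
      have := supp_lk_mono hZ A
      rwa [hlk] at this
    have hZ2 : supp (dl A Z) ⊆ supp Q := by
      have := supp_dl_mono hZ A
      rwa [hdl] at this
    have hZ2a : ¬ Face (dl A Z) {a} := fun hf =>
      not_face_of_notMem_vars h5 (hf.of_supp_subset hZ2)
    have hdY : d (lk A Z) = 0 := by rw [← lk_d, hdZ, map_zero]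
    have hZeq := eq_lk_add_dl A Z
    have hdZeq : d (e A) * lk A Z + d (dl A Z) = 0 := by
      rw [← hdZ]
      conv_rhs => rw [hZeq, map_add, d_mul, hdY, mul_zero, add_zero]
    have hvar : Disjoint {a} (vars (d (e A) * P)) := by
      rw [Finset.disjoint_singleton_left]
      exact notMem_vars_mul (notMem_vars_d (by simpa using h2)) h4
    rcases hP _ hY hdY with h0 | h0
    · rw [h0, mul_zero, zero_add] at hZeq
      rw [← hZeq] at hZ2 hZ2a
      rcases hS Z (hZ2.trans hsub2) hdZ with h7 | h7
      · exact Or.inl h7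
      · rw [h7] at hZ2a
        exact absurd (hlk'.symm.trans (lk_eq_zero hZ2a)) hne
    · have hsub : supp (e {a} * (d (e A) * P) + dl A Z) ⊆ supp (e {a} * d (e A) * P + Q) := by
        intro m hm
        rw [mem_supp_e_mul_add hZ2a] at hm
        rw [mul_assoc, mem_supp_e_mul_add (not_face_of_notMem_vars h5)]
        exact hm.imp_right fun h => hZ2 h
      have hd0 : d (e {a} * (d (e A) * P) + dl A Z) = 0 := by
        rw [h0] at hdZeq
        rw [map_add, d_vertex_mul, d_mul, d_d, hdP]
        linear_combination hdZeq
      rcases hS _ hsub hd0 with h7 | h7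
      · have := lk_eq hvar hZ2a
        rw [h7, map_zero] at this
        exact absurd this.symm hne
      · right
        rw [hZeq, h0]
        rw [mul_assoc] at h7
        rw [add_left_cancel h7]

/-- The vanishing boundary determines the link part at `c` from the part off `c`, and the latter is
zero or the single facet opposite `c`. -/
theorem irr_d_e {D : Finset ι} (hD : D.Nonempty) : Irr (d (e D)) := by
  obtain ⟨c, hc⟩ := hD
  have hS : d (e D) = e {c} * d (e (D.erase c)) + e (D.erase c) := by
    rw [e_erase hc, d_vertex_mul, add_comm]
  have hv1 : Disjoint {c} (vars (d (e (D.erase c)))) := by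
    rw [Finset.disjoint_singleton_left]; exact notMem_vars_d (by simp)
  have hv2 : ¬ Face (e (D.erase c)) {c} := by simp
  intro Z hZ hdZ
  rw [hS] at hZ ⊢
  have hZ2 : supp (dl {c} Z) ⊆ {D.erase c} := by
    have := supp_dl_mono hZ {c}
    rwa [dl_eq hv1 hv2, supp_e] at this
  have hZeq := eq_lk_add_dl {c} Z
  have hdY : d (lk {c} Z) = 0 := by rw [← lk_d, hdZ, map_zero]
  have hdZeq : lk {c} Z + d (dl {c} Z) = 0 := by
    rw [← hdZ]
    conv_rhs => rw [hZeq, map_add, d_vertex_mul, hdY, mul_zero, add_zero]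
  rcases Finset.subset_singleton_iff.1 hZ2 with h0 | h0
  · rw [supp_eq_empty] at h0
    rw [h0, map_zero, add_zero] at hdZeq
    left
    rw [hZeq, hdZeq, h0]; ring
  · have h1 : dl {c} Z = e (D.erase c) := chain_ext (by rw [h0, supp_e])
    right
    rw [h1] at hdZeq
    rw [hZeq, h1, eq_of_add_eq_zero hdZeq]

theorem Sph.lk {k : ℕ} {S : Chain ι} (h : Sph k S) {G : Finset ι} (hG : G.Nonempty)
    (hf : Face S G) : ∃ j, G.card + j = k ∧ Sph j (lk G S) := by
  obtain ⟨j, hj, hB⟩ := BallOrSph.man (Or.inr h) G hG hf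
  exact ⟨j, hj, hB.sph (by rw [← lk_d, h.d_eq_zero, map_zero])⟩

theorem Sph.irr {k : ℕ} {S : Chain ι} (h : Sph k S) : Irr S := by
  induction k using Nat.strong_induction_on generalizing S with
  | _ k ih =>
  have key : ∀ {R L : Chain ι}, Eqv R L → Sph k L → (Irr R ↔ Irr L) := by
    intro R L hRL
    induction hRL with
    | rel R L hs =>
      intro hL
      have hR := hL.of_eqv hs.eqv
      obtain ⟨C, c, P, T, hs⟩ := hs
      by_cases hP : P = 0
      · subst hP; rw [hs.eq_of_zero]
      · have hlk := hs.lk_simplex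
        obtain ⟨j, hj, hB⟩ := hR.lk hs.1 (lk_ne_zero.1 (by rwa [hlk]))
        rw [hlk] at hB
        have hc := Finset.card_pos.2 hs.1
        obtain ⟨i, hi⟩ : ∃ i, C.card = i + 1 := ⟨C.card - 1, by omega⟩
        exact hs.irr hP hB.d_eq_zero (ih j (by omega) hB)
          (ih (j + i) (by omega) (hB.d_e_mul hi hs.2.2.1))
    | refl K => exact fun _ => Iff.rfl
    | symm R L hRL ih' => exact fun hR => (ih' (hR.of_eqv hRL.symm)).symm
    | trans K L M hKL hLM ih1 ih2 => exact fun hM => (ih1 (hM.of_eqv hLM)).trans (ih2 hM)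
  obtain ⟨D, hD, h⟩ := h
  rw [key h ⟨D, hD, .refl _⟩]
  exact irr_d_e (Finset.card_pos.1 (by omega))

/-- One point is not a cycle, as its boundary is `1`; two points are a nonzero cycle, hence
everything. -/
theorem Sph.eq_pair {S : Chain ι} (h : Sph 1 S) : ∃ u u', u ≠ u' ∧ S = e {u} + e {u'} := by
  have hhom := BallOrSph.hom (Or.inr h)
  have hpt : ∀ m ∈ supp S, ∃ u, m = {u} := fun m hm => Finset.card_eq_one.1 (hhom m hm)
  obtain ⟨m, hm⟩ : (supp S).Nonempty := by
    rw [Finset.nonempty_iff_ne_empty, Ne, supp_eq_empty]; exact h.ne_zero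
  obtain ⟨u, rfl⟩ := hpt m hm
  obtain ⟨m', hm', hne⟩ : ∃ m' ∈ supp S, m' ≠ {u} := by
    by_contra! hall
    have : S = e {u} := chain_ext (by
      rw [supp_e]
      exact Finset.eq_singleton_iff_unique_mem.2 ⟨hm, hall⟩)
    have hd := h.d_eq_zero
    rw [this, d_vertex] at hd
    exact e_ne_zero ∅ hd
  obtain ⟨u', rfl⟩ := hpt m' hm'
  have huu : u ≠ u' := fun h => hne (by rw [h])
  refine ⟨u, u', huu, ?_⟩
  have hsub : supp (e {u} + e {u'}) ⊆ supp S := by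
    intro m hm2
    rcases mem_supp_or_of_add hm2 with h | h
    · rw [supp_e, Finset.mem_singleton] at h; exact h ▸ hm
    · rw [supp_e, Finset.mem_singleton] at h; exact h ▸ hm'
  have hd : d (e {u} + e {u'} : Chain ι) = 0 := by rw [map_add, d_vertex, d_vertex, add_self]
  rcases h.irr _ hsub hd with h0 | h0
  · have := congrArg supp (eq_of_add_eq_zero h0)
    simp [huu] at this
  · exact h0.symm

/-- Attaching a cone over the star of a boundary vertex does not change the type. -/
theorem eqv_cone_star {W Y : Chain ι} {u z : ι} (hW : Phi W) (huW : u ∉ vars W) (huY : u ∉ vars Y)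
    (hzu : z ≠ u) (hzW : z ∉ vars W) (hzY : z ∉ vars Y) :
    Eqv (e {u} * (W + e {z} * d W) + Y) (e {u} * W + Y) := by
  have h1 := hW {u} 1 z (Finset.singleton_nonempty u) d_one (by simp) (by simpa using huW) (by simp)
    (by simpa using hzu) (by simp) hzW
  rw [d_vertex, one_mul, one_mul, one_mul] at h1
  have hE : d (e {u} * (W + e {z} * d W)) = e {z} * d W + W := by
    rw [d_vertex_mul, map_add, d_vertex_mul, d_d]
    linear_combination (e {u} * d W) * two_eq_zero (ι := ι)
  have h2 : Eqv (e {u} * (W + e {z} * d W) + Y) (e {z} * W + Y) := by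
    refine h1.eqv_add ?_ ?_
    · refine meetIn_e_mul ?_ (not_face_of_notMem_vars huY) ?_
      · rw [Finset.disjoint_singleton_left]
        exact notMem_vars_add huW (notMem_vars_mul (by simpa using hzu.symm) (notMem_vars_d huW))
      · rw [hE, d_vertex]; ring
    · intro G hG hGY hGW
      have := meetIn_e_mul (by simpa using hzW) (not_face_of_notMem_vars hzY)
        (by rw [d_vertex, one_mul]) G hG hGY hGW
      rw [hE]
      exact this.add_e_mul (not_face_of_notMem_vars hzW)
  -- The exchange has produced `z * W + Y`; starring at the vertex `u` shows that this is `u * W +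
  -- Y` renamed.
  have h3 : StarAt {u} z W Y (e {u} * W + Y) (e {z} * W + Y) :=
    ⟨Finset.singleton_nonempty u, by simpa using hzu, by simpa using huW, hzW, hzY,
      not_face_of_notMem_vars huY, rfl, by rw [d_vertex, mul_one]⟩
  exact h2.trans h3.eqv.symm

theorem notMem_vars_dl_singleton (u : ι) (K : Chain ι) : u ∉ vars (dl {u} K) := fun h =>
  not_face_dl {u} K (mem_vars_iff_face.1 h)

theorem notMem_vars_lk_singleton (u : ι) (K : Chain ι) : u ∉ vars (lk {u} K) := fun h =>
  Finset.disjoint_left.1 (disjoint_vars_lk {u} K) (by simp) h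

/-- Let `W` be the link of `u'` in `Y`. The link of `u'` in the sphere is `E + W`, so by induction
`W` is a ball with boundary `∂E`. Starring `E` turns the facet `E * u'` into `u' * x * ∂W`, which
`eqv_cone_star` removes. -/
theorem eqv_add_facet_of_sph {k : ℕ} {S Y : Chain ι} {E : Finset ι} {u u' : ι} (h : Sph k S)
    (hE : E.Nonempty) (hu' : u' ∉ E) (huu : u ≠ u') (hY : ¬ Face Y E)
    (hS : S = e E * (e {u} + e {u'}) + Y)
    (ih : ∀ j < k, 1 ≤ j → ∀ (L : Chain ι) (F : Finset ι), Sph j L → F ∈ supp L →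
      Ball j (L + e F)) :
    Eqv (e E * e {u'} + Y) Y := by
  set W := StellarChain.lk {u'} Y with hWdef
  set Y0 := dl {u'} Y with hY0
  have hYeq : Y = e {u'} * W + Y0 := eq_lk_add_dl {u'} Y
  have hu'W : u' ∉ vars W := notMem_vars_lk_singleton _ _
  have hu'Y0 : u' ∉ vars Y0 := notMem_vars_dl_singleton _ _
  have hWE : ¬ Face W E := fun hf => hY ((face_lk.1 hf).2.mono Finset.subset_union_right)
  have hSeq : S = e {u'} * (e E + W) + (e {u} * e E + Y0) := by
    rw [hS, hYeq]; ring
  have hlk : StellarChain.lk {u'} S = e E + W := by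
    rw [hSeq]
    refine lk_eq ?_ (not_face_of_notMem_vars (notMem_vars_add (notMem_vars_mul
      (by simpa using huu.symm) (by simpa using hu')) hu'Y0))
    rw [Finset.disjoint_singleton_left]
    exact notMem_vars_add (by simpa using hu') hu'W
  have hEmem : E ∈ supp (e E + W) := by
    rw [mem_supp_add]
    exact Or.inl ⟨by simp, fun h => hWE (face_of_mem_supp h)⟩
  have hne : StellarChain.lk {u'} S ≠ 0 := by
    rw [hlk, Ne, ← supp_eq_empty]
    exact Finset.ne_empty_of_mem hEmem
  obtain ⟨j, hj, hL⟩ := h.lk (Finset.singleton_nonempty u') (lk_ne_zero.1 hne)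
  rw [hlk] at hL
  rw [Finset.card_singleton] at hj
  have hjE : E.card = j := BallOrSph.hom (Or.inr hL) E hEmem
  have hWb : Ball j W := by
    have := ih j (by omega) (by have := Finset.card_pos.2 hE; omega) _ E hL hEmem
    rwa [show e E + W + e E = W by linear_combination e E * two_eq_zero (ι := ι)] at this
  have hdW : d W = d (e E) := by
    have := hL.d_eq_zero
    rw [map_add] at this
    exact (eq_of_add_eq_zero this).symm
  obtain ⟨x, hx⟩ := exists_fresh (E ∪ {u'} ∪ vars Y)
  simp only [Finset.mem_union, Finset.mem_singleton, not_or] at hx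
  obtain ⟨⟨hxE, hxu⟩, hxY⟩ := hx
  have s1 : StarAt E x (e {u'}) Y (e E * e {u'} + Y) (e {x} * d (e E) * e {u'} + Y) :=
    ⟨hE, hxE, by simpa using hu', by simpa using hxu, hxY, hY, rfl, rfl⟩
  have s2 := eqv_cone_star (BallOrSph.phi (Or.inl hWb)) hu'W hu'Y0 hxu
    (fun h => hxY (vars_lk_subset _ _ h)) (fun h => hxY (vars_dl_subset _ _ h))
  rw [← hYeq] at s2
  refine s1.eqv.trans ((Eqv.of_eq ?_).trans s2)
  rw [hdW]
  conv_lhs => rw [hYeq]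
  ring

/-- Either way of removing one of the two facets at the ridge `E` is compared with removing both. An
empty ridge occurs for two points only and is treated by renaming. -/
theorem Sph.eqv_adjacent {k : ℕ} {S : Chain ι} {E : Finset ι} {u u' : ι} (h : Sph k S)
    (huu : u ≠ u') (hS : StellarChain.lk E S = e {u} + e {u'})
    (ih : ∀ j < k, 1 ≤ j → ∀ (L : Chain ι) (F : Finset ι), Sph j L → F ∈ supp L →
      Ball j (L + e F)) :
    Eqv (S + e (insert u E)) (S + e (insert u' E)) := by
  have hSeq := eq_lk_add_dl E S
  rw [hS] at hSeq
  have hmem : ∀ w, w = u ∨ w = u' → w ∉ E := by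
    intro w hw hwE
    have : w ∈ vars (StellarChain.lk E S) := by
      rw [hS, mem_vars]
      refine ⟨{w}, ?_, by simp⟩
      rw [mem_supp_add, supp_e, supp_e]
      rcases hw with rfl | rfl
      · exact Or.inl (by simpa using huu)
      · exact Or.inr (by simpa using huu.symm)
    exact Finset.disjoint_left.1 (disjoint_vars_lk E S) hwE this
  have hu := hmem u (Or.inl rfl)
  have hu' := hmem u' (Or.inr rfl)
  have hY := not_face_dl E S
  have e1 : S + e (insert u E) = e E * e {u'} + dl E S := by
    rw [e_insert hu]
    linear_combination hSeq + (e {u} * e E) * two_eq_zero (ι := ι)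
  have e2 : S + e (insert u' E) = e E * e {u} + dl E S := by
    rw [e_insert hu']
    linear_combination hSeq + (e {u'} * e E) * two_eq_zero (ι := ι)
  rw [e1, e2]
  rcases E.eq_empty_or_nonempty with rfl | hE
  · have h0 : dl ∅ S = 0 := by
      by_contra h0
      exact hY (face_empty.2 h0)
    rw [h0, e_empty, one_mul, one_mul, add_zero, add_zero]
    have : StarAt {u'} u 1 0 (e {u'}) (e {u}) :=
      ⟨by simp, by simpa using huu, by simp, by simp, by simp, by simp, by ring,
        by rw [d_vertex]; ring⟩
    exact this.eqv
  · refine (eqv_add_facet_of_sph h hE hu' huu hY hSeq ih).trans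
      (eqv_add_facet_of_sph h hE hu huu.symm hY ?_ ih).symm
    rw [add_comm (e {u'})]; exact hSeq

/-- Facets whose removal is equivalent to that of `F'` form a cycle: at each ridge there are exactly
two facets, and they are both in the class or both outside it. A nonzero cycle is the whole sphere.
-/
theorem Sph.eqv_facets {k : ℕ} {S : Chain ι} {F F' : Finset ι} (h : Sph k S)
    (ih : ∀ j < k, 1 ≤ j → ∀ (L : Chain ι) (F : Finset ι), Sph j L → F ∈ supp L →
      Ball j (L + e F)) (hF : F ∈ supp S) (hF' : F' ∈ supp S) :
    Eqv (S + e F) (S + e F') := by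
  classical
  set s := (supp S).filter fun G => Eqv (S + e G) (S + e F') with hs
  set Z : Chain ι := ∑ G ∈ s, e G with hZ
  have hsupp : supp Z = s := by
    rw [hZ, supp_sum_e (f := fun m => m) (Set.injOn_id _), Finset.image_id']
  have hsub : supp Z ⊆ supp S := by rw [hsupp]; exact Finset.filter_subset _ _
  have hdZ : d Z = 0 := by
    by_contra hne
    obtain ⟨E, hE⟩ : (supp (d Z)).Nonempty := by
      rwa [Finset.nonempty_iff_ne_empty, Ne, supp_eq_empty]
    obtain ⟨v, hvE, hv⟩ := mem_supp_d hE
    have hfE : Face S E := ⟨_, hsub hv, Finset.subset_insert _ _⟩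
    have hk : (insert v E).card = k := BallOrSph.hom (Or.inr h) _ (hsub hv)
    rw [Finset.card_insert_of_notMem hvE] at hk
    have hL : Sph 1 (StellarChain.lk E S) := by
      rcases E.eq_empty_or_nonempty with rfl | hE0
      · have : StellarChain.lk ∅ S = S := by
          have h1 := lk_e_mul (A := ∅) (P := S) (by simp)
          rwa [e_empty, one_mul] at h1
        rw [this]
        simp only [Finset.card_empty, zero_add] at hk
        rwa [hk]
      · obtain ⟨j, hj, hL⟩ := h.lk hE0 hfE
        have : j = 1 := by omega
        rwa [this] at hL
    obtain ⟨u, u', huu, hL⟩ := hL.eq_pair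
    have hadj := h.eqv_adjacent huu hL ih
    have hmemL : ∀ w, w = u ∨ w = u' → w ∉ E ∧ insert w E ∈ supp S := by
      intro w hw
      have : {w} ∈ supp (StellarChain.lk E S) := by
        rw [hL, mem_supp_add, supp_e, supp_e]
        rcases hw with rfl | rfl
        · exact Or.inl (by simpa using huu)
        · exact Or.inr (by simpa using huu.symm)
      rw [mem_supp_lk] at this
      rw [Finset.insert_eq, Finset.union_comm]
      exact ⟨by simpa using this.1, this.2⟩
    obtain ⟨huE, huS⟩ := hmemL u (Or.inl rfl)
    obtain ⟨huE', huS'⟩ := hmemL u' (Or.inr rfl)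
    have hlkZ : ∀ w, w ∉ E → ({w} ∈ supp (StellarChain.lk E Z) ↔ insert w E ∈ s) := by
      intro w hw
      rw [mem_supp_lk, Finset.union_comm, ← Finset.insert_eq, hsupp]
      simp [hw]
    have hiff : insert u E ∈ s ↔ insert u' E ∈ s := by
      rw [hs, Finset.mem_filter, Finset.mem_filter]
      simp only [huS, huS', true_and]
      exact ⟨fun h => hadj.symm.trans h, fun h => hadj.trans h⟩
    have hsubL : ∀ m ∈ supp (StellarChain.lk E Z), m = {u} ∨ m = {u'} := by
      intro m hm
      have := supp_lk_mono hsub E hm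
      rw [hL] at this
      simpa using mem_supp_or_of_add this
    have hd0 : d (StellarChain.lk E Z) = 0 := by
      by_cases hus : insert u E ∈ s
      · have : StellarChain.lk E Z = e {u} + e {u'} := by
          apply chain_ext
          ext m
          rw [mem_supp_add, supp_e, supp_e, Finset.mem_singleton, Finset.mem_singleton]
          constructor
          · intro hm
            rcases hsubL m hm with rfl | rfl
            · exact Or.inl (by simpa using huu)
            · exact Or.inr (by simpa using huu.symm)
          · rintro (⟨rfl, -⟩ | ⟨rfl, -⟩)
            · exact (hlkZ u huE).2 hus
            · exact (hlkZ u' huE').2 (hiff.1 hus)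
        rw [this, map_add, d_vertex, d_vertex, add_self]
      · have : StellarChain.lk E Z = 0 := by
          rw [← supp_eq_empty, Finset.eq_empty_iff_forall_notMem]
          intro m hm
          rcases hsubL m hm with rfl | rfl
          · exact hus ((hlkZ u huE).1 hm)
          · exact hus (hiff.2 ((hlkZ u' huE').1 hm))
        rw [this, map_zero]
    rw [← lk_d] at hd0
    exact lk_ne_zero.2 (face_of_mem_supp hE) hd0
  rcases h.irr Z hsub hdZ with h0 | h0
  · have : F' ∈ supp Z := by
      rw [hsupp, hs, Finset.mem_filter]; exact ⟨hF', .refl _⟩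
    rw [h0] at this; simp at this
  · have : F ∈ supp Z := by rw [h0]; exact hF
    rw [hsupp, hs, Finset.mem_filter] at this
    exact this.2

/-- The complement of a simplex of maximal dimension in a sphere is a ball. -/
theorem Sph.ball_add_facet {k : ℕ} {S : Chain ι} {F : Finset ι} (h : Sph k S) (hk : 1 ≤ k)
    (hF : F ∈ supp S) : Ball k (S + e F) := by
  induction k using Nat.strong_induction_on generalizing S F with
  | _ k ih =>
  have ih' : ∀ j < k, 1 ≤ j → ∀ (L : Chain ι) (F : Finset ι), Sph j L → F ∈ supp L →
      Ball j (L + e F) := fun j hj h1 L F hL hF => ih j hj hL h1 hF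
  suffices H : ∃ F ∈ supp S, Ball k (S + e F) by
    obtain ⟨F', hF', hB⟩ := H
    exact hB.of_eqv (h.eqv_facets ih' hF hF')
  have key : ∀ {R L : Chain ι}, Eqv R L → Sph k L →
      ((∃ F ∈ supp R, Ball k (R + e F)) ↔ ∃ F ∈ supp L, Ball k (L + e F)) := by
    intro R L hRL
    induction hRL with
    | rel R L hs =>
      intro hL
      have hR := hL.of_eqv hs.eqv
      obtain ⟨C, c, P, T, hs⟩ := hs
      by_cases hP : P = 0
      · subst hP; rw [hs.eq_of_zero]
      -- It suffices to remove a facet outside the star of `C`, since the move does not touch it.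
      -- There is one, as otherwise `R = C * P` would have the nonzero boundary `∂C * P`.
      obtain ⟨F, hFT⟩ : (supp T).Nonempty := by
        rw [Finset.nonempty_iff_ne_empty, Ne, supp_eq_empty]
        rintro rfl
        have hd := hR.d_eq_zero
        have hdl : d P = 0 := by rw [← hs.lk_simplex, ← lk_d, hd, map_zero]
        rw [hs.2.2.2.2.2.2.1, add_zero, d_mul, hdl, mul_zero, add_zero] at hd
        exact mul_ne_zero' (vars_d_e_disjoint hs.2.2.1) (d_e_ne_zero hs.1) hP hd
      have hFR : F ∈ supp R := hs.mem_supp_left.2 (Or.inr hFT)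
      have hFL : F ∈ supp L := hs.mem_supp_right.2 (Or.inr hFT)
      have heqv : Eqv (R + e F) (L + e F) := by
        obtain ⟨h1, h2, h3, h4, h5, h6, rfl, rfl⟩ := hs
        have hsF := (face_of_mem_supp hFT).subset_vars
        have : StarAt C c P (T + e F) (e C * P + T + e F) (e {c} * d (e C) * P + T + e F) :=
          ⟨h1, h2, h3, h4, notMem_vars_add h5 (by rw [vars_e]; exact fun h => h5 (hsF h)),
            not_face_add h6 (by rw [face_e]; exact fun h => h6 ⟨F, hFT, h⟩), by ring, by ring⟩
        exact this.eqv
      constructor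
      · rintro ⟨F', hF', hB⟩
        exact ⟨F, hFL, (hB.of_eqv (hR.eqv_facets ih' hFR hF')).of_eqv heqv.symm⟩
      · rintro ⟨F', hF', hB⟩
        exact ⟨F, hFR, (hB.of_eqv (hL.eqv_facets ih' hFL hF')).of_eqv heqv⟩
    | refl K => exact fun _ => Iff.rfl
    | symm R L hRL ih' => exact fun hR => (ih' (hR.of_eqv hRL.symm)).symm
    | trans K L M hKL hLM ih1 ih2 => exact fun hM => (ih1 (hM.of_eqv hLM)).trans (ih2 hM)
  obtain ⟨D, hD, h⟩ := h
  rw [key h ⟨D, hD, .refl _⟩]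
  obtain ⟨c, hc⟩ : D.Nonempty := Finset.card_pos.1 (by omega)
  have hcard : (D.erase c).card = k := by rw [Finset.card_erase_of_mem hc]; omega
  have hne : (D.erase c).Nonempty := Finset.card_pos.1 (by omega)
  refine ⟨D.erase c, mem_supp_d_e.2 ⟨c, hc, rfl⟩, ?_⟩
  -- The boundary of `D` without the facet opposite `c` is the cone `c * ∂(D \ c)`, a starring of
  -- that facet at itself.
  have hs : StarAt (D.erase c) c 1 0 (e (D.erase c)) (e {c} * d (e (D.erase c))) :=
    ⟨hne, Finset.notMem_erase c D, by simp, by simp, by simp, by simp, by ring, by ring⟩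
  have : d (e D) + e (D.erase c) = e {c} * d (e (D.erase c)) := by
    rw [e_erase hc, d_vertex_mul]
    linear_combination e (D.erase c) * two_eq_zero (ι := ι)
  rw [this]
  have hb := ball_e hne
  rw [hcard] at hb
  exact hb.of_eqv hs.eqv.symm

end

end StellarChain

/-! ### Newman's theorem for chains. -/

namespace StellarChain

noncomputable section

variable {ι : Type*} [DecidableEq ι] [Infinite ι]

theorem mem_supp_add_of_disjoint {K X : Chain ι} (h : Disjoint (supp K) (supp X)) {m : Finset ι} :
    m ∈ supp (K + X) ↔ m ∈ supp K ∨ m ∈ supp X := by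
  have h' : m ∈ supp K → m ∉ supp X := fun h1 h2 => Finset.disjoint_left.1 h h1 h2
  rw [mem_supp_add]
  unfold Xor
  tauto

theorem disjoint_supp_lk {K X : Chain ι} (h : Disjoint (supp K) (supp X)) (G : Finset ι) :
    Disjoint (supp (lk G K)) (supp (lk G X)) := by
  rw [Finset.disjoint_left] at h ⊢
  intro m hm hm'
  exact h (mem_supp_lk.1 hm).2 (mem_supp_lk.1 hm').2

/-- Two parts of a sphere meet in their boundary. -/
theorem Sph.face_boundary {k : ℕ} {K X : Chain ι} (h : Sph k (K + X))
    (hd : Disjoint (supp K) (supp X)) {G : Finset ι} (hG : G.Nonempty) (hK : Face K G)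
    (hX : Face X G) : Face (d K) G := by
  -- If `G` is not in the boundary of `K`, then its link in `K` is a cycle inside the link in the
  -- sphere, so it is zero or everything. Both are excluded because `G` occurs in `K` and in `X`.
  by_contra hn
  have hdl := disjoint_supp_lk hd G
  have hsub : ∀ m, m ∈ supp (StellarChain.lk G K) → m ∈ supp (StellarChain.lk G (K + X)) := by
    intro m hm
    rw [map_add, mem_supp_add_of_disjoint hdl]
    exact Or.inl hm
  have hf : Face (K + X) G := by
    obtain ⟨m, hm, hGm⟩ := hK
    exact ⟨m, (mem_supp_add_of_disjoint hd).2 (Or.inl hm), hGm⟩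
  obtain ⟨j, -, hL⟩ := h.lk hG hf
  have hd0 : d (StellarChain.lk G K) = 0 := by rw [← lk_d, lk_eq_zero hn]
  rcases hL.irr _ hsub hd0 with h0 | h0
  · exact lk_ne_zero.2 hK h0
  · rw [map_add] at h0
    exact lk_ne_zero.2 hX (left_eq_add.1 h0)

theorem Ball.rn {k : ℕ} {K : Chain ι} (h : Ball k K) (σ : Equiv.Perm ι) : Ball k (rn σ K) :=
  h.of_eqv (eqv_rn σ K).symm

theorem disjoint_supp_rn {K X : Chain ι} (h : Disjoint (supp K) (supp X)) (σ : Equiv.Perm ι) :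
    Disjoint (supp (rn σ K)) (supp (rn σ X)) := by
  rw [supp_rn, supp_rn, Finset.disjoint_image (Finset.map_injective _)]
  exact h

/-- The complement of `K` is a ball in every sphere that contains `K`. -/
def ComplBall (k : ℕ) (K : Chain ι) : Prop :=
  ∀ X : Chain ι, Sph k (K + X) → Disjoint (supp K) (supp X) → Ball k X

/-- The sphere is subdivided at `A` as a whole, which subdivides `K` and its complement
simultaneously; no induction on the dimension is needed. -/
theorem StarAt.complBall_of_subdivision {A : Finset ι} {x : ι} {P R K K' : Chain ι} {k : ℕ}
    (h : StarAt A x P R K K') (hK' : ComplBall k K') : ComplBall k K := by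
  intro X hS hd
  -- The vertex `x` is new for `K` but may occur in `X`, and has to be renamed there.
  obtain ⟨σ, h1, h2⟩ := exists_perm_avoid (vars K) (vars X) {x}
  have hσK : rn σ K = K := rn_eq_self h1
  suffices H : Ball k (rn σ X) from H.of_eqv (eqv_rn σ X)
  have hxK := h.notMem_vars
  have hxX : x ∉ vars (rn σ X) := by
    rw [vars_rn, Finset.mem_map]
    rintro ⟨v, hv, hvx⟩
    by_cases hvK : v ∈ vars K
    · have : σ v = v := h1 v hvK
      exact hxK (by rw [← hvx]; exact this.symm ▸ hvK)
    · exact h2 v hv hvK (by simpa using hvx)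
  have hS1 : Sph k (K + rn σ X) := by
    rw [← hσK, ← map_add]; exact hS.of_eqv (eqv_rn σ _).symm
  have hd1 : Disjoint (supp K) (supp (rn σ X)) := by
    have := disjoint_supp_rn hd σ
    rwa [hσK] at this
  generalize rn σ X = Y at hxX hS1 hd1
  have hY := StarAt.mk_lk h.1 h.2.1 hxX
  set Y' := e {x} * d (e A) * lk A Y + dl A Y with hY'
  have hKY : StarAt A x (P + lk A Y) (R + dl A Y) (K + Y) (K' + Y') := by
    obtain ⟨a1, a2, a3, a4, a5, a6, rfl, rfl⟩ := h
    obtain ⟨-, -, b3, b4, b5, b6, b7, -⟩ := hY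
    refine ⟨a1, a2, disjoint_vars_add a3 b3, notMem_vars_add a4 b4, notMem_vars_add a5 b5,
      not_face_add a6 b6, ?_, ?_⟩
    · conv_lhs => rw [b7]
      ring
    · rw [hY']; ring
  refine (hK' Y' (hS1.of_eqv hKY.eqv.symm) ?_).of_eqv hY.eqv
  rw [Finset.disjoint_left] at hd1 ⊢
  intro m hm hm'
  have hxR : ∀ m ∈ supp R, x ∉ m := fun m hm hx =>
    h.2.2.2.2.1 (mem_vars.2 ⟨m, hm, hx⟩)
  have hxY : ∀ m ∈ supp (dl A Y), x ∉ m := fun m hm hx =>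
    hY.2.2.2.2.1 (mem_vars.2 ⟨m, hm, hx⟩)
  rcases h.mem_supp_right.1 hm with ⟨v, hv, p, hp, rfl⟩ | hm
  · rcases hY.mem_supp_right.1 hm' with ⟨w, hw, q, hq, heq⟩ | hm'
    -- The link facet is recovered by deleting `x` and `A`, so a common new facet would come from a
    -- common old one.
    · have sub : ∀ {Z : Chain ι} {p : Finset ι}, Disjoint A (vars Z) → x ∉ vars Z → p ∈ supp Z →
          ∀ v, (insert x (A.erase v ∪ p)) \ insert x A = p := by
        intro Z p hAZ hxZ hp v
        have hpZ := (face_of_mem_supp hp).subset_vars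
        ext y
        simp only [Finset.mem_sdiff, Finset.mem_insert, Finset.mem_union, Finset.mem_erase]
        constructor
        · tauto
        · intro hy
          have c1 : y ≠ x := fun hyx => hxZ (hyx ▸ hpZ hy)
          have c2 : y ∉ A := fun hyA => Finset.disjoint_left.1 hAZ hyA (hpZ hy)
          tauto
      have hpq : p = q := by
        rw [← sub h.2.2.1 h.2.2.2.1 hp v, heq, sub hY.2.2.1 hY.2.2.2.1 hq w]
      subst hpq
      exact hd1 (h.mem_supp_left.2 (Or.inl ⟨p, hp, rfl⟩)) (hY.mem_supp_left.2 (Or.inl ⟨p, hq, rfl⟩))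
    · exact hxY _ hm' (Finset.mem_insert_self _ _)
  · rcases hY.mem_supp_right.1 hm' with ⟨w, hw, q, hq, rfl⟩ | hm'
    · exact hxR _ hm (Finset.mem_insert_self _ _)
    · exact hd1 (h.mem_supp_left.2 (Or.inr hm)) (hY.mem_supp_left.2 (Or.inr hm'))

/-- Here `K` is obtained by a weld from `K'`, and the old simplex `A` is reintroduced by the
exchange of `x * ∂A * P` for `A * (P + x * ∂P)`. This shifts `A * x * ∂P` to the side of the
complement; when it is nonzero, the induction hypothesis applied to the link of `x` allows its
removal. -/
theorem StarAt.complBall_of_weld {A : Finset ι} {x : ι} {P R K K' : Chain ι} {k : ℕ}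
    (h : StarAt A x P R K K') (hKball : Ball k K) (hK : ComplBall k K)
    (ih : ∀ j < k, 1 ≤ j → ∀ L : Chain ι, Ball j L → ComplBall j L) : ComplBall k K' := by
  by_cases hP0 : P = 0
  · subst hP0; rwa [← h.eq_of_zero]
  have hA := h.1
  have hxA := h.2.1
  have hAP := h.2.2.1
  have hxP := h.2.2.2.1
  have hxR := h.2.2.2.2.1
  have hRA := h.2.2.2.2.2.1
  have hKeq := h.2.2.2.2.2.2.1
  have hK'eq := h.2.2.2.2.2.2.2
  have hxA' : x ∉ vars (e A) := by simpa using hxA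
  have hPf : Face K A := lk_ne_zero.1 (by rw [h.lk_simplex]; exact hP0)
  obtain ⟨j, hj, hPj⟩ := BallOrSph.man (Or.inl hKball) A hA hPf
  rw [h.lk_simplex] at hPj
  have hcA := Finset.card_pos.2 hA
  -- the main case: `A` is not a simplex of the complement
  have main : ∀ X : Chain ι, ¬ Face X A → Sph k (K' + X) → Disjoint (supp K') (supp X) →
      Ball k X := by
    intro X hXA hS hd
    have hAx : Disjoint A (vars (e {x})) := by simpa using hxA
    have hAxP : Disjoint A (vars (P + e {x} * d P)) :=
      disjoint_vars_add hAP (disjoint_vars_mul hAx (disjoint_vars_d hAP))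
    have hflip := hPj.phi A 1 x hA d_one (by simp) hAP (by simp) hxA (by simp) hxP
    rw [one_mul, one_mul] at hflip
    have hE : d (e A * (P + e {x} * d P)) = e {x} * (d (e A) * d P) + d (e A) * P := by
      rw [d_mul, map_add, d_vertex_mul, d_d]
      linear_combination (e A * d P) * two_eq_zero (ι := ι)
    have hxAP : x ∉ vars (d (e A) * P) := notMem_vars_mul (notMem_vars_d hxA') hxP
    have hnx : ∀ G : Finset ι, x ∉ G → Face (e {x} * (d (e A) * P)) G →
        Face (e {x} * (d (e A) * d P) + d (e A) * P) G := by
      intro G hxG hG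
      have := hG.of_e_mul (by simpa using hxAP) (by simpa using hxG)
      rw [d_vertex, one_mul] at this
      exact this.add_e_mul (not_face_of_notMem_vars hxAP)
    have hdK' : d K' = e {x} * (d (e A) * d P) + (d (e A) * P + d R) := by
      rw [hK'eq, map_add, mul_assoc, d_vertex_mul, d_mul, d_d]; ring
    -- Here the exchange acts with `R + X` as the rest of the chain.
    have heqv : Eqv (K' + X) (K + (X + e A * (e {x} * d P))) := by
      have := (hflip.eqv_add (Q := R + X) ?_ ?_).symm
      · refine (Eqv.of_eq ?_).trans (this.trans (Eqv.of_eq ?_))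
        · rw [hK'eq]; ring
        · rw [hKeq]; ring
      · exact meetIn_e_mul hAxP (not_face_add hRA hXA) (by rw [hE]; ring)
      · intro G hG hGQ hGC
        rw [hE]
        -- A common simplex through `x` cannot lie in `R`, so it lies in `K'` and `X`, hence in the
        -- boundary of `K'`; its part at `x` is `x * ∂A * ∂P`.
        by_cases hxG : x ∈ G
        · have hGX : Face X G := by
            rcases hGQ.of_add with h1 | h1
            · exact absurd (h1.subset_vars hxG) hxR
            · exact h1
          have hGK' : Face K' G := by
            rw [hK'eq, mul_assoc]
            exact hGC.e_mul_add (not_face_of_notMem_vars hxR)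
          have hGd := hS.face_boundary hd hG hGK' hGX
          rw [hdK'] at hGd
          rcases hGd.of_add with h1 | h1
          · exact h1.e_mul_add (not_face_of_notMem_vars hxAP)
          · exact absurd (h1.subset_vars hxG) (notMem_vars_add hxAP (notMem_vars_d hxR))
        · exact hnx G hxG hGC
    have hxK : x ∉ vars K := h.notMem_vars
    have hAxdP : Disjoint A (vars (e {x} * d P)) := disjoint_vars_mul hAx (disjoint_vars_d hAP)
    have hball : Ball k (X + e A * (e {x} * d P)) := by
      refine hK _ (hS.of_eqv heqv.symm) ?_
      rw [Finset.disjoint_left] at hd ⊢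
      intro m hm hm'
      rcases mem_supp_or_of_add hm' with hm' | hm'
      · rcases h.mem_supp_left.1 hm with ⟨p, -, rfl⟩ | hmR
        · exact hXA ⟨_, hm', Finset.subset_union_left⟩
        · exact hd (h.mem_supp_right.2 (Or.inr hmR)) hm'
      · rw [show e A * (e {x} * d P) = e {x} * (e A * d P) by ring] at hm'
        have := subset_of_mem_supp_e_mul hm'
        exact hxK (mem_vars.2 ⟨m, hm, this (Finset.mem_singleton_self x)⟩)
    by_cases hdP : d P = 0
    · rwa [hdP, mul_zero, mul_zero, add_zero] at hball
    have hPball := hPj.ball hdP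
    refine hball.of_eqv (Eqv.symm ?_)
    -- the link of `x`
    set W := lk {x} X with hW
    set X0 := dl {x} X with hX0
    have hXeq : X = e {x} * W + X0 := eq_lk_add_dl {x} X
    have hlkx := h.lk_vertex
    have hdl := disjoint_supp_lk hd {x}
    rw [hlkx] at hdl
    have hne : d (e A) * P ≠ 0 := mul_ne_zero' (vars_d_e_disjoint hAP) (d_e_ne_zero hA) hP0
    have hfx : Face (K' + X) {x} := by
      rw [← lk_ne_zero, map_add, hlkx]
      intro h0
      rw [← eq_of_add_eq_zero h0, disjoint_self] at hdl
      exact hne (supp_eq_empty.1 hdl)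
    obtain ⟨i, hi, hL⟩ := hS.lk (Finset.singleton_nonempty x) hfx
    rw [map_add, hlkx] at hL
    rw [Finset.card_singleton] at hi
    obtain ⟨c, hc⟩ : ∃ c, A.card = c + 1 := ⟨A.card - 1, by omega⟩
    have hdAP := hPball.d_e_mul hc hAP
    have hji : j + c = i := by omega
    rw [hji] at hdAP
    -- In the link of `x` in the sphere, `W` is the complement of the ball `∂A * P`, which has
    -- smaller dimension.
    have hWball : Ball i W := ih i (by omega) hdAP.1 _ hdAP W hL hdl
    have hdW : d W = d (e A) * d P := by
      have := hL.d_eq_zero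
      rw [map_add, d_mul, d_d, zero_mul, zero_add] at this
      exact (eq_of_add_eq_zero this).symm
    obtain ⟨z, hz⟩ := exists_fresh (A ∪ {x} ∪ vars P ∪ vars X)
    simp only [Finset.mem_union, Finset.mem_singleton, not_or] at hz
    obtain ⟨⟨⟨hzA, hzx⟩, hzP⟩, hzX⟩ := hz
    -- As `d W = ∂A * ∂P`, starring `A` turns the extra piece into `x * z * d W`, the form that
    -- `eqv_cone_star` removes.
    have s1 : StarAt A z (e {x} * d P) X (X + e A * (e {x} * d P))
        (e {z} * d (e A) * (e {x} * d P) + X) :=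
      ⟨hA, hzA, hAxdP, notMem_vars_mul (by simpa using hzx) (notMem_vars_d hzP), hzX, hXA,
        by ring, rfl⟩
    have s2 := eqv_cone_star (BallOrSph.phi (Or.inl hWball)) (notMem_vars_lk_singleton x X)
      (notMem_vars_dl_singleton x X) hzx (fun h => hzX (vars_lk_subset _ _ h))
      (fun h => hzX (vars_dl_subset _ _ h))
    rw [← hX0, ← hXeq, hdW] at s2
    refine s1.eqv.trans ((Eqv.of_eq ?_).trans s2)
    conv_lhs => rw [hXeq]
    ring
  intro X hS hd
  -- In general `A` is first starred in the sphere. It is not a face of `K'`, so only `X` changes,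
  -- and afterwards `A` is gone.
  obtain ⟨z, hz⟩ := exists_fresh (A ∪ vars K' ∪ vars X)
  simp only [Finset.mem_union, not_or] at hz
  obtain ⟨⟨hzA, hzK'⟩, hzX⟩ := hz
  have hX := StarAt.mk_lk hA hzA hzX
  set X' := e {z} * d (e A) * lk A X + dl A X with hX'
  refine (main X' hX.not_face ?_ ?_).of_eqv hX.eqv
  · refine hS.of_eqv (Eqv.symm (StarAt.eqv (A := A) (a := z) (P := lk A X) (Q := K' + dl A X)
      ⟨hA, hzA, hX.2.2.1, hX.2.2.2.1, notMem_vars_add hzK' hX.2.2.2.2.1,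
        not_face_add h.not_face (not_face_dl A X), ?_, ?_⟩))
    · conv_lhs => rw [eq_lk_add_dl A X]
      ring
    · rw [hX']; ring
  · rw [Finset.disjoint_left] at hd ⊢
    intro m hm hm'
    rcases hX.mem_supp_right.1 hm' with ⟨v, -, p, -, rfl⟩ | hm'
    · exact hzK' (mem_vars.2 ⟨_, hm, Finset.mem_insert_self _ _⟩)
    · exact hd hm (mem_supp_dl.1 hm').1

/-- Newman's theorem for chains. -/
theorem Ball.complBall {k : ℕ} {K : Chain ι} (h : Ball k K) : ComplBall k K := by
  induction k using Nat.strong_induction_on generalizing K with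
  | _ k ih =>
  have ih' : ∀ j < k, 1 ≤ j → ∀ L : Chain ι, Ball j L → ComplBall j L :=
    fun j hj _ L hL => ih j hj hL
  have key : ∀ {R L : Chain ι}, Eqv R L → Ball k L → (ComplBall k R ↔ ComplBall k L) := by
    intro R L hRL
    induction hRL with
    | rel R L hs =>
      intro hL
      have hR := hL.of_eqv hs.eqv
      obtain ⟨C, c, P, T, hs⟩ := hs
      exact ⟨fun hc => hs.complBall_of_weld hR hc ih', hs.complBall_of_subdivision⟩
    | refl K => exact fun _ => Iff.rfl
    | symm R L hRL ih' => exact fun hR => (ih' (hR.of_eqv hRL.symm)).symm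
    | trans K L M hKL hLM ih1 ih2 => exact fun hM => (ih1 (hM.of_eqv hLM)).trans (ih2 hM)
  obtain ⟨hk, D, hD, h⟩ := h
  rw [key h ⟨hk, D, hD, .refl _⟩]
  intro X hS hd
  have hm : D ∈ supp (e D + X) := by
    rw [mem_supp_add_of_disjoint hd]; simp
  have := hS.ball_add_facet hk hm
  rwa [show e D + X + e D = X by linear_combination e D * two_eq_zero (ι := ι)] at this

end

end StellarChain

/-! ### Starring of simplicial complexes, and complexes of chains. -/

namespace StellarChain

noncomputable section

open Stellar

section Complex

variable {W : Type*} [DecidableEq W]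

theorem mem_of_subset {L : PreAbstractSimplicialComplex W} {s t : Finset W} (ht : t ∈ L)
    (hst : s ⊆ t) (hs : s.Nonempty) : s ∈ L :=
  (L.isRelLowerSet_faces ht).2 hst hs

theorem nonempty_of_mem {L : PreAbstractSimplicialComplex W} {s : Finset W} (h : s ∈ L) :
    s.Nonempty :=
  (L.isRelLowerSet_faces h).1

theorem subset_vertices {L : PreAbstractSimplicialComplex W} {s : Finset W} (h : s ∈ L) {x : W}
    (hx : x ∈ s) : x ∈ vertices L :=
  mem_of_subset h (Finset.singleton_subset_iff.2 hx) (Finset.singleton_nonempty x)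

theorem notMem_of_mem {L : PreAbstractSimplicialComplex W} {s : Finset W} (h : s ∈ L) {a : W}
    (ha : a ∉ vertices L) : a ∉ s := fun h' => ha (subset_vertices h h')

theorem isSimplexOrEmpty_link_iff {L : PreAbstractSimplicialComplex W} {A : Finset W} (hA : A ∈ L)
    {s : Finset W} : IsSimplexOrEmpty (link A L) s ↔ Disjoint A s ∧ A ∪ s ∈ L := by
  -- The unions in the definition of `link` use the classical instance, to which the given one is
  -- equal.
  obtain rfl : ‹DecidableEq W› = fun _ _ => Classical.propDecidable _ := Subsingleton.elim _ _
  classical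
  constructor
  · rintro (rfl | ⟨-, h1, h2⟩)
    · simpa using hA
    · exact ⟨h1, h2⟩
  · rintro ⟨h1, h2⟩
    rcases s.eq_empty_or_nonempty with rfl | hs
    · exact Or.inl rfl
    · exact Or.inr ⟨mem_of_subset h2 Finset.subset_union_right hs, h1, h2⟩

theorem isSimplexOrEmpty_simplex_iff {A s : Finset W} :
    IsSimplexOrEmpty (simplex A) s ↔ s ⊆ A := by
  constructor
  · rintro (rfl | ⟨-, h⟩)
    · simp
    · exact h
  · intro h
    rcases s.eq_empty_or_nonempty with rfl | hs
    · exact Or.inl rfl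
    · exact Or.inr ⟨hs, h⟩

theorem isSimplexOrEmpty_boundary_iff {A s : Finset W} (hA : A.Nonempty) :
    IsSimplexOrEmpty (boundary A) s ↔ s ⊂ A := by
  constructor
  · rintro (rfl | ⟨-, h⟩)
    · exact Finset.empty_ssubset.2 hA
    · exact h
  · intro h
    rcases s.eq_empty_or_nonempty with rfl | hs
    · exact Or.inl rfl
    · exact Or.inr ⟨hs, h⟩

theorem isSimplexOrEmpty_join_iff {K L : PreAbstractSimplicialComplex W} {s : Finset W} :
    IsSimplexOrEmpty (join K L) s ↔
      ∃ A B, IsSimplexOrEmpty K A ∧ IsSimplexOrEmpty L B ∧ s = A ∪ B := by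
  obtain rfl : ‹DecidableEq W› = fun _ _ => Classical.propDecidable _ := Subsingleton.elim _ _
  classical
  constructor
  · rintro (rfl | ⟨-, h⟩)
    · exact ⟨∅, ∅, Or.inl rfl, Or.inl rfl, by simp⟩
    · exact h
  · intro h
    rcases s.eq_empty_or_nonempty with rfl | hs
    · exact Or.inl rfl
    · exact Or.inr ⟨hs, h⟩

theorem isSimplexOrEmpty_closedStar_iff {L : PreAbstractSimplicialComplex W} {A s : Finset W}
    (hA : A ∈ L) : IsSimplexOrEmpty (closedStar A L) s ↔ s ∪ A ∈ L := by
  rw [closedStar, isSimplexOrEmpty_join_iff]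
  simp only [isSimplexOrEmpty_simplex_iff, isSimplexOrEmpty_link_iff hA]
  constructor
  · rintro ⟨B, C, hB, ⟨-, hC⟩, rfl⟩
    rwa [Finset.union_right_comm, Finset.union_eq_right.2 hB]
  · intro h
    refine ⟨s ∩ A, s \ A, Finset.inter_subset_right, ⟨Finset.disjoint_sdiff, ?_⟩, ?_⟩
    · rwa [Finset.union_sdiff_self_eq_union, Finset.union_comm]
    · rw [Finset.union_comm, Finset.sdiff_union_inter]

theorem mem_iff_isSimplexOrEmpty {L : PreAbstractSimplicialComplex W} {s : Finset W} :
    s ∈ L ↔ s.Nonempty ∧ IsSimplexOrEmpty L s := by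
  constructor
  · exact fun h => ⟨nonempty_of_mem h, Or.inr h⟩
  · rintro ⟨h, rfl | h'⟩
    · simp at h
    · exact h'

/-- Removal and insertion are merged into one condition that treats old and new simplexes alike;
`StarAt.face_right` has the same shape. -/
theorem mem_starring {L : PreAbstractSimplicialComplex W} {A : Finset W} {a : W} (hA : A ∈ L)
    (ha : a ∉ vertices L) {s : Finset W} :
    s ∈ starring A a L ↔
      s.Nonempty ∧ ¬ A ⊆ s ∧ (s ∈ L ∨ (a ∈ s ∧ s.erase a ∪ A ∈ L)) := by
  have haA := notMem_of_mem hA ha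
  have h0 : s ∈ starring A a L ↔ (s ∈ L ∧ s ∉ closedStar A L) ∨
      s ∈ join (simplex {a}) (join (boundary A) (link A L)) := Iff.rfl
  rw [h0, mem_iff_isSimplexOrEmpty (L := closedStar A L),
    mem_iff_isSimplexOrEmpty (L := join _ _), isSimplexOrEmpty_closedStar_iff hA,
    isSimplexOrEmpty_join_iff]
  simp only [isSimplexOrEmpty_simplex_iff, isSimplexOrEmpty_join_iff,
    isSimplexOrEmpty_boundary_iff (nonempty_of_mem hA), isSimplexOrEmpty_link_iff hA]
  constructor
  · rintro (⟨h1, h2⟩ | ⟨hs, X, _, hX, ⟨Y, Z, hY, ⟨hd, hZ⟩, rfl⟩, rfl⟩)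
    · have hs := nonempty_of_mem h1
      refine ⟨hs, fun h => h2 ⟨hs, ?_⟩, Or.inl h1⟩
      rwa [Finset.union_eq_left.2 h]
    · have haZ : a ∉ Z := fun h => notMem_of_mem hZ ha (by simp [h])
      have haY : a ∉ Y := fun h => haA (hY.1 h)
      refine ⟨hs, fun h => hY.2 fun x hx => ?_, ?_⟩
      · have := h hx
        simp only [Finset.mem_union] at this
        rcases this with h1 | h1 | h1
        · rw [Finset.mem_singleton.1 (hX h1)] at hx; exact absurd hx haA
        · exact h1
        · exact absurd h1 (Finset.disjoint_left.1 hd hx)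
      · rcases Finset.subset_singleton_iff.1 hX with rfl | rfl
        · left
          refine mem_of_subset hZ ?_ hs
          rw [Finset.empty_union]
          exact Finset.union_subset_union_left hY.1
        · right
          refine ⟨by simp, mem_of_subset hZ ?_ ((nonempty_of_mem hA).mono
            Finset.subset_union_right)⟩
          intro x hx
          have := @hY.1 x
          simp at hx ⊢
          tauto
  · rintro ⟨hs, hAs, h⟩
    by_cases h1 : s ∈ L ∧ ¬ (s.Nonempty ∧ s ∪ A ∈ L)
    · exact Or.inl h1
    right
    have hL : s.erase a ∪ A ∈ L := by
      rcases h with h | h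
      · rw [Finset.erase_eq_of_notMem (notMem_of_mem h ha)]
        tauto
      · exact h.2
    refine ⟨hs, s ∩ {a}, s.erase a, Finset.inter_subset_right,
      ⟨s.erase a ∩ A, s.erase a \ A, ⟨Finset.inter_subset_right, fun h' => hAs fun x hx => ?_⟩,
        ⟨Finset.disjoint_sdiff, ?_⟩, ?_⟩, ?_⟩
    · exact Finset.mem_of_mem_erase (Finset.mem_inter.1 (h' hx)).1
    · rwa [Finset.union_sdiff_self_eq_union, Finset.union_comm]
    · rw [Finset.union_comm, Finset.sdiff_union_inter]
    · ext x
      simp only [Finset.mem_union, Finset.mem_inter, Finset.mem_singleton, Finset.mem_erase]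
      tauto

theorem complex_ext {K L : PreAbstractSimplicialComplex W}
    (h : ∀ s : Finset W, s.Nonempty → (s ∈ K ↔ s ∈ L)) : K = L :=
  SetLike.ext fun s => ⟨fun hs => (h s (nonempty_of_mem hs)).1 hs,
    fun hs => (h s (nonempty_of_mem hs)).2 hs⟩

/-- A removed simplex `s` containing `A` leaves a trace: for `v` in `A`, the simplex obtained by
trading `v` for `a` is in the starring exactly because `s` was in the complex. -/
theorem mem_of_starring_eq {L L' : PreAbstractSimplicialComplex W} {A : Finset W} {a : W}
    (hA : A ∈ L) (ha : a ∉ vertices L) (hA' : A ∈ L') (ha' : a ∉ vertices L')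
    (h : starring A a L = starring A a L') {s : Finset W} (hs : s ∈ L) : s ∈ L' := by
  have has := notMem_of_mem hs ha
  by_cases hAs : A ⊆ s
  · obtain ⟨v, hv⟩ := nonempty_of_mem hA
    have hva : v ≠ a := fun h => has (h ▸ hAs hv)
    have h1 : (insert a (s.erase v)).erase a ∪ A = s := by
      ext x
      have := @hAs x
      by_cases hxa : x = a <;> by_cases hxv : x = v <;> simp_all
    have h2 : insert a (s.erase v) ∈ starring A a L := by
      rw [mem_starring hA ha, h1]
      refine ⟨by simp, fun h' => ?_, Or.inr ⟨by simp, hs⟩⟩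
      simpa [hva] using h' hv
    rw [h, mem_starring hA' ha', h1] at h2
    rcases h2.2.2 with h3 | h3
    · exact absurd (Finset.mem_insert_self _ _) (notMem_of_mem h3 ha')
    · exact h3.2
  · have h2 := (mem_starring hA ha).2 ⟨nonempty_of_mem hs, hAs, Or.inl hs⟩
    rw [h, mem_starring hA' ha'] at h2
    rcases h2.2.2 with h3 | h3
    · exact h3
    · exact absurd h3.1 has

theorem starring_injective {L L' : PreAbstractSimplicialComplex W} {A : Finset W} {a : W}
    (hA : A ∈ L) (ha : a ∉ vertices L) (hA' : A ∈ L') (ha' : a ∉ vertices L')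
    (h : starring A a L = starring A a L') : L = L' :=
  complex_ext fun _ _ => ⟨mem_of_starring_eq hA ha hA' ha' h,
    mem_of_starring_eq hA' ha' hA ha h.symm⟩

end Complex

section ChainComplex

variable {ι : Type*} [DecidableEq ι] [Infinite ι]

/-- The simplicial complex of the non-empty simplexes of a chain and their faces. -/
def cx (K : Chain ι) : PreAbstractSimplicialComplex ι where
  faces := {s | s.Nonempty ∧ Face K s}
  isRelLowerSet_faces := fun _ hs => ⟨hs.1, fun _ ht hne => ⟨hne, hs.2.mono ht⟩⟩

theorem mem_cx {K : Chain ι} {s : Finset ι} : s ∈ cx K ↔ s.Nonempty ∧ Face K s := Iff.rfl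

theorem vertices_cx (K : Chain ι) : vertices (cx K) = vars K := by
  ext x
  rw [Finset.mem_coe, mem_vars_iff_face]
  exact ⟨fun h => h.2, fun h => ⟨Finset.singleton_nonempty x, h⟩⟩

theorem StarAt.face_left {A : Finset ι} {a : ι} {P Q K K' : Chain ι} (h : StarAt A a P Q K K')
    (hP : P ≠ 0) : Face K A := by
  obtain ⟨m, hm, -⟩ := face_empty.2 hP
  exact ⟨A ∪ m, h.mem_supp_left.2 (Or.inl ⟨m, hm, rfl⟩), Finset.subset_union_left⟩

theorem StarAt.notMem_vars_left {A : Finset ι} {a : ι} {P Q K K' : Chain ι}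
    (h : StarAt A a P Q K K') : a ∉ vars K := by
  rw [mem_vars]
  rintro ⟨m, hm, ham⟩
  rcases h.mem_supp_left.1 hm with ⟨p, hp, rfl⟩ | hm
  · rcases Finset.mem_union.1 ham with h1 | h1
    · exact h.2.1 h1
    · exact h.2.2.2.1 ((face_of_mem_supp hp).subset_vars h1)
  · exact h.2.2.2.2.1 ((face_of_mem_supp hm).subset_vars ham)

theorem StarAt.face_right {A : Finset ι} {a : ι} {P Q K K' : Chain ι} (h : StarAt A a P Q K K')
    {s : Finset ι} :
    Face K' s ↔ ¬ A ⊆ s ∧ (Face K s ∨ (a ∈ s ∧ Face K (s.erase a ∪ A))) := by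
  have hQ : ∀ m ∈ supp Q, ¬ A ⊆ m := fun m hm hA => h.2.2.2.2.2.1 ⟨m, hm, hA⟩
  constructor
  · rintro ⟨m, hm, hs⟩
    rcases h.mem_supp_right.1 hm with ⟨v, hv, p, hp, rfl⟩ | hm
    · have hAp : A ∪ p ∈ supp K := h.mem_supp_left.2 (Or.inl ⟨p, hp, rfl⟩)
      have hvp : v ∉ p := fun h' =>
        Finset.disjoint_left.1 h.2.2.1 hv ((face_of_mem_supp hp).subset_vars h')
      have hva : v ≠ a := fun h' => h.2.1 (h' ▸ hv)
      refine ⟨fun hAs => by simpa [hva, hvp] using hs (hAs hv), ?_⟩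
      by_cases ha : a ∈ s
      · refine Or.inr ⟨ha, _, hAp, fun x hx => ?_⟩
        have := @hs x
        simp at hx this ⊢
        tauto
      · refine Or.inl ⟨_, hAp, fun x hx => ?_⟩
        have hxa : x ≠ a := fun h' => ha (h' ▸ hx)
        have := hs hx
        simp at this ⊢
        tauto
    · exact ⟨fun hA => hQ m hm (hA.trans hs), Or.inl ⟨m, h.mem_supp_left.2 (Or.inr hm), hs⟩⟩
  · rintro ⟨hAs, h'⟩
    have key : ∀ p ∈ supp P, s.erase a ⊆ A ∪ p → Face K' s := by
      intro p hp hs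
      obtain ⟨v, hv, hvs⟩ := Finset.not_subset.1 hAs
      refine ⟨_, h.mem_supp_right.2 (Or.inl ⟨v, hv, p, hp, rfl⟩), fun x hx => ?_⟩
      have hxv : x ≠ v := fun h' => hvs (h' ▸ hx)
      have := @hs x
      simp at this ⊢
      tauto
    rcases h' with ⟨m, hm, hs⟩ | ⟨ha, m, hm, hs⟩
    · rcases h.mem_supp_left.1 hm with ⟨p, hp, rfl⟩ | hm
      · exact key p hp ((Finset.erase_subset _ _).trans hs)
      · exact ⟨m, h.mem_supp_right.2 (Or.inr hm), hs⟩
    · rcases h.mem_supp_left.1 hm with ⟨p, hp, rfl⟩ | hm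
      · exact key p hp (Finset.subset_union_left.trans hs)
      · exact absurd (Finset.subset_union_right.trans hs) (hQ m hm)

theorem StarAt.mem_cx_left {A : Finset ι} {a : ι} {P Q K K' : Chain ι} (h : StarAt A a P Q K K')
    (hP : P ≠ 0) : A ∈ cx K := ⟨h.1, h.face_left hP⟩

theorem StarAt.cx_eq {A : Finset ι} {a : ι} {P Q K K' : Chain ι} (h : StarAt A a P Q K K')
    (hP : P ≠ 0) : cx K' = starring A a (cx K) := by
  refine complex_ext fun s hs => ?_
  rw [mem_starring (h.mem_cx_left hP) (by rw [vertices_cx]; exact h.notMem_vars_left), mem_cx,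
    mem_cx, mem_cx, h.face_right]
  have : (s.erase a ∪ A).Nonempty := h.1.mono Finset.subset_union_right
  tauto

theorem StarAt.isStellarSubdivision {A : Finset ι} {a : ι} {P Q K K' : Chain ι}
    (h : StarAt A a P Q K K') (hP : P ≠ 0) : IsStellarSubdivision A a (cx K) (cx K') :=
  ⟨h.mem_cx_left hP, by rw [vertices_cx]; exact h.notMem_vars_left, h.cx_eq hP⟩

/-- By purity a face of full size is a facet; in this way a pure chain is recovered from its
complex. -/
theorem Hom.mem_supp {k : ℕ} {K : Chain ι} (h : Hom k K) {m : Finset ι} (hm : Face K m)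
    (hk : k ≤ m.card) : m ∈ supp K := by
  obtain ⟨m', hm', hs⟩ := hm
  rwa [Finset.eq_of_subset_of_card_le hs (by rw [h m' hm']; exact hk)]

/-- This undoes a subdivision without assuming that `L` is pure: purity of `K'` suffices to read off
the chain `P` of the link of `A`, and `L` is the complex of `A * P + Q` because starring is
injective. -/
theorem exists_starAt_of_starring_eq {A : Finset ι} {a : ι} {L : PreAbstractSimplicialComplex ι}
    {K' : Chain ι} {k : ℕ} (hA : A ∈ L) (ha : a ∉ vertices L) (hK' : cx K' = starring A a L)
    (hk : Hom k K') : ∃ K, Star K K' ∧ cx K = L := by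
  have hF : ∀ {s : Finset ι}, s.Nonempty →
      (Face K' s ↔ ¬ A ⊆ s ∧ (s ∈ L ∨ (a ∈ s ∧ s.erase a ∪ A ∈ L))) := by
    intro s hs
    have : s ∈ cx K' ↔ s ∈ starring A a L := by rw [hK']
    rw [mem_starring hA ha, mem_cx] at this
    tauto
  have hAne := nonempty_of_mem hA
  have haA := notMem_of_mem hA ha
  have hcone : ∀ {B : Finset ι} {v : ι}, v ∈ A → Disjoint A B → a ∉ B → A ∪ B ∈ L →
      Face K' (insert a (A.erase v ∪ B)) := by
    intro B v hv hd haB hAB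
    rw [hF (by simp)]
    have hvB : v ∉ B := Finset.disjoint_left.1 hd hv
    have hva : v ≠ a := fun h => haA (h ▸ hv)
    refine ⟨fun h => by simpa [hvB, hva] using h hv, Or.inr ⟨by simp, ?_⟩⟩
    convert hAB using 1
    ext x
    by_cases hx : x = a
    · simp [hx, haA, haB]
    · by_cases hxA : x ∈ A <;> simp [hx, hxA]
  -- every facet through `a` comes from a facet of the link of `A`
  have hfacet : ∀ m ∈ supp K', a ∈ m → (∃ v ∈ A, m = insert a (A.erase v ∪ (m.erase a \ A))) ∧
      A ∪ (m.erase a \ A) ∈ L := by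
    intro m hm ham
    obtain ⟨h1, h2⟩ := (hF ⟨a, ham⟩).1 (face_of_mem_supp hm)
    have h3 : A ∪ (m.erase a \ A) ∈ L := by
      rw [Finset.union_sdiff_self_eq_union, Finset.union_comm]
      rcases h2 with h2 | h2
      · exact absurd ham (notMem_of_mem h2 ha)
      · exact h2.2
    refine ⟨?_, h3⟩
    obtain ⟨v, hv, hvm⟩ := Finset.not_subset.1 h1
    refine ⟨v, hv, ?_⟩
    obtain ⟨m', hm', hs⟩ := hcone hv Finset.disjoint_sdiff (by simp) h3
    have hsub : m ⊆ insert a (A.erase v ∪ (m.erase a \ A)) := by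
      intro x hx
      have hxv : x ≠ v := fun h => hvm (h ▸ hx)
      simp only [Finset.mem_insert, Finset.mem_union, Finset.mem_erase, Finset.mem_sdiff]
      tauto
    have hmm : m = m' := Finset.eq_of_subset_of_card_le (hsub.trans hs)
      (by rw [hk m hm, hk m' hm'])
    exact hsub.antisymm (hs.trans hmm.ge)
  -- The candidate facets of the link of `A` are what remains of the facets through `a` after
  -- deletion of `a` and `A`.
  set T := ((supp K').filter (a ∈ ·)).image (fun m => m.erase a \ A) with hT
  set P : Chain ι := ∑ B ∈ T, e B with hP
  have hPsupp : ∀ {B}, B ∈ supp P ↔ ∃ m ∈ supp K', a ∈ m ∧ m.erase a \ A = B := by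
    intro B
    rw [hP, supp_sum_e (f := fun m => m) (Set.injOn_id _), Finset.image_id', hT]
    simp [and_assoc]
  have hAP : Disjoint A (vars P) := by
    rw [Finset.disjoint_right]
    intro x hx
    obtain ⟨B, hB, hxB⟩ := mem_vars.1 hx
    obtain ⟨m, -, -, rfl⟩ := hPsupp.1 hB
    exact (Finset.mem_sdiff.1 hxB).2
  have haP : a ∉ vars P := by
    intro hx
    obtain ⟨B, hB, hxB⟩ := mem_vars.1 hx
    obtain ⟨m, -, -, rfl⟩ := hPsupp.1 hB
    simp at hxB
  have hlk : lk {a} K' = d (e A) * P := by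
    apply chain_ext
    ext m
    rw [mem_supp_lk, mem_supp_d_e_mul hAP, Finset.disjoint_singleton_left]
    constructor
    · rintro ⟨ham, hm⟩
      rw [← Finset.insert_eq] at hm
      have he : (insert a m).erase a = m := Finset.erase_insert ham
      obtain ⟨⟨v, hv, h1⟩, -⟩ := hfacet _ hm (by simp)
      rw [he] at h1
      refine ⟨v, hv, _, hPsupp.2 ⟨_, hm, by simp, rfl⟩, ?_⟩
      have h2 := congrArg (fun s => Finset.erase s a) h1
      rw [he, Finset.erase_insert (by simp [haA, ham])] at h2
      rwa [he]
    · rintro ⟨v, hv, B, hB, rfl⟩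
      obtain ⟨m, hm, ham, rfl⟩ := hPsupp.1 hB
      obtain ⟨⟨w, hw, h1⟩, h2⟩ := hfacet m hm ham
      refine ⟨by simp [haA], ?_⟩
      rw [← Finset.insert_eq]
      -- For every choice of `v` in `A` the simplex obtained has the same size as the given facet,
      -- so purity makes it a facet too.
      refine hk.mem_supp (hcone hv Finset.disjoint_sdiff (by simp) h2) ?_
      rw [← hk m hm]
      conv_lhs => rw [h1]
      have hc : ∀ u ∈ A, (insert a (A.erase u ∪ (m.erase a \ A))).card =
          A.card + (m.erase a \ A).card := by
        intro u hu
        rw [Finset.card_insert_of_notMem (by simp [haA]), Finset.card_union_of_disjoint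
          (Finset.disjoint_of_subset_left (Finset.erase_subset _ _) Finset.disjoint_sdiff),
          ← Finset.card_erase_add_one hu]
        ring
      rw [hc w hw, hc v hv]
  have hst : StarAt A a P (dl {a} K') (e A * P + dl {a} K') K' := by
    refine ⟨hAne, haA, hAP, haP, ?_, fun h => ?_, rfl, ?_⟩
    · rw [mem_vars_iff_face]
      exact not_face_dl _ _
    · exact ((hF hAne).1 h.of_dl).1 subset_rfl
    · rw [mul_assoc, ← hlk]
      exact eq_lk_add_dl _ _
  have hP0 : P ≠ 0 := by
    have h1 : Face K' {a} := by
      rw [hF (Finset.singleton_nonempty a)]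
      refine ⟨fun h => ?_, Or.inr ⟨by simp, by simpa using hA⟩⟩
      obtain ⟨v, hv⟩ := hAne
      exact haA (Finset.mem_singleton.1 (h hv) ▸ hv)
    rw [← lk_ne_zero, hlk] at h1
    rintro h
    rw [h, mul_zero] at h1
    exact h1 rfl
  refine ⟨_, ⟨A, a, P, _, hst⟩, ?_⟩
  exact starring_injective (hst.mem_cx_left hP0)
    (by rw [vertices_cx]; exact hst.notMem_vars_left) hA ha (by rw [← hst.cx_eq hP0, hK'])

end ChainComplex

end

end StellarChain

/-! ### Transport of complexes along maps injective on vertices. -/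

namespace StellarChain

noncomputable section

open Stellar

section Map

variable {W ι : Type*} [DecidableEq W] [DecidableEq ι]

theorem mem_map {C : PreAbstractSimplicialComplex W} {f : W → ι} {s : Finset ι} :
    s ∈ C.map f ↔ ∃ t ∈ C, t.image f = s := Iff.rfl

theorem vertices_map (C : PreAbstractSimplicialComplex W) (f : W → ι) :
    vertices (C.map f) = f '' vertices C := by
  ext x
  constructor
  · rintro ⟨t, ht, h⟩
    obtain ⟨y, hy, rfl⟩ := Finset.mem_image.1 (h.ge (Finset.mem_singleton_self x))
    exact ⟨y, subset_vertices ht hy, rfl⟩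
  · rintro ⟨y, hy, rfl⟩
    exact ⟨{y}, hy, Finset.image_singleton f y⟩

theorem map_congr {C : PreAbstractSimplicialComplex W} {f g : W → ι}
    (h : Set.EqOn f g (vertices C)) : C.map f = C.map g := by
  have key : ∀ t ∈ C, t.image f = t.image g := fun t ht =>
    Finset.image_congr fun x hx => h (subset_vertices ht hx)
  refine complex_ext fun s _ => ?_
  simp only [mem_map]
  exact exists_congr fun t => and_congr_right fun ht => by rw [key t ht]

theorem image_mem_map {C : PreAbstractSimplicialComplex W} {f : W → ι} {U : Set W}
    (hf : Set.InjOn f U) (hU : vertices C ⊆ U) {t : Finset W} (ht : (t : Set W) ⊆ U) :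
    t.image f ∈ C.map f ↔ t ∈ C := by
  refine ⟨?_, fun h => ⟨t, h, rfl⟩⟩
  rintro ⟨t', ht', h⟩
  have : t' = t := by
    apply Finset.coe_injective
    refine (hf.image_eq_image_iff (fun x hx => hU (subset_vertices ht' hx)) ht).1 ?_
    simpa using congrArg (fun s : Finset ι => (s : Set ι)) h
  exact this ▸ ht'

theorem vertices_starring_subset {L : PreAbstractSimplicialComplex W} {A : Finset W} {a : W}
    (hA : A ∈ L) (ha : a ∉ vertices L) : vertices (starring A a L) ⊆ insert a (vertices L) := by
  intro x hx
  rcases ((mem_starring hA ha).1 hx).2.2 with h | h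
  · exact Or.inr h
  · exact Or.inl (Finset.mem_singleton.1 h.1).symm

/-- Starring at a vertex deletes it, so the vertices of `A` have to be added back. -/
theorem insert_vertices_subset {L : PreAbstractSimplicialComplex W} {A : Finset W} {a : W}
    (hA : A ∈ L) (ha : a ∉ vertices L) :
    insert a (vertices L) ⊆ vertices (starring A a L) ∪ (insert a A : Finset W) := by
  rintro x (rfl | hx)
  · exact Or.inr (by simp)
  · by_cases hxA : A ⊆ {x}
    · obtain ⟨v, hv⟩ := nonempty_of_mem hA
      exact Or.inr (by simp [← Finset.mem_singleton.1 (hxA hv), hv])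
    · exact Or.inl ((mem_starring hA ha).2 ⟨Finset.singleton_nonempty x, hxA, Or.inl hx⟩)

theorem notMem_vertices_map {L : PreAbstractSimplicialComplex W} {a : W} (ha : a ∉ vertices L)
    {f : W → ι} (hf : Set.InjOn f (insert a (vertices L))) : f a ∉ vertices (L.map f) := by
  rw [vertices_map]
  rintro ⟨x, hx, h⟩
  exact ha (hf (Or.inr hx) (Or.inl rfl) h ▸ hx)

theorem map_starring {L : PreAbstractSimplicialComplex W} {A : Finset W} {a : W}
    (hA : A ∈ L) (ha : a ∉ vertices L) {f : W → ι} (hf : Set.InjOn f (insert a (vertices L))) :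
    (starring A a L).map f = starring (A.image f) (f a) (L.map f) := by
  set U := insert a (vertices L) with hU
  have hAU : (A : Set W) ⊆ U := fun x hx => Or.inr (subset_vertices hA hx)
  have hLU : vertices L ⊆ U := Set.subset_insert _ _
  have hA' : A.image f ∈ L.map f := ⟨A, hA, rfl⟩
  have ha' := notMem_vertices_map ha hf
  have key : ∀ t : Finset W, (t : Set W) ⊆ U →
      (t.image f ∈ starring (A.image f) (f a) (L.map f) ↔ t ∈ starring A a L) := by
    intro t ht
    have h1 : A.image f ⊆ t.image f ↔ A ⊆ t := by
      rw [← Finset.coe_subset, Finset.coe_image, Finset.coe_image,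
        hf.image_subset_image_iff hAU ht, Finset.coe_subset]
    have h2 : f a ∈ t.image f ↔ a ∈ t := by
      rw [Finset.mem_image]
      refine ⟨?_, fun h => ⟨a, h, rfl⟩⟩
      rintro ⟨x, hx, h⟩
      exact hf (ht hx) (Or.inl rfl) h ▸ hx
    have h3 : (t.image f).erase (f a) = (t.erase a).image f := by
      ext y
      simp only [Finset.mem_erase, Finset.mem_image]
      constructor
      · rintro ⟨hy, x, hx, rfl⟩
        exact ⟨x, ⟨fun h => hy (by rw [h]), hx⟩, rfl⟩
      · rintro ⟨x, ⟨hxa, hx⟩, rfl⟩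
        exact ⟨fun h => hxa (hf (ht hx) (Or.inl rfl) h), x, hx, rfl⟩
    have h4 : ((t.erase a ∪ A : Finset W) : Set W) ⊆ U := by
      rw [Finset.coe_union]
      exact Set.union_subset (fun x hx => ht (Finset.mem_of_mem_erase hx)) hAU
    rw [mem_starring hA ha, mem_starring hA' ha', h1, h2, h3, ← Finset.image_union,
      image_mem_map hf hLU ht, image_mem_map hf hLU h4, Finset.image_nonempty]
  refine complex_ext fun s _ => ⟨?_, fun h => ?_⟩
  · rintro ⟨t, ht, rfl⟩
    exact (key t fun x hx =>
      vertices_starring_subset hA ha (subset_vertices ht hx)).2 ht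
  · obtain ⟨r, hr, hs⟩ : ∃ r ∈ L, s ⊆ (insert a r).image f := by
      rcases ((mem_starring hA' ha').1 h).2.2 with ⟨r, hr, h1⟩ | ⟨-, r, hr, h1⟩
      · exact ⟨r, hr, h1 ▸ Finset.image_subset_image (Finset.subset_insert _ _)⟩
      · change r.image f = _ at h1
        refine ⟨r, hr, fun x hx => ?_⟩
        rw [Finset.image_insert, h1]
        by_cases hxa : x = f a <;> simp [hxa, hx]
    obtain ⟨t, ht, rfl⟩ := Finset.subset_image_iff.1 hs
    refine ⟨t, (key t fun x hx => ?_).1 h, rfl⟩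
    rcases Finset.mem_insert.1 (ht hx) with rfl | h1
    · exact Or.inl rfl
    · exact Or.inr (subset_vertices hr h1)

/-- A map given on the vertices of one complex may behave badly on the vertices that a move adds or
restores; there it is redefined with unused values. -/
theorem exists_injOn_extension [Infinite ι] {f : W → ι} {S : Set W} (hS : (f '' S).Finite)
    (hf : Set.InjOn f S) (B : Finset W) :
    ∃ g : W → ι, Set.EqOn g f S ∧ Set.InjOn g (S ∪ B) := by
  induction B using Finset.induction_on with
  | empty => exact ⟨f, fun _ _ => rfl, by simpa using hf⟩
  | insert b B _ ih =>
    obtain ⟨g, h1, h2⟩ := ih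
    by_cases hb : b ∈ S ∪ B
    · refine ⟨g, h1, ?_⟩
      rwa [Finset.coe_insert, Set.union_insert, Set.insert_eq_of_mem hb]
    have hfin : (g '' (S ∪ B)).Finite := by
      rw [Set.image_union, h1.image_eq]
      exact hS.union (B.finite_toSet.image g)
    obtain ⟨z, hz⟩ := hfin.exists_notMem
    have h3 : Set.EqOn (Function.update g b z) g (S ∪ B) := fun x hx =>
      Function.update_of_ne (fun h => hb (by rwa [h] at hx)) _ _
    refine ⟨Function.update g b z, fun x hx => (h3 (Or.inl hx)).trans (h1 hx), ?_⟩
    rw [Finset.coe_insert, Set.union_insert, Set.injOn_insert hb, h3.image_eq,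
      Function.update_self]
    exact ⟨h2.congr h3.symm, hz⟩

theorem simplicialIso_map {C : PreAbstractSimplicialComplex W} {f : W → ι}
    (hf : Set.InjOn f (vertices C)) : SimplicialIso C (C.map f) := by
  refine ⟨(Equiv.Set.imageOfInjOn f _ hf).trans (Equiv.setCongr (vertices_map C f).symm),
    fun s => ?_⟩
  rw [← image_mem_map hf subset_rfl (t := s.map (Function.Embedding.subtype _))]
  · rw [iff_iff_eq]
    congr 1
    ext y
    simp only [Finset.mem_image, Finset.mem_map, Function.Embedding.coe_subtype,
      Equiv.coe_toEmbedding, exists_exists_and_eq_and]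
    rfl
  · intro x hx
    obtain ⟨y, -, rfl⟩ := Finset.mem_map.1 hx
    exact y.2

theorem SimplicialIso.symm {K : PreAbstractSimplicialComplex W} {L : PreAbstractSimplicialComplex ι}
    (h : SimplicialIso K L) : SimplicialIso L K := by
  obtain ⟨e, he⟩ := h
  refine ⟨e.symm, fun s => ?_⟩
  rw [he (s.map e.symm.toEmbedding)]
  simp [Finset.map_map]

theorem exists_map_eq_of_simplicialIso {X : Type*} [DecidableEq X] [Nonempty X]
    {K : PreAbstractSimplicialComplex W} {L : PreAbstractSimplicialComplex ι}
    (h : SimplicialIso K L) {f : ι → X} (hf : Set.InjOn f (vertices L)) :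
    ∃ g : W → X, Set.InjOn g (vertices K) ∧ K.map g = L.map f := by
  classical
  obtain ⟨e, he⟩ := h
  set g : W → X := fun x => if h : x ∈ vertices K then f (e ⟨x, h⟩) else Classical.arbitrary X
    with hg
  have hgx : ∀ x : vertices K, g x = f (e x) := fun x => by simp [hg]
  have him : ∀ s : Finset (vertices K), (s.map (Function.Embedding.subtype _)).image g =
      ((s.map e.toEmbedding).map (Function.Embedding.subtype _)).image f := by
    intro s
    ext y
    simp only [Finset.mem_image, Finset.mem_map, Function.Embedding.coe_subtype,
      Equiv.coe_toEmbedding, exists_exists_and_eq_and, hgx]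
  refine ⟨g, fun x hx y hy hxy => ?_, complex_ext fun s _ => ⟨?_, ?_⟩⟩
  · have h1 := (hgx ⟨x, hx⟩).symm.trans (hxy.trans (hgx ⟨y, hy⟩))
    have h2 := e.injective (Subtype.ext (hf (e _).2 (e _).2 h1))
    exact congrArg Subtype.val h2
  · rintro ⟨t, ht, rfl⟩
    have h1 : (t.subtype (· ∈ vertices K)).map (Function.Embedding.subtype _) = t :=
      Finset.subtype_map_of_mem fun x hx => subset_vertices ht hx
    refine ⟨_, (he (t.subtype (· ∈ vertices K))).1 (by rwa [h1]), ?_⟩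
    beta_reduce
    rw [← him, h1]
  · rintro ⟨t, ht, rfl⟩
    have h1 : (t.subtype (· ∈ vertices L)).map (Function.Embedding.subtype _) = t :=
      Finset.subtype_map_of_mem fun x hx => subset_vertices ht hx
    have h2 : ((t.subtype (· ∈ vertices L)).map e.symm.toEmbedding).map e.toEmbedding =
        t.subtype (· ∈ vertices L) := by simp [Finset.map_map]
    refine ⟨_, (he ((t.subtype (· ∈ vertices L)).map e.symm.toEmbedding)).2 (by rwa [h2, h1]), ?_⟩
    beta_reduce
    rw [him, h2, h1]

end Map

/-! ### Representing balls and spheres by chains. -/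

section Rep

variable {ι : Type*} [DecidableEq ι] [Infinite ι]

/-- Injective on vertices, `f` maps the complex `C` onto the complex of the chain `K`. -/
def IsRep {W : Type*} (f : W → ι) (K : Chain ι) (C : PreAbstractSimplicialComplex W) : Prop :=
  Set.InjOn f (vertices C) ∧ C.map f = cx K

theorem IsRep.finite {W : Type*} {f : W → ι} {K : Chain ι} {C : PreAbstractSimplicialComplex W}
    (h : IsRep f K C) : (f '' vertices C).Finite := by
  classical
  rw [← vertices_map, h.2, vertices_cx]
  exact Finset.finite_toSet _

theorem IsRep.congr {W : Type*} {f g : W → ι} {K : Chain ι} {C : PreAbstractSimplicialComplex W}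
    (h : IsRep f K C) (hg : Set.EqOn g f (vertices C)) : IsRep g K C := by
  classical
  exact ⟨h.1.congr hg.symm, by rw [map_congr hg, h.2]⟩

theorem IsRep.exists_of_subdivision {W : Type*} {f : W → ι} {K' : Chain ι}
    {L M : PreAbstractSimplicialComplex W} {A : Finset W} {a : W} {k : ℕ}
    (h : IsRep f K' M) (hk : Hom k K') (hs : IsStellarSubdivision A a L M) :
    ∃ g K, IsRep g K L ∧ Star K K' := by
  classical
  obtain ⟨hA, ha, rfl⟩ := hs
  obtain ⟨g, h1, h2⟩ := exists_injOn_extension h.finite h.1 (insert a A)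
  have hinj := h2.mono (insert_vertices_subset hA ha)
  have hg := h.congr h1
  have h3 := hg.2
  rw [map_starring hA ha hinj] at h3
  obtain ⟨K, hK, hKL⟩ := exists_starAt_of_starring_eq (K' := K') (k := k) (A := A.image g)
    (L := L.map g) ⟨A, hA, rfl⟩ (notMem_vertices_map ha hinj) h3.symm hk
  exact ⟨g, K, ⟨hinj.mono (Set.subset_insert _ _), hKL.symm⟩, hK⟩

theorem IsRep.exists_of_weld {W : Type*} {f : W → ι} {K : Chain ι}
    {L M : PreAbstractSimplicialComplex W} {A : Finset W} {a : W}
    (h : IsRep f K L) (hs : IsStellarSubdivision A a L M) :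
    ∃ g K', IsRep g K' M ∧ Star K K' := by
  classical
  obtain ⟨hA, ha, rfl⟩ := hs
  obtain ⟨g, h1, h2⟩ := exists_injOn_extension h.finite h.1 {a}
  have hinj : Set.InjOn g (insert a (vertices L)) := h2.mono (by
    rw [Finset.coe_singleton, Set.union_singleton])
  have hg := h.congr h1
  have hA' : A.image g ∈ cx K := hg.2 ▸ ⟨A, hA, rfl⟩
  have ha' : g a ∉ vertices (cx K) := hg.2 ▸ notMem_vertices_map ha hinj
  have hst := StarAt.mk_lk hA'.1 (notMem_of_mem hA' ha') (by rwa [vertices_cx] at ha')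
  refine ⟨g, _, ⟨hinj.mono (vertices_starring_subset hA ha), ?_⟩, _, _, _, _, hst⟩
  rw [map_starring hA ha hinj, hst.cx_eq (lk_ne_zero.2 hA'.2), hg.2]

/-- The representation is carried from the end of the move sequence back to its start. Undoing a
weld subdivides the chain; undoing a subdivision welds it, which is possible because the chain is
pure, a property preserved by moves. -/
theorem exists_isRep {V : Type u} {C : PreAbstractSimplicialComplex V} {W : Type u}
    {L : PreAbstractSimplicialComplex W} (h : StellarEquiv C L) {f : W → ι} {K : Chain ι} {k : ℕ}
    (hK : IsRep f K L) (hk : Hom k K) : ∃ g K', IsRep (W := V) g K' C ∧ Eqv K' K := by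
  induction h generalizing K with
  | refl => exact ⟨f, K, hK, .refl K⟩
  | subdivide A a _ hs ih =>
    obtain ⟨g, K', h1, h2⟩ := hK.exists_of_subdivision hk hs
    obtain ⟨g', K'', h3, h4⟩ := ih h1 (h2.eqv.hom.2 hk)
    exact ⟨g', K'', h3, h4.trans h2.eqv⟩
  | weld A a _ hs ih =>
    obtain ⟨g, K', h1, h2⟩ := hK.exists_of_weld hs
    obtain ⟨g', K'', h3, h4⟩ := ih h1 (h2.eqv.hom.1 hk)
    exact ⟨g', K'', h3, h4.trans h2.eqv.symm⟩
  | iso _ hi ih =>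
    classical
    obtain ⟨g, h1, h2⟩ := exists_map_eq_of_simplicialIso hi hK.1
    exact ih ⟨h1, h2.trans hK.2⟩ hk

theorem stellarEquiv_cx_iff {ι : Type u} [DecidableEq ι] [Infinite ι] {V : Type u}
    {C : PreAbstractSimplicialComplex V} {K L : Chain ι} (h : Eqv K L) :
    StellarEquiv C (cx K) ↔ StellarEquiv C (cx L) := by
  induction h with
  | rel K L h =>
    obtain ⟨A, a, P, Q, h⟩ := h
    by_cases hP : P = 0
    · subst hP
      rw [h.eq_of_zero]
    · exact ⟨fun h' => h'.subdivide A a (h.isStellarSubdivision hP),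
        fun h' => h'.weld A a (h.isStellarSubdivision hP)⟩
  | refl K => rfl
  | symm K L _ ih => exact ih.symm
  | trans K L M _ _ ih1 ih2 => exact ih1.trans ih2

theorem exists_injective_image_eq {n : ℕ} {D : Finset ι} (hD : D.card = n + 1) :
    ∃ f : ULift (Fin (n + 1)) → ι, Function.Injective f ∧ Finset.univ.image f = D := by
  have e : ULift (Fin (n + 1)) ≃ D := Equiv.ulift.trans (D.equivFinOfCardEq hD).symm
  refine ⟨fun x => e x, Subtype.val_injective.comp e.injective, ?_⟩
  ext x
  simp only [Finset.mem_image, Finset.mem_univ, true_and]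
  exact ⟨by rintro ⟨y, rfl⟩; exact (e y).2, fun h => ⟨e.symm ⟨x, h⟩, by simp⟩⟩

theorem isRep_stdComplex {n : ℕ} {f : ULift (Fin (n + 1)) → ι} (hf : Function.Injective f) :
    IsRep f (e (Finset.univ.image f)) (stdComplex n) := by
  refine ⟨hf.injOn, complex_ext fun s hs => ?_⟩
  rw [mem_map, mem_cx, face_e, Finset.subset_image_iff]
  constructor
  · rintro ⟨t, -, rfl⟩
    exact ⟨hs, t, by simp, rfl⟩
  · rintro ⟨-, t, ht, rfl⟩
    exact ⟨t, ⟨Finset.image_nonempty.1 hs, Finset.subset_univ _⟩, rfl⟩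

theorem isRep_stdBoundary {n : ℕ} {f : ULift (Fin (n + 1)) → ι} (hf : Function.Injective f) :
    IsRep f (d (e (Finset.univ.image f))) (stdBoundary n) := by
  refine ⟨hf.injOn, complex_ext fun s hs => ?_⟩
  rw [mem_map, mem_cx, face_d_e]
  constructor
  · rintro ⟨t, ht, rfl⟩
    exact ⟨hs, (Finset.image_ssubset_image hf).2 ht.2⟩
  · rintro ⟨-, h⟩
    obtain ⟨t, ht, rfl⟩ := Finset.subset_image_iff.1 h.1
    exact ⟨t, ⟨Finset.image_nonempty.1 hs, (Finset.image_ssubset_image hf).1 h⟩, rfl⟩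

theorem exists_isRep_ball {V : Type u} {C : PreAbstractSimplicialComplex V} {n : ℕ}
    (h : IsStellarBall n C) : ∃ (f : V → ι) (K : Chain ι), IsRep f K C ∧ Ball (n + 1) K := by
  obtain ⟨D, -, hD⟩ := (Set.infinite_univ (α := ι)).exists_subset_card_eq (n + 1)
  obtain ⟨f, hf, rfl⟩ := exists_injective_image_eq (ι := ι) hD
  have hb := ball_e (ι := ι) (D := Finset.univ.image f) (Finset.card_pos.1 (by rw [hD]; omega))
  rw [hD] at hb
  obtain ⟨g, K, h1, h2⟩ := exists_isRep h (isRep_stdComplex hf) (BallOrSph.hom (Or.inl hb))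
  exact ⟨g, K, h1, hb.of_eqv h2⟩

theorem exists_isRep_sphere {V : Type u} {C : PreAbstractSimplicialComplex V} {n : ℕ}
    (h : IsStellarSphere n C) : ∃ (f : V → ι) (K : Chain ι), IsRep f K C ∧ Sph (n + 1) K := by
  obtain ⟨D, -, hD⟩ := (Set.infinite_univ (α := ι)).exists_subset_card_eq (n + 1 + 1)
  obtain ⟨f, hf, rfl⟩ := exists_injective_image_eq (ι := ι) hD
  have hb : Sph (n + 1) (d (e (Finset.univ.image f))) := ⟨_, hD, .refl _⟩
  obtain ⟨g, K, h1, h2⟩ := exists_isRep h (isRep_stdBoundary hf) (BallOrSph.hom (Or.inr hb))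
  exact ⟨g, K, h1, hb.of_eqv h2⟩

theorem IsRep.isStellarBall {ι V : Type u} [DecidableEq ι] [Infinite ι]
    {C : PreAbstractSimplicialComplex V} {n : ℕ} {f : V → ι} {K : Chain ι} (h : IsRep f K C)
    (hK : Ball (n + 1) K) : IsStellarBall n C := by
  classical
  obtain ⟨-, D, hD, hKD⟩ := hK
  obtain ⟨g, hg, rfl⟩ := exists_injective_image_eq hD
  have h1 : StellarEquiv C (cx K) := StellarEquiv.refl.iso (h.2 ▸ simplicialIso_map h.1)
  have h2 := isRep_stdComplex hg
  exact ((stellarEquiv_cx_iff hKD).1 h1).iso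
    (SimplicialIso.symm (h2.2 ▸ simplicialIso_map h2.1))

end Rep

/-! ### Complements, and the theorem for complexes. -/

section Complement

variable {ι : Type*} [DecidableEq ι] [Infinite ι] {V : Type*}

theorem map_le_map {S K : PreAbstractSimplicialComplex V} (h : K ≤ S) (f : V → ι) :
    K.map f ≤ S.map f := by
  rintro _ ⟨t, ht, rfl⟩
  exact ⟨t, h ht, rfl⟩

theorem mem_cx_rn {σ : Equiv.Perm ι} {K : Chain ι} {s : Finset ι} :
    s ∈ cx (rn σ K) ↔ ∃ t ∈ cx K, t.image σ = s := by
  simp only [mem_cx]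
  constructor
  · rintro ⟨hs, m, hm, hsm⟩
    rw [supp_rn, Finset.mem_image] at hm
    obtain ⟨m', hm', rfl⟩ := hm
    rw [Finset.map_eq_image] at hsm
    obtain ⟨t, ht, rfl⟩ := Finset.subset_image_iff.1 hsm
    exact ⟨t, ⟨Finset.image_nonempty.1 hs, m', hm', ht⟩, rfl⟩
  · rintro ⟨t, ⟨ht, m, hm, htm⟩, rfl⟩
    refine ⟨Finset.image_nonempty.2 ht, m.map σ.toEmbedding, ?_, ?_⟩
    · rw [supp_rn]
      exact Finset.mem_image_of_mem _ hm
    · rw [Finset.map_eq_image]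
      exact Finset.image_subset_image htm

theorem IsRep.rn {C : PreAbstractSimplicialComplex V} {f : V → ι} {K : Chain ι}
    (h : IsRep f K C) (σ : Equiv.Perm ι) : IsRep (σ ∘ f) (rn σ K) C := by
  classical
  refine ⟨σ.injective.comp_injOn h.1, complex_ext fun s _ => ?_⟩
  rw [mem_cx_rn, ← h.2, mem_map]
  constructor
  · rintro ⟨t, ht, rfl⟩
    exact ⟨t.image f, ⟨t, ht, rfl⟩, by rw [Finset.image_image]⟩
  · rintro ⟨_, ⟨t, ht, rfl⟩, rfl⟩
    exact ⟨t, ht, by rw [Finset.image_image]⟩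

/-- Two representations of one complex differ by an injection on finitely many vertices, and this
extends to a permutation. -/
theorem IsRep.exists_rn {C : PreAbstractSimplicialComplex V} {f g : V → ι} {K : Chain ι}
    (h : IsRep g K C) (hf : Set.InjOn f (vertices C)) :
    ∃ σ : Equiv.Perm ι, IsRep f (StellarChain.rn σ K) C := by
  classical
  rcases isEmpty_or_nonempty V with hV | hV
  · exact ⟨1, (h.rn 1).congr fun x => (hV.false x).elim⟩
  have hinv : ∀ x ∈ vertices C, Function.invFunOn g (vertices C) (g x) = x := fun x hx =>
    h.1.leftInvOn_invFunOn hx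
  have hvars : (vars K : Set ι) = g '' vertices C := by rw [← vertices_cx, ← h.2, vertices_map]
  obtain ⟨σ, -, hσ⟩ := exists_perm_of_injOn (vars K) (f ∘ Function.invFunOn g (vertices C)) (by
    rw [hvars]
    rintro _ ⟨x, hx, rfl⟩ _ ⟨y, hy, rfl⟩ hxy
    simp only [Function.comp, hinv x hx, hinv y hy] at hxy
    rw [hf hx hy hxy])
  refine ⟨σ, (h.rn σ).congr fun x hx => ?_⟩
  have hgx : g x ∈ vars K := by
    rw [← Finset.mem_coe, hvars]
    exact ⟨x, hx, rfl⟩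
  rw [Function.comp_apply, hσ _ hgx, Function.comp_apply, hinv x hx]

theorem vertices_closureDiff_subset (S K : PreAbstractSimplicialComplex V) :
    vertices (closureDiff S K) ⊆ vertices S := by
  classical
  rintro x ⟨-, s, hs, -, hx⟩
  exact subset_vertices hs (by simpa using hx)

/-- Both complexes are pure of the same dimension, so facets of `K` are facets of `S` and the mod 2
sum lists the facets of `S` outside `K`. A simplex not in `K` lies only in facets not in `K`, so
these facets generate the closure. -/
theorem IsRep.closureDiff {S K : PreAbstractSimplicialComplex V} {f : V → ι} {X Y : Chain ι}
    {k : ℕ} (hS : IsRep f X S) (hK : IsRep f Y K) (hkX : Hom k X) (hkY : Hom k Y) (hk : 1 ≤ k)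
    (hKS : K ≤ S) : supp Y ⊆ supp X ∧ IsRep f (X + Y) (Stellar.closureDiff S K) := by
  classical
  have hle : cx Y ≤ cx X := by rw [← hS.2, ← hK.2]; exact map_le_map hKS f
  have hne : ∀ m ∈ supp X, m.Nonempty := fun m hm =>
    Finset.card_pos.1 (by rw [hkX m hm]; exact hk)
  have hsub : supp Y ⊆ supp X := fun m hm => hkX.mem_supp
    (hle ⟨Finset.card_pos.1 (by rw [hkY m hm]; exact hk), face_of_mem_supp hm⟩ :
      m ∈ cx X).2 (hkY m hm).ge
  have hsupp : ∀ m, m ∈ supp (X + Y) ↔ m ∈ supp X ∧ m ∉ supp Y := by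
    intro m
    have := @hsub m
    rw [mem_supp_add]
    unfold Xor
    tauto
  refine ⟨hsub, hS.1.mono (vertices_closureDiff_subset S K), complex_ext fun r hr => ?_⟩
  constructor
  · rintro ⟨t, ⟨htne, s, hs, hsK, hts⟩, rfl⟩
    have h1 : s.image f ∈ cx X := hS.2 ▸ ⟨s, hs, rfl⟩
    obtain ⟨m, hm, hsm⟩ := h1.2
    refine ⟨hr, m, (hsupp m).2 ⟨hm, fun hmY => hsK ?_⟩, (Finset.image_subset_image hts).trans hsm⟩
    have h2 : s.image f ∈ K.map f := by
      rw [hK.2]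
      exact ⟨h1.1, m, hmY, hsm⟩
    obtain ⟨s', hs', h3⟩ := h2
    have h4 : s' = s := by
      apply Finset.coe_injective
      refine (hS.1.image_eq_image_iff (fun x hx => subset_vertices (hKS hs') hx)
        (fun x hx => subset_vertices hs hx)).1 ?_
      simpa using congrArg (fun s : Finset ι => (s : Set ι)) h3
    exact h4 ▸ hs'
  · rintro ⟨-, m, hm, hrm⟩
    obtain ⟨hmX, hmY⟩ := (hsupp m).1 hm
    obtain ⟨s, hs, rfl⟩ : m ∈ S.map f := by
      rw [hS.2]
      exact ⟨hne m hmX, face_of_mem_supp hmX⟩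
    obtain ⟨t, ht, rfl⟩ := Finset.subset_image_iff.1 hrm
    refine ⟨t, ⟨Finset.image_nonempty.1 hr, s, hs, fun hsK => hmY ?_, ht⟩, rfl⟩
    have h1 : s.image f ∈ cx Y := hK.2 ▸ ⟨s, hsK, rfl⟩
    exact hkY.mem_supp h1.2 (hkX _ hmX).ge

end Complement

theorem isStellarBall_closureDiff {V : Type u} {n : ℕ} {S K : PreAbstractSimplicialComplex V}
    (hS : IsStellarSphere n S) (hK : IsStellarBall n K) (hKS : K ≤ S) :
    IsStellarBall n (closureDiff S K) := by
  classical
  -- `V` may be finite and have no room for new vertices; `ULift ℕ` is infinite and lives in the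
  -- universe in which stellar equivalence is defined.
  obtain ⟨f, X, hfX, hX⟩ := exists_isRep_sphere (ι := ULift.{u} ℕ) hS
  obtain ⟨g, Y', hgY, hY'⟩ := exists_isRep_ball (ι := ULift.{u} ℕ) hK
  -- The representations of `S` and `K` were obtained independently; that of `K` is renamed so that
  -- both use the map `f`.
  obtain ⟨σ, hfY⟩ := hgY.exists_rn (hfX.1.mono fun x hx => hKS hx)
  have hY := hY'.rn σ
  set Y := rn σ Y'
  obtain ⟨hsub, hrep⟩ := hfX.closureDiff hfY (BallOrSph.hom (Or.inr hX))
    (BallOrSph.hom (Or.inl hY)) (by omega) hKS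
  refine hrep.isStellarBall (hY.complBall (X + Y) ?_ ?_)
  · rwa [show Y + (X + Y) = X by linear_combination Y * two_eq_zero (ι := ULift.{u} ℕ)]
  · rw [Finset.disjoint_left]
    intro m hm hm'
    have := hsub hm
    rw [mem_supp_add] at hm'
    unfold Xor at hm'
    tauto

end

end StellarChain

theorem theorem3p8 {V : Type*} (n : ℕ) (S K : PreAbstractSimplicialComplex V)
    (hS : Stellar.IsStellarSphere n S) (hK : Stellar.IsStellarBall n K) (hKS : K ≤ S) :
    Stellar.IsStellarBall n (Stellar.closureDiff S K) :=
  StellarChain.isStellarBall_closureDiff hS hK hKS
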